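/- A \emph{structure} is a set $\mathcal M$ of predicates (sets $A\subseteq\omega^n$ together with their arity) and function symbols (total functions $\omega^n\to\omega$ together with their arity), each interpreted by itself over the natural numbers, which contains the arithmetic $\mathbf A=\{=,<,S,+,\cdot\}$. It is \emph{$L$-finite} if it is a finite set. A set $B\subseteq\omega^k$ is definable in $\mathcal M$ if it is defined by a first-order formula over the symbols of $\mathcal M$; $\mathcal D(\mathcal M)$ is the set of all $X\subseteq\omega$ definable in $\mathcal M$, and $\mathcal M\sim\mathcal M'$ means $\mathcal D(\mathcal M)=\mathcal D(\mathcal M')$. A \emph{universal predicate} for $\mathcal M$ is a $G\subseteq\omega^2$ with $\mathcal D(\mathcal M)\subseteq\{G(n,\cdot):n\in\omega\}$; a universal predicate $P$ for $\mathcal M$ is \emph{canonic} if $P$ is definable in $\mathcal M\cup\{G\}$ for every universal predicate $G$ for $\mathcal M$. A \emph{Tarski hierarchy} over $\mathcal N$ is a sequence of structures $\{\mathcal M_\alpha\}_{\alpha\le\lambda}$ such that (1) $\mathcal M_0=\mathcal N$; (2) for every $\alpha<\lambda$ there is a canonic universal predicate $P_\alpha$ for $\mathcal M_\alpha$ with $\mathcal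 M_{\alpha+1}=\mathcal M_\alpha\cup\{P_\alpha\}$; (3) $\mathcal M_\beta=\bigcup_{\alpha<\beta}\mathcal M_\alpha$ for every limit ordinal $\beta\le\lambda$; (4) $\lambda$ is maximal, i.e. the sequence cannot be continued to a longer one satisfying (1)-(3). A tuple $A=(A_1,\dots,A_s)$ of sets $A_i\subseteq\omega^{k_i}$ has a \emph{proper implicit definition} in $\mathcal M$ if it is the only tuple of these arities that satisfies some closed formula over $\mathcal M$ with unquantified second-order variables of arities $k_1,\dots,k_s$. A set $B\subseteq\omega^k$ is \emph{implicitly definable} in $\mathcal M$ if it is definable in $\mathcal M\cup\{A_1,\dots,A_s\}$ for some tuple $A$ with a proper implicit definition in $\mathcal M$. $\mathcal I(\mathcal M)$ is $\mathcal M$ together with all $X\subseteq\omega$ implicitly definable in $\mathcal M$. $B$ is \emph{hyperarithmetical} in $\mathcal M$ if it is $\Delta^1_1$-definable in $\mathcal M$. An ordinal is definable (recursive) in $\mathcal M$ if it is the order type of a well-ordering of a subset of $\omega$ whose non-strict order relation, as a subset of $\omega^2$, is definable in $\mathcal M$ (computable with oracles for the symbols of $\mathcal M$). $Ord(\mathcal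 M)$ is the first ordinal that is not definable in $\mathcal M$. \textbf{Theorem.} Let $\mathcal N$ be an $L$-finite structure. Then a Tarski hierarchy over $\mathcal N$ exists. For every Tarski hierarchy $\{\mathcal M_\alpha\}_{\alpha\le\lambda}$ over $\mathcal N$, $\lambda=\lambda(\mathcal N)$ is the greatest length of any sequence satisfying (1)-(3); $\lambda(\mathcal N)$ is countable; and $\lambda(\mathcal N)=Ord(\mathcal N)$, which is also the first ordinal that is not recursive in $\mathcal N$. Furthermore $\mathcal M_{\lambda(\mathcal N)}$ is the minimal structure containing all sets implicitly definable in $\mathcal N$: every set implicitly definable in $\mathcal N$ is definable in $\mathcal M_{\lambda(\mathcal N)}$, every set definable in $\mathcal M_{\lambda(\mathcal N)}$ is definable in each structure in which all $X\subseteq\omega$ implicitly definable in $\mathcal N$ are definable, and $\mathcal M_{\lambda(\mathcal N)}\sim\mathcal I(\mathcal N)$. For every $B\subseteq\omega^k$, $B$ is definable in $\mathcal M_{\lambda(\mathcal N)}$ if and only if it is implicitly definable in $\mathcal N$, and if and only if it is hyperarithmetical in $\mathcal N$. -/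

import Mathlib

namespace TarskiHierarchy

open FirstOrder

/-! ### Structures over the natural numbers -/

/-- An inherently interpreted symbol: an `n`-ary predicate is given by its extension, an `n`-ary
function symbol by a total function. (Predicates of arity `0`, i.e. truth values, are harmlessly
allowed as well.) -/
inductive Symbol : Type
  | pred (n : ℕ) (A : Set (Fin n → ℕ)) : Symbol
  | func (n : ℕ) (f : (Fin n → ℕ) → ℕ) : Symbol

/-- The arithmetic `{=, <, S, +, ·}` with the usual interpretation. -/
def arithmetic : Set Symbol :=
  {Symbol.pred 2 {v | v 0 = v 1}, Symbol.pred 2 {v | v 0 < v 1},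
    Symbol.func 1 fun v => v 0 + 1, Symbol.func 2 fun v => v 0 + v 1,
    Symbol.func 2 fun v => v 0 * v 1}

/-- A structure is a set of symbols that contains the arithmetic. -/
@[ext]
structure Struc : Type where
  carrier : Set Symbol
  arith : arithmetic ⊆ carrier

/-- `M + Y`: the structure `M` with the symbols in `Y` added. -/
def Struc.add (M : Struc) (Y : Set Symbol) : Struc :=
  ⟨M.carrier ∪ Y, M.arith.trans Set.subset_union_left⟩

/-- A structure is L-finite if it is a finite set of symbols. -/
def Struc.LFinite (M : Struc) : Prop := M.carrier.Finite

/-- The first-order language whose symbols are the elements of `M`. -/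
def Struc.lang (M : Struc) : Language :=
  ⟨fun n => {f : (Fin n → ℕ) → ℕ // Symbol.func n f ∈ M.carrier},
    fun n => {A : Set (Fin n → ℕ) // Symbol.pred n A ∈ M.carrier}⟩

/-- Every symbol is interpreted by itself. -/
instance Struc.langStructure (M : Struc) : M.lang.Structure ℕ where
  funMap f v := f.1 v
  RelMap A v := v ∈ A.1

/-- `B ⊆ ω^k` is (first-order, without parameters) definable in `M`. -/
def Struc.Def (M : Struc) {k : ℕ} (B : Set (Fin k → ℕ)) : Prop :=
  (∅ : Set ℕ).Definable M.lang B

/-- `𝒟(M)`: the subsets of `ω` definable in `M`. -/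
def Struc.defSets (M : Struc) : Set (Set ℕ) :=
  {X | M.Def {v : Fin 1 → ℕ | v 0 ∈ X}}

/-- `M ∼ M'`: the two structures have the same definable sets. -/
def Struc.Equivalent (M M' : Struc) : Prop := M.defSets = M'.defSets

/-- The subset of `ω²` given by a binary relation. -/
def ext₂ (R : ℕ → ℕ → Prop) : Set (Fin 2 → ℕ) := {v | R (v 0) (v 1)}

/-! ### Universal predicates and the Tarski hierarchy -/

/-- `G` is a universal predicate for `M`: `𝒟(M) ⊆ {G(n, ·) : n ∈ ω}`. -/
def IsUniversal (M : Struc) (G : ℕ → ℕ → Prop) : Prop :=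
  ∀ X ∈ M.defSets, ∃ n, X = {m | G n m}

/-- `P` is a canonic universal predicate for `M`. -/
def IsCanonicUniversal (M : Struc) (P : ℕ → ℕ → Prop) : Prop :=
  IsUniversal M P ∧
    ∀ G, IsUniversal M G → (M.add {Symbol.pred 2 (ext₂ G)}).Def (ext₂ P)

/-- `(M α)_{α ≤ lam}` starts with `N`, adds a canonic universal predicate at each successor step,
and takes unions at limits. Only the values `M α` with `α ≤ lam` matter. -/
structure IsTarskiSequence (N : Struc) (lam : Ordinal.{0}) (M : Ordinal.{0} → Struc) : Prop where
  zero : M 0 = N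
  succ : ∀ α < lam, ∃ P, IsCanonicUniversal (M α) P ∧
    M (Order.succ α) = (M α).add {Symbol.pred 2 (ext₂ P)}
  limit : ∀ β ≤ lam, Order.IsSuccLimit β → (M β).carrier = ⋃ α < β, (M α).carrier

/-- `(M α)_{α ≤ lam}` is a Tarski hierarchy over `N`: it cannot be continued beyond `lam`. -/
structure IsTarskiHierarchy (N : Struc) (lam : Ordinal.{0}) (M : Ordinal.{0} → Struc) : Prop
    extends IsTarskiSequence N lam M where
  maximal : ∀ mu M', IsTarskiSequence N mu M' → (∀ α ≤ lam, M' α = M α) → mu ≤ lam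

/-! ### Formula schemes and implicit definability -/

/-- `P(ω^lam)`: tuples of sets of the arities `lam 0, …, lam (s - 1)`. -/
abbrev SetTuple {s : ℕ} (lam : Fin s → ℕ) : Type := ∀ i, Set (Fin (lam i) → ℕ)

/-- Second-order variables `Y_0, …, Y_{s-1}` of the arities `lam`, as relation symbols. -/
inductive VarRel {s : ℕ} (lam : Fin s → ℕ) : ℕ → Type
  | var (i : Fin s) : VarRel lam (lam i)

/-- The language of the second-order variables. -/
def varLang {s : ℕ} (lam : Fin s → ℕ) : Language := ⟨fun _ => Empty, VarRel lam⟩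

/-- The interpretation of the second-order variables by a tuple of sets. -/
@[reducible]
def varStructure {s : ℕ} {lam : Fin s → ℕ} (A : SetTuple lam) : (varLang lam).Structure ℕ where
  funMap f := nomatch f
  RelMap := fun
    | .var i => fun v => v ∈ A i

/-- Formula schemes of `M`: formulas with second-order variables of arities `lam` (which are not
quantified) and first-order variables `x_0, …, x_{k-1}`. -/
def Scheme (M : Struc) {s : ℕ} (lam : Fin s → ℕ) (k : ℕ) : Type :=
  (M.lang.sum (varLang lam)).Formula (Fin k)

/-- `A` and `v` satisfy the scheme `ψ`. -/
def Scheme.Holds {M : Struc} {s : ℕ} {lam : Fin s → ℕ} {k : ℕ} (ψ : Scheme M lam k)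
    (A : SetTuple lam) (v : Fin k → ℕ) : Prop :=
  letI := varStructure A
  Language.Formula.Realize (L := M.lang.sum (varLang lam)) ψ v

/-- `A` has a proper implicit definition in `M`: it is the only tuple satisfying some closed
scheme of `M`. -/
def HasProperImplicitDef (M : Struc) {s : ℕ} {lam : Fin s → ℕ} (A : SetTuple lam) : Prop :=
  ∃ ψ : Scheme M lam 0, ∀ A' : SetTuple lam, ψ.Holds A' Fin.elim0 ↔ A' = A

/-- `B` is implicitly definable in `M`: it is definable in `M + A` for some tuple `A` that has a
proper implicit definition in `M`. -/
def ImplicitlyDefinable (M : Struc) {k : ℕ} (B : Set (Fin k → ℕ)) : Prop :=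
  ∃ (s : ℕ) (lam : Fin s → ℕ) (A : SetTuple lam), HasProperImplicitDef M A ∧
    (M.add (Set.range fun i => Symbol.pred (lam i) (A i))).Def B

/-- `𝓘(M)`: the structure `M` together with all `X ⊆ ω` implicitly definable in `M`. -/
def implicitClosure (M : Struc) : Struc :=
  M.add {S | ∃ X : Set (Fin 1 → ℕ), ImplicitlyDefinable M X ∧ S = Symbol.pred 1 X}

/-- `B` is `Σ¹₁` in `M`. -/
def IsSigma11 (M : Struc) {k : ℕ} (B : Set (Fin k → ℕ)) : Prop :=
  ∃ (s : ℕ) (lam : Fin s → ℕ) (ψ : Scheme M lam k),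
    ∀ v, v ∈ B ↔ ∃ A : SetTuple lam, ψ.Holds A v

/-- `B` is `Π¹₁` in `M`. -/
def IsPi11 (M : Struc) {k : ℕ} (B : Set (Fin k → ℕ)) : Prop :=
  ∃ (s : ℕ) (lam : Fin s → ℕ) (ψ : Scheme M lam k),
    ∀ v, v ∈ B ↔ ∀ A : SetTuple lam, ψ.Holds A v

/-- `B` is hyperarithmetical in `M`, that is, `Δ¹₁`-definable in `M`. -/
def IsHyperarithmetical (M : Struc) {k : ℕ} (B : Set (Fin k → ℕ)) : Prop :=
  IsSigma11 M B ∧ IsPi11 M B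

/-! ### Definable ordinals -/

/-- The range of a relation, the set of `y` with `R x y` for some `x`. -/
def rng (R : ℕ → ℕ → Prop) : Set ℕ := {y | ∃ x, R x y}

/-- `R` is a (non-strict) linear ordering on its range. -/
structure IsLinearOrdering (R : ℕ → ℕ → Prop) : Prop where
  dom_subset : ∀ x y, R x y → x ∈ rng R
  refl : ∀ x ∈ rng R, R x x
  trans : ∀ x y z, R x y → R y z → R x z
  antisymm : ∀ x y, R x y → R y x → x = y
  total : ∀ x ∈ rng R, ∀ y ∈ rng R, R x y ∨ R y x

/-- The strict part of `R` on its range. -/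
def strictPart (R : ℕ → ℕ → Prop) (x y : rng R) : Prop := R x y ∧ x ≠ y

/-- `R` is a representation of the ordinal `α`: a linear ordering whose strict part is a
well-ordering of order type `α`. -/
def IsRepresentation (R : ℕ → ℕ → Prop) (α : Ordinal.{0}) : Prop :=
  IsLinearOrdering R ∧ ∃ h : IsWellOrder (rng R) (strictPart R),
    @Ordinal.type (rng R) (strictPart R) h = α

/-- `α` is definable in `M`. -/
def DefinableOrdinal (M : Struc) (α : Ordinal.{0}) : Prop :=
  ∃ R, IsRepresentation R α ∧ M.Def (ext₂ R)

/-- `Ord(M)`: the first ordinal not definable in `M`. -/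
noncomputable def Ord (M : Struc) : Ordinal.{0} := sInf {α | ¬ DefinableOrdinal M α}

/-- The `i`-th entry of the list coded by `m` (`0` if there is none). -/
def entry (m i : ℕ) : ℕ := ((Encodable.decode (α := List ℕ) m).getD []).getD i 0

open Classical in
/-- The oracles given by `M`: its functions and the characteristic functions of its predicates,
applied to coded tuples. -/
def oracles (M : Struc) : Set (ℕ →. ℕ) :=
  {g | (∃ n f, Symbol.func n f ∈ M.carrier ∧
      g = fun m => Part.some (f fun i => entry m i)) ∨
    (∃ n A, Symbol.pred n A ∈ M.carrier ∧
      g = fun m => Part.some (if (fun i : Fin n => entry m i) ∈ A then 1 else 0))}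

open Classical in
/-- `α` is recursive in `M`: it has a representation whose characteristic function is computable
with oracles for the symbols of `M`. -/
def RecursiveOrdinal (M : Struc) (α : Ordinal.{0}) : Prop :=
  ∃ R, IsRepresentation R α ∧
    ComputableIn₂ (oracles M) fun x y => if R x y then (1 : ℕ) else 0

end TarskiHierarchy

/-!
The structures of a Tarski sequence over an `L`-finite structure `N` are identified with the levels
of a jump hierarchy, and the theorem becomes a relativized form of the classical description of the
hyperarithmetical sets by Kleene, Spector and Kreisel. Throughout, definability in a structure is
handled through families of relations that are closed under the first-order operations and under
primitive recursive substitutions (`ArithClosed`): the relations definable in a structure form the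
least such family containing its symbols (`Struc.closed`, `Struc.family_subset`), so that statements
about all definable relations are proved without a further induction on formulas. All symbols of `N`
are coded by one function `g` recursive in `N` (`exists_isCoding`).

*The levels.* Let `R` be a well-ordering definable in `N`, and let `H` be the result of iterating the
jump along `R`. By induction on `δ`, the structure `M δ` of a Tarski sequence defines exactly the
sets that are many-one reducible to a level of `H` of rank below `1 + δ`
(`IsTarskiSequence.family_eq_levelFamily`). Hence `M δ` has a canonic universal predicate: if `G` is
universal, then each proper initial part of `H` up to this place is a column of `G`, and such columns
are recognized by the recursion equation of `H`
(`dfn_hier_of_columns`, `isCanonicUniversal_reducts_below`).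
So a sequence can be continued as long as its length is an ordinal definable in `N`.

*Boundedness.* An existential second-order definition over `N` can be brought into the form "the tree
`T m`, which is recursive in `g`, has an infinite path" (`IsCoding.isSig_of_scheme`). The set `D` of
the indices of well-founded trees in a universal list does not have this form, by diagonalization
(`exists_not_isSig`); on the other hand it would have it if a family of well-orderings indexed by a
set in normal form could be longer than all Kleene–Brouwer orderings of trees with index in `D`
(`exists_bound`). It follows that
these orderings exhaust the ordinals definable in `N`, that the definable ordinals are the recursive
ones, and that the first non-definable ordinal `Ord N` is a countable limit ordinal. If a set and its
complement are in normal form, then boundedness reduces membership to a comparison with one definable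
well-ordering, and this comparison is definable in `M (Ord N)`
(`IsTarskiSequence.mem_family_of_isSig`).

*The end of the hierarchy.* A canonic universal predicate `P` of `M (Ord N)` would be definable from
every predicate `G` that contains, for each tree, an infinite path or a jump hierarchy along its
Kleene–Brouwer ordering, because such a `G` computes all levels. The class of these `G` is nonempty
and arithmetical in `N`, so by forcing with arithmetical classes `P` is hyperarithmetical
(`exists_isGeneric`). Then `P` is definable in `M (Ord N)`, which is impossible for a universal
predicate (`IsTarskiSequence.not_isCanonicUniversal`). Therefore every Tarski hierarchy has length
`Ord N`.

*Implicit definability.* An initial part of `H` is the only solution of its recursion equation, so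
sets definable in `M (Ord N)` are implicitly definable; implicitly definable sets are `Δ¹₁`, because
the defined tuple may be quantified in either way; and `Δ¹₁` sets are definable in `M (Ord N)` by
boundedness.
-/

namespace TarskiHierarchy

open FirstOrder Encodable

/-! ### Primitive recursive functions -/

attribute [fun_prop] Primrec
-- `fun_prop` composes primitive recursive functions with these rules and those below
attribute [fun_prop] Primrec.id Primrec.const Primrec.comp Primrec.fst Primrec.snd Primrec.pair

section PrimrecRules

variable {α β γ : Type*} [Primcodable α] [Primcodable β] [Primcodable γ]

@[fun_prop]
theorem primrec_natPair {f g : α → ℕ} (hf : Primrec f) (hg : Primrec g) :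
    Primrec fun a => Nat.pair (f a) (g a) :=
  Primrec₂.natPair.comp hf hg

@[fun_prop]
theorem primrec_unpair {f : α → ℕ} (hf : Primrec f) : Primrec fun a => (f a).unpair :=
  Primrec.unpair.comp hf

@[fun_prop]
theorem primrec_add {f g : α → ℕ} (hf : Primrec f) (hg : Primrec g) :
    Primrec fun a => f a + g a :=
  Primrec.nat_add.comp hf hg

@[fun_prop]
theorem primrec_sub {f g : α → ℕ} (hf : Primrec f) (hg : Primrec g) :
    Primrec fun a => f a - g a :=
  Primrec.nat_sub.comp hf hg

@[fun_prop]
theorem primrec_encode {f : α → β} (hf : Primrec f) : Primrec fun a => encode (f a) :=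
  Primrec.encode.comp hf

@[fun_prop]
theorem primrec_length {f : α → List β} (hf : Primrec f) : Primrec fun a => (f a).length :=
  Primrec.list_length.comp hf

@[fun_prop]
theorem primrec_take {n : α → ℕ} {f : α → List β} (hn : Primrec n) (hf : Primrec f) :
    Primrec fun a => (f a).take (n a) :=
  Primrec.list_take.comp hn hf

@[fun_prop]
theorem primrec_drop {n : α → ℕ} {f : α → List β} (hn : Primrec n) (hf : Primrec f) :
    Primrec fun a => (f a).drop (n a) :=
  Primrec.list_drop.comp hn hf

@[fun_prop]
theorem primrec_getD {n : α → ℕ} {f : α → List β} (d : β) (hn : Primrec n) (hf : Primrec f) :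
    Primrec fun a => (f a).getD (n a) d :=
  (Primrec.list_getD d).comp hf hn

@[fun_prop]
theorem primrec_append {f g : α → List β} (hf : Primrec f) (hg : Primrec g) :
    Primrec fun a => f a ++ g a :=
  Primrec.list_append.comp hf hg

@[fun_prop]
theorem primrec_cons {f : α → β} {g : α → List β} (hf : Primrec f) (hg : Primrec g) :
    Primrec fun a => f a :: g a :=
  Primrec.list_cons.comp hf hg

@[fun_prop]
theorem primrec_range {f : α → ℕ} (hf : Primrec f) : Primrec fun a => List.range (f a) :=
  Primrec.list_range.comp hf

theorem primrec_map {f : α → List β} {g : α → β → γ} (hf : Primrec f)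
    (hg : Primrec fun p : α × β => g p.1 p.2) : Primrec fun a => (f a).map (g a) :=
  Primrec.list_map hf hg

theorem primrec_finApp {n : ℕ} {f : α → Fin n → β} (i : Fin n) (hf : Primrec f) :
    Primrec fun a => f a i :=
  (Primrec.fin_app.comp hf (Primrec.const i) :)

theorem primrec_finLam {n : ℕ} {f : α → Fin n → β} (hf : ∀ i, Primrec fun a => f a i) :
    Primrec f := by
  refine Primrec.fin_curry.2 (Primrec₂.swap ?_)
  exact Primrec.fin_curry₁.2 hf

theorem primrec_ite {p : α → Prop} [DecidablePred p] {f g : α → β} (hp : PrimrecPred p)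
    (hf : Primrec f) (hg : Primrec g) : Primrec fun a => if p a then f a else g a :=
  Primrec.ite hp hf hg

theorem primrecPred_eq {f g : α → β} [DecidableEq β] (hf : Primrec f) (hg : Primrec g) :
    PrimrecPred fun a => f a = g a :=
  Primrec.eq.comp hf hg

theorem primrecPred_lt {f g : α → ℕ} (hf : Primrec f) (hg : Primrec g) :
    PrimrecPred fun a => f a < g a :=
  Primrec.nat_lt.comp hf hg

theorem primrecPred_le {f g : α → ℕ} (hf : Primrec f) (hg : Primrec g) :
    PrimrecPred fun a => f a ≤ g a :=
  Primrec.nat_le.comp hf hg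

@[fun_prop]
theorem primrec_entry {f g : α → ℕ} (hf : Primrec f) (hg : Primrec g) :
    Primrec fun a => entry (f a) (g a) := by
  unfold entry
  have h : Primrec fun a => (decode (α := List ℕ) (f a)).getD [] :=
    Primrec.option_getD.comp (Primrec.decode.comp hf) (Primrec.const [])
  exact (Primrec.list_getD 0).comp h hg

end PrimrecRules

/-! ### Families of relations closed under arithmetical operations -/

section Closed

variable {𝒳 : Type*}

/-- A family `𝓑` of relations between points of `𝒳` and numbers that is closed under the
first-order operations and under primitive recursive substitutions. The points of `𝒳` are
parameters, for instance interpretations of second-order variables; finite tuples of numbers are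
coded by single numbers. -/
structure ArithClosed (𝓑 : Set (𝒳 → ℕ → Prop)) : Prop where
  not_mem : ∀ {p}, p ∈ 𝓑 → (fun x m => ¬ p x m) ∈ 𝓑
  and_mem : ∀ {p q}, p ∈ 𝓑 → q ∈ 𝓑 → (fun x m => p x m ∧ q x m) ∈ 𝓑
  ex_mem : ∀ {p}, p ∈ 𝓑 → (fun x m => ∃ y, p x (Nat.pair m y)) ∈ 𝓑
  comap_mem : ∀ {p} {c : ℕ → ℕ}, p ∈ 𝓑 → Primrec c → (fun x m => p x (c m)) ∈ 𝓑
  eq_mem : (fun _ m => m.unpair.1 = m.unpair.2) ∈ 𝓑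

variable {α β : Type*} [Primcodable α] [Primcodable β]

/-- A relation between points of `𝒳` and elements of a primitively coded type `α` belongs to `𝓑`
after coding. -/
def Dfn (𝓑 : Set (𝒳 → ℕ → Prop)) (p : 𝒳 → α → Prop) : Prop :=
  (fun x m => ∃ a ∈ decode (α := α) m, p x a) ∈ 𝓑

theorem Dfn.of_iff {𝓑 : Set (𝒳 → ℕ → Prop)} {p q : 𝒳 → α → Prop} (hp : Dfn 𝓑 p)
    (h : ∀ x a, q x a ↔ p x a) : Dfn 𝓑 q := by
  have : q = p := by ext; apply h
  rwa [this]

theorem dfn_nat {𝓑 : Set (𝒳 → ℕ → Prop)} {p : 𝒳 → ℕ → Prop} : Dfn 𝓑 p ↔ p ∈ 𝓑 := by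
  simp [Dfn]

theorem Dfn.mono {𝓑 𝓒 : Set (𝒳 → ℕ → Prop)} (h : 𝓑 ⊆ 𝓒) {p : 𝒳 → α → Prop}
    (hp : Dfn 𝓑 p) : Dfn 𝓒 p := h hp

namespace ArithClosed

variable {𝓑 : Set (𝒳 → ℕ → Prop)} (h : ArithClosed 𝓑)
include h

/-- Primitive recursive relations belong to every closed family: equality with a constant is
substituted by the characteristic function. -/
theorem primrecPred {q : α → Prop} (hq : PrimrecPred q) : Dfn 𝓑 fun _ => q := by
  classical
  have hc : Primrec fun m : ℕ =>
      Nat.pair (Option.casesOn (decode (α := α) m) 1 fun a => if q a then 0 else 1) 0 := by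
    refine Primrec₂.natPair.comp (Primrec.option_casesOn Primrec.decode (Primrec.const 1) ?_)
      (Primrec.const 0)
    exact primrec_ite (hq.comp Primrec.snd) (Primrec.const 0) (Primrec.const 1)
  have := h.comap_mem h.eq_mem hc
  refine cast (congrArg (· ∈ 𝓑) ?_) this
  ext x m
  cases hm : decode (α := α) m <;> simp

theorem comap {p : 𝒳 → α → Prop} {c : β → α} (hp : Dfn 𝓑 p) (hc : Primrec c) :
    Dfn 𝓑 fun x b => p x (c b) := by
  have h1 : PrimrecPred fun m : ℕ => (decode (α := β) m).isSome = true :=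
    primrecPred_eq (Primrec.option_isSome.comp Primrec.decode) (Primrec.const true)
  have h2 := dfn_nat.1 (h.primrecPred h1)
  have h3 : Primrec fun m : ℕ =>
      (Option.casesOn (decode (α := β) m) 0 fun b => encode (c b) : ℕ) :=
    Primrec.option_casesOn Primrec.decode (Primrec.const 0)
      (Primrec.encode.comp (hc.comp Primrec.snd))
  refine cast (congrArg (· ∈ 𝓑) ?_) (h.and_mem h2 (h.comap_mem hp h3))
  ext x m
  cases hm : decode (α := β) m <;> simp

theorem not {p : 𝒳 → α → Prop} (hp : Dfn 𝓑 p) : Dfn 𝓑 fun x a => ¬ p x a := by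
  have h1 : PrimrecPred fun m : ℕ => (decode (α := α) m).isSome = true :=
    primrecPred_eq (Primrec.option_isSome.comp Primrec.decode) (Primrec.const true)
  have h2 := dfn_nat.1 (h.primrecPred h1)
  refine cast (congrArg (· ∈ 𝓑) ?_) (h.and_mem h2 (h.not_mem hp))
  ext x m
  cases hm : decode (α := α) m <;> simp

theorem and {p q : 𝒳 → α → Prop} (hp : Dfn 𝓑 p) (hq : Dfn 𝓑 q) :
    Dfn 𝓑 fun x a => p x a ∧ q x a := by
  refine cast (congrArg (· ∈ 𝓑) ?_) (h.and_mem hp hq)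
  ext x m
  cases hm : decode (α := α) m <;> simp

theorem or {p q : 𝒳 → α → Prop} (hp : Dfn 𝓑 p) (hq : Dfn 𝓑 q) :
    Dfn 𝓑 fun x a => p x a ∨ q x a :=
  (h.not (h.and (h.not hp) (h.not hq))).of_iff fun _ _ => by tauto

theorem imp {p q : 𝒳 → α → Prop} (hp : Dfn 𝓑 p) (hq : Dfn 𝓑 q) :
    Dfn 𝓑 fun x a => p x a → q x a :=
  (h.or (h.not hp) hq).of_iff fun _ _ => by tauto

theorem iff {p q : 𝒳 → α → Prop} (hp : Dfn 𝓑 p) (hq : Dfn 𝓑 q) :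
    Dfn 𝓑 fun x a => p x a ↔ q x a :=
  (h.and (h.imp hp hq) (h.imp hq hp)).of_iff fun _ _ => by tauto

theorem ex {p : 𝒳 → α → β → Prop} (hp : Dfn 𝓑 fun x (c : α × β) => p x c.1 c.2) :
    Dfn 𝓑 fun x a => ∃ b, p x a b := by
  refine cast (congrArg (· ∈ 𝓑) ?_) (h.ex_mem hp)
  ext x m
  constructor
  · rintro ⟨y, ⟨a, b⟩, hab, hp⟩
    rw [Option.mem_def, decode_prod_val, Nat.unpair_pair] at hab
    simp only [Option.bind_eq_some_iff, Option.map_eq_some_iff, Prod.mk.injEq] at hab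
    obtain ⟨a', ha, b', hb, rfl, rfl⟩ := hab
    exact ⟨a', ha, b', hp⟩
  · rintro ⟨a, ha, b, hp⟩
    refine ⟨encode b, (a, b), ?_, hp⟩
    rw [Option.mem_def] at ha
    simp [decode_prod_val, ha]

theorem all {p : 𝒳 → α → β → Prop} (hp : Dfn 𝓑 fun x (c : α × β) => p x c.1 c.2) :
    Dfn 𝓑 fun x a => ∀ b, p x a b :=
  (h.not (h.ex (p := fun x a b => ¬ p x a b) (h.not hp))).of_iff fun _ _ => by simp

theorem const (c : Prop) : Dfn 𝓑 fun _ (_ : α) => c := by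
  by_cases hc : c
  · exact (h.primrecPred (primrecPred_eq (Primrec.const 0) (Primrec.const 0))).of_iff
      fun _ _ => by simp [hc]
  · exact (h.primrecPred (primrecPred_eq (Primrec.const 0) (Primrec.const 1))).of_iff
      fun _ _ => by simp [hc]

theorem finAll {n : ℕ} {p : Fin n → 𝒳 → α → Prop} (hp : ∀ i, Dfn 𝓑 (p i)) :
    Dfn 𝓑 fun x a => ∀ i, p i x a := by
  induction n with
  | zero => exact (h.const True).of_iff fun _ _ => by simp
  | succ n ih =>
    exact (h.and (hp 0) (ih fun i => hp i.succ)).of_iff fun _ _ => by rw [Fin.forall_fin_succ]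

theorem eq [DecidableEq β] {f g : α → β} (hf : Primrec f) (hg : Primrec g) :
    Dfn 𝓑 fun _ a => f a = g a :=
  h.primrecPred (primrecPred_eq hf hg)

theorem lt {f g : α → ℕ} (hf : Primrec f) (hg : Primrec g) :
    Dfn 𝓑 fun _ a => f a < g a :=
  h.primrecPred (primrecPred_lt hf hg)

/-- The graph of the universal partial recursive function. -/
theorem eval {c f g : α → ℕ} (hc : Primrec c) (hf : Primrec f) (hg : Primrec g) :
    Dfn 𝓑 fun _ a =>
      g a ∈ Nat.Partrec.Code.eval (Denumerable.ofNat Nat.Partrec.Code (c a)) (f a) := by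
  have h1 : Dfn 𝓑 fun (_ : 𝒳) (a : α) => ∃ k : ℕ,
      Nat.Partrec.Code.evaln k (Denumerable.ofNat Nat.Partrec.Code (c a)) (f a)
        = some (g a) := by
    refine h.ex (h.eq (f := fun b : α × ℕ => Nat.Partrec.Code.evaln b.2
      (Denumerable.ofNat Nat.Partrec.Code (c b.1)) (f b.1)) ?_ ?_)
    · exact Nat.Partrec.Code.primrec_evaln.comp
        ((Primrec.snd.pair ((Primrec.ofNat _).comp (hc.comp Primrec.fst))).pair
          (hf.comp Primrec.fst))
    · exact Primrec.option_some.comp (by fun_prop)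
  exact h1.of_iff fun _ a => Nat.Partrec.Code.evaln_complete

end ArithClosed

end Closed

/-! ### Uniform first-order definability -/

section Uniform

variable {L : FirstOrder.Language.{0, 0}} {𝒳 : Type*}

/-- The relation `p` is defined by one formula of `L` in all the structures `S x`. -/
def FO (S : 𝒳 → L.Structure ℕ) {k : ℕ} (p : 𝒳 → (Fin k → ℕ) → Prop) : Prop :=
  ∃ φ : L.Formula (Fin k), ∀ x v, p x v ↔ @Language.Formula.Realize L ℕ (S x) (Fin k) φ v

/-- The relations between points of `𝒳` and numbers that are uniformly definable in the
structures `S x`. -/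
def UDef (S : 𝒳 → L.Structure ℕ) : Set (𝒳 → ℕ → Prop) :=
  {p | FO S fun x (v : Fin 1 → ℕ) => p x (v 0)}

/-- The function `f` has a uniformly definable graph. -/
def FOFun (S : 𝒳 → L.Structure ℕ) {k : ℕ} (f : (Fin k → ℕ) → ℕ) : Prop :=
  FO S fun _ (w : Fin (k + 1) → ℕ) => f (fun i => w i.castSucc) = w (Fin.last k)

variable {S : 𝒳 → L.Structure ℕ} {k n : ℕ}

namespace FO

theorem of_iff {p q : 𝒳 → (Fin k → ℕ) → Prop} (hp : FO S p) (h : ∀ x v, q x v ↔ p x v) :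
    FO S q := by
  have : q = p := by ext; apply h
  rwa [this]

theorem not {p : 𝒳 → (Fin k → ℕ) → Prop} (hp : FO S p) : FO S fun x v => ¬ p x v := by
  obtain ⟨φ, hφ⟩ := hp
  refine ⟨φ.not, fun x v => ?_⟩
  let := S x
  beta_reduce
  rw [hφ, Language.Formula.realize_not]

theorem and {p q : 𝒳 → (Fin k → ℕ) → Prop} (hp : FO S p) (hq : FO S q) :
    FO S fun x v => p x v ∧ q x v := by
  obtain ⟨φ, hφ⟩ := hp
  obtain ⟨ψ, hψ⟩ := hq
  refine ⟨φ ⊓ ψ, fun x v => ?_⟩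
  let := S x
  beta_reduce
  rw [hφ, hψ, Language.Formula.realize_inf]

theorem or {p q : 𝒳 → (Fin k → ℕ) → Prop} (hp : FO S p) (hq : FO S q) :
    FO S fun x v => p x v ∨ q x v :=
  (hp.not.and hq.not).not.of_iff fun _ _ => by tauto

theorem imp {p q : 𝒳 → (Fin k → ℕ) → Prop} (hp : FO S p) (hq : FO S q) :
    FO S fun x v => p x v → q x v :=
  (hp.not.or hq).of_iff fun _ _ => by tauto

theorem sub {p : 𝒳 → (Fin k → ℕ) → Prop} (hp : FO S p) (σ : Fin k → Fin n) :
    FO S fun x v => p x fun i => v (σ i) := by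
  obtain ⟨φ, hφ⟩ := hp
  refine ⟨φ.relabel σ, fun x v => ?_⟩
  let := S x
  beta_reduce
  rw [hφ, Language.Formula.realize_relabel]
  rfl

theorem exFin {p : 𝒳 → (Fin k → ℕ) → (Fin n → ℕ) → Prop}
    (hp : FO S fun x (w : Fin (k + n) → ℕ) =>
      p x (fun i => w (i.castAdd n)) (fun i => w (i.natAdd k))) :
    FO S fun x v => ∃ y, p x v y := by
  obtain ⟨φ, hφ⟩ := hp
  refine ⟨(φ.relabel (finSumFinEquiv.symm : Fin (k + n) → Fin k ⊕ Fin n)).iExs (Fin n),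
    fun x v => ?_⟩
  let := S x
  rw [Language.Formula.realize_iExs]
  refine exists_congr fun y => ?_
  rw [Language.Formula.realize_relabel, ← hφ]
  simp

theorem ex {p : 𝒳 → (Fin k → ℕ) → ℕ → Prop}
    (hp : FO S fun x (w : Fin (k + 1) → ℕ) =>
      p x (fun i => w i.castSucc) (w (Fin.last k))) :
    FO S fun x v => ∃ y, p x v y := by
  refine (exFin (n := 1) (p := fun x v y => p x v (y 0)) hp).of_iff fun x v => ?_
  exact ⟨fun ⟨y, hy⟩ => ⟨fun _ => y, hy⟩, fun ⟨y, hy⟩ => ⟨y 0, hy⟩⟩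

theorem all {p : 𝒳 → (Fin k → ℕ) → ℕ → Prop}
    (hp : FO S fun x (w : Fin (k + 1) → ℕ) =>
      p x (fun i => w i.castSucc) (w (Fin.last k))) :
    FO S fun x v => ∀ y, p x v y :=
  (ex (p := fun x v y => ¬ p x v y) hp.not).not.of_iff fun _ _ => by simp

theorem varEq (i j : Fin k) : FO S fun _ v => v i = v j := by
  refine ⟨(Language.Term.var i).equal (Language.Term.var j), fun x v => ?_⟩
  let := S x
  rw [Language.Formula.realize_equal, Language.Term.realize_var, Language.Term.realize_var]

theorem true : FO S fun _ (_ : Fin k → ℕ) => True := by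
  refine ⟨⊤, fun x v => ?_⟩
  let := S x
  simp [Language.Formula.Realize]

theorem finAll {p : Fin n → 𝒳 → (Fin k → ℕ) → Prop} (hp : ∀ i, FO S (p i)) :
    FO S fun x v => ∀ i, p i x v := by
  induction n with
  | zero => exact FO.true.of_iff fun _ _ => by simp
  | succ n ih =>
    exact ((hp 0).and (ih fun i => hp i.succ)).of_iff fun _ _ => by rw [Fin.forall_fin_succ]

/-- Substitution of functions: a value is named by an existentially quantified variable. -/
theorem comp {p : 𝒳 → (Fin n → ℕ) → Prop} {f : Fin n → (Fin k → ℕ) → ℕ} (hp : FO S p)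
    (hf : ∀ i, FOFun S (f i)) : FO S fun x v => p x fun i => f i v := by
  have h : FO S fun x v => ∃ y : Fin n → ℕ, (∀ i, f i v = y i) ∧ p x y := by
    refine exFin (p := fun x v y => (∀ i, f i v = y i) ∧ p x y) (and (finAll fun i => ?_) ?_)
    · refine (sub (hf i) (Fin.snoc (fun i => i.castAdd n) (i.natAdd k))).of_iff fun x v => ?_
      simp
    · exact sub hp fun i => i.natAdd k
  refine h.of_iff fun x v => ⟨fun h => ⟨_, fun _ => rfl, h⟩, ?_⟩
  rintro ⟨y, hy, hp⟩
  rwa [funext hy]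

theorem rel₁ {r : 𝒳 → ℕ → Prop} (hr : FO S fun x (v : Fin 1 → ℕ) => r x (v 0))
    {f : (Fin k → ℕ) → ℕ} (hf : FOFun S f) : FO S fun x v => r x (f v) :=
  comp (f := fun _ => f) hr fun _ => hf

theorem rel₂ {r : 𝒳 → ℕ → ℕ → Prop} (hr : FO S fun x (v : Fin 2 → ℕ) => r x (v 0) (v 1))
    {f g : (Fin k → ℕ) → ℕ} (hf : FOFun S f) (hg : FOFun S g) :
    FO S fun x v => r x (f v) (g v) :=
  comp (f := ![f, g]) hr (by simp [Fin.forall_fin_two, hf, hg])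

theorem rel₃ {r : 𝒳 → ℕ → ℕ → ℕ → Prop}
    (hr : FO S fun x (v : Fin 3 → ℕ) => r x (v 0) (v 1) (v 2))
    {f g h : (Fin k → ℕ) → ℕ} (hf : FOFun S f) (hg : FOFun S g) (hh : FOFun S h) :
    FO S fun x v => r x (f v) (g v) (h v) :=
  comp (f := ![f, g, h]) hr (by simp [Fin.forall_fin_succ, hf, hg, hh])

theorem eq {f g : (Fin k → ℕ) → ℕ} (hf : FOFun S f) (hg : FOFun S g) :
    FO S fun _ v => f v = g v :=
  rel₂ (r := fun _ a b => a = b) (varEq 0 1) hf hg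

end FO

theorem FOFun.proj (i : Fin k) : FOFun S fun v : Fin k → ℕ => v i :=
  FO.varEq i.castSucc (Fin.last k)

theorem FOFun.comp₂ {F : ℕ → ℕ → ℕ} (hF : FO S fun _ (v : Fin 3 → ℕ) => F (v 0) (v 1) = v 2)
    {f g : (Fin k → ℕ) → ℕ} (hf : FOFun S f) (hg : FOFun S g) : FOFun S fun v => F (f v) (g v) := by
  have h : FO S fun (_ : 𝒳) (w : Fin (k + 1) → ℕ) => ∃ a b,
      f (fun i => w i.castSucc) = a ∧ g (fun i => w i.castSucc) = b ∧ F a b = w (Fin.last k) := by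
    refine FO.ex (FO.ex (FO.and ?_ (FO.and ?_ ?_)))
    · exact (hf.sub (Fin.snoc (fun i => i.castSucc.castSucc.castSucc)
        (Fin.last _).castSucc)).of_iff fun _ _ => by simp
    · exact (hg.sub (Fin.snoc (fun i => i.castSucc.castSucc.castSucc)
        (Fin.last _))).of_iff fun _ _ => by simp
    · exact FO.rel₃ (r := fun _ a b c => F a b = c) hF (.proj _) (.proj _) (.proj _)
  exact h.of_iff fun _ _ => by simp

/-- The structures `S x` interpret addition and multiplication uniformly. -/
structure HasArith (S : 𝒳 → L.Structure ℕ) : Prop where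
  add_graph : FO S fun _ (v : Fin 3 → ℕ) => v 0 + v 1 = v 2
  mul_graph : FO S fun _ (v : Fin 3 → ℕ) => v 0 * v 1 = v 2

namespace HasArith

variable (h : HasArith S)
include h

theorem add {f g : (Fin k → ℕ) → ℕ} (hf : FOFun S f) (hg : FOFun S g) :
    FOFun S fun v => f v + g v := .comp₂ h.add_graph hf hg

theorem mul {f g : (Fin k → ℕ) → ℕ} (hf : FOFun S f) (hg : FOFun S g) :
    FOFun S fun v => f v * g v := .comp₂ h.mul_graph hf hg

theorem zero : FOFun S fun _ : Fin k → ℕ => 0 := by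
  refine FO.of_iff (p := fun _ w => w (Fin.last k) + w (Fin.last k) = w (Fin.last k))
    (FO.eq (h.add (.proj _) (.proj _)) (.proj _)) fun _ _ => by beta_reduce; omega

theorem one : FOFun S fun _ : Fin k → ℕ => 1 := by
  have : FO S fun (_ : 𝒳) (w : Fin (k + 1) → ℕ) => ∀ y, w (Fin.last k) * y = y :=
    FO.all (FO.eq (h.mul (.proj _) (.proj _)) (.proj _))
  refine this.of_iff fun _ w => ⟨fun h => by simp [← h], fun h => ?_⟩
  simpa using (h 1).symm

theorem le {f g : (Fin k → ℕ) → ℕ} (hf : FOFun S f) (hg : FOFun S g) :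
    FO S fun _ v => f v ≤ g v := by
  refine FO.rel₂ (r := fun _ a b => a ≤ b) ?_ hf hg
  have : FO S fun (_ : 𝒳) (v : Fin 2 → ℕ) => ∃ y, v 0 + y = v 1 :=
    FO.ex (FO.eq (h.add (.proj _) (.proj _)) (.proj _))
  exact this.of_iff fun _ _ => le_iff_exists_add.trans (by simp only [eq_comm])

theorem lt {f g : (Fin k → ℕ) → ℕ} (hf : FOFun S f) (hg : FOFun S g) :
    FO S fun _ v => f v < g v :=
  (h.le hg hf).not.of_iff fun _ _ => by simp

theorem pair {f g : (Fin k → ℕ) → ℕ} (hf : FOFun S f) (hg : FOFun S g) :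
    FOFun S fun v => Nat.pair (f v) (g v) := by
  refine .comp₂ ?_ hf hg
  have : FO S fun (_ : 𝒳) (v : Fin 3 → ℕ) => (v 0 < v 1 ∧ v 1 * v 1 + v 0 = v 2) ∨
      (¬ v 0 < v 1 ∧ v 0 * v 0 + v 0 + v 1 = v 2) := by
    refine ((h.lt (.proj _) (.proj _)).and (FO.eq ?_ (.proj _))).or
      ((h.lt (.proj _) (.proj _)).not.and (FO.eq ?_ (.proj _)))
    · exact h.add (h.mul (.proj _) (.proj _)) (.proj _)
    · exact h.add (h.add (h.mul (.proj _) (.proj _)) (.proj _)) (.proj _)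
  refine this.of_iff fun _ v => ?_
  unfold Nat.pair
  split_ifs with h <;> simp [h]

theorem beta {f g : (Fin k → ℕ) → ℕ} (hf : FOFun S f) (hg : FOFun S g) :
    FOFun S fun v => Nat.beta (f v) (g v) := by
  refine .comp₂ ?_ hf hg
  have : FO S fun (_ : 𝒳) (v : Fin 3 → ℕ) => ∃ a b q, Nat.pair a b = v 0 ∧
      q * ((v 1 + 1) * b + 1) + v 2 = a ∧ v 2 < (v 1 + 1) * b + 1 := by
    refine FO.ex (FO.ex (FO.ex (FO.and (FO.eq (h.pair (.proj _) (.proj _)) (.proj _))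
      (FO.and (FO.eq ?_ (.proj _)) (h.lt (.proj _) ?_)))))
    · exact h.add (h.mul (.proj _) (h.add (h.mul (h.add (.proj _) h.one) (.proj _)) h.one))
        (.proj _)
    · exact h.add (h.mul (h.add (.proj _) h.one) (.proj _)) h.one
  refine this.of_iff fun _ v => ?_
  unfold Nat.beta
  constructor
  · intro hv
    refine ⟨(v 0).unpair.1, (v 0).unpair.2, (v 0).unpair.1 / ((v 1 + 1) * (v 0).unpair.2 + 1),
      by simp, ?_, ?_⟩
    · rw [← hv, mul_comm]
      exact Nat.div_add_mod _ _
    · rw [← hv]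
      exact Nat.mod_lt _ (Nat.succ_pos _)
  · rintro ⟨a, b, q, hab, hq, hlt⟩
    rw [← hab, Nat.unpair_pair]
    simp only
    rw [← hq, mul_comm q, Nat.mul_add_mod, Nat.mod_eq_of_lt hlt]

/-- The graphs of partial functions that are recursive in definable oracles are definable. -/
theorem recursiveIn_graph {O : Set (ℕ →. ℕ)}
    (hO : ∀ g ∈ O, FO S fun _ (v : Fin 2 → ℕ) => v 1 ∈ g (v 0)) {f : ℕ →. ℕ}
    (hf : Nat.RecursiveIn O f) : FO S fun _ (v : Fin 2 → ℕ) => v 1 ∈ f (v 0) := by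
  induction hf with
  | zero =>
    exact (FO.eq (.proj 1) h.zero).of_iff fun _ v => Part.mem_some_iff
  | succ =>
    exact (FO.eq (.proj 1) (h.add (.proj 0) h.one)).of_iff fun _ v => Part.mem_some_iff
  | left =>
    have : FO S fun (_ : 𝒳) (v : Fin 2 → ℕ) => ∃ b, Nat.pair (v 1) b = v 0 :=
      FO.ex (FO.eq (h.pair (.proj _) (.proj _)) (.proj _))
    refine this.of_iff fun _ v => Part.mem_some_iff.trans ⟨fun h => ⟨(v 0).unpair.2, ?_⟩, ?_⟩
    · simp [h]
    · rintro ⟨b, hb⟩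
      simp [← hb]
  | right =>
    have : FO S fun (_ : 𝒳) (v : Fin 2 → ℕ) => ∃ b, Nat.pair b (v 1) = v 0 :=
      FO.ex (FO.eq (h.pair (.proj _) (.proj _)) (.proj _))
    refine this.of_iff fun _ v => Part.mem_some_iff.trans ⟨fun h => ⟨(v 0).unpair.1, ?_⟩, ?_⟩
    · simp [h]
    · rintro ⟨b, hb⟩
      simp [← hb]
  | oracle g hg => exact hO g hg
  | @pair f g _ _ ihf ihg =>
    have : FO S fun (_ : 𝒳) (v : Fin 2 → ℕ) => ∃ a b, a ∈ f (v 0) ∧ b ∈ g (v 0) ∧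
        Nat.pair a b = v 1 := by
      refine FO.ex (FO.ex (FO.and ?_ (FO.and ?_ (FO.eq (h.pair (.proj _) (.proj _)) (.proj _)))))
      · exact FO.rel₂ (r := fun _ a b => b ∈ f a) ihf (.proj _) (.proj _)
      · exact FO.rel₂ (r := fun _ a b => b ∈ g a) ihg (.proj _) (.proj _)
    refine this.of_iff fun _ v => ?_
    simp only [Seq.seq, Part.map_eq_map, Part.mem_bind_iff, Part.mem_map_iff]
    constructor
    · rintro ⟨_, ⟨a, ha, rfl⟩, b, hb, hab⟩
      exact ⟨a, b, ha, hb, hab⟩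
    · rintro ⟨a, b, ha, hb, hab⟩
      exact ⟨_, ⟨a, ha, rfl⟩, b, hb, hab⟩
  | @comp f g _ _ ihf ihg =>
    have : FO S fun (_ : 𝒳) (v : Fin 2 → ℕ) => ∃ a, a ∈ g (v 0) ∧ v 1 ∈ f a := by
      refine FO.ex (FO.and ?_ ?_)
      · exact FO.rel₂ (r := fun _ a b => b ∈ g a) ihg (.proj _) (.proj _)
      · exact FO.rel₂ (r := fun _ a b => b ∈ f a) ihf (.proj _) (.proj _)
    exact this.of_iff fun _ v => Part.mem_bind_iff
  | @prec f g _ _ ihf ihg =>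
    have : FO S fun (_ : 𝒳) (v : Fin 2 → ℕ) => ∃ a n s, Nat.pair a n = v 0 ∧
        Nat.beta s 0 ∈ f a ∧
        (∀ i, i < n → Nat.beta s (i + 1) ∈ g (Nat.pair a (Nat.pair i (Nat.beta s i)))) ∧
        Nat.beta s n = v 1 := by
      refine FO.ex (FO.ex (FO.ex (FO.and (FO.eq (h.pair (.proj _) (.proj _)) (.proj _))
        (FO.and ?_ (FO.and (FO.all (FO.imp (h.lt (.proj _) (.proj _)) ?_))
          (FO.eq (h.beta (.proj _) (.proj _)) (.proj _)))))))
      · exact FO.rel₂ (r := fun _ a b => b ∈ f a) ihf (.proj _) (h.beta (.proj _) h.zero)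
      · exact FO.rel₂ (r := fun _ a b => b ∈ g a) ihg
          (h.pair (.proj _) (h.pair (.proj _) (h.beta (.proj _) (.proj _))))
          (h.beta (.proj _) (h.add (.proj _) h.one))
    refine this.of_iff fun _ v => ?_
    -- a computation by recursion is coded by Gödel's `β` function
    have key : ∀ (a n z : ℕ), z ∈ (n.rec (f a) fun y IH => do
          let i ← IH
          g (Nat.pair a (Nat.pair y i)) : Part ℕ) ↔ ∃ s, Nat.beta s 0 ∈ f a ∧
        (∀ i, i < n → Nat.beta s (i + 1) ∈ g (Nat.pair a (Nat.pair i (Nat.beta s i)))) ∧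
        Nat.beta s n = z := by
      intro a n z
      have key' : z ∈ (n.rec (f a) fun y IH => do
          let i ← IH
          g (Nat.pair a (Nat.pair y i)) : Part ℕ) ↔ ∃ s : ℕ → ℕ, s 0 ∈ f a ∧
          (∀ i, i < n → s (i + 1) ∈ g (Nat.pair a (Nat.pair i (s i)))) ∧ s n = z := by
        induction n generalizing z with
        | zero => exact ⟨fun hz => ⟨fun _ => z, hz, by simp, rfl⟩, fun ⟨s, h0, _, hz⟩ => hz ▸ h0⟩
        | succ n ih =>
          refine Part.mem_bind_iff.trans ?_
          constructor
          · rintro ⟨y, hy, hz⟩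
            obtain ⟨s, h0, hs, rfl⟩ := (ih y).1 hy
            refine ⟨fun i => if i ≤ n then s i else z, by simpa, fun i hi => ?_, by simp⟩
            rcases Nat.lt_succ_iff_lt_or_eq.1 hi with hi | rfl
            · simpa [show i + 1 ≤ n from hi, hi.le] using hs i hi
            · simpa using hz
          · rintro ⟨s, h0, hs, rfl⟩
            exact ⟨s n, (ih _).2 ⟨s, h0, fun i hi => hs i (hi.trans n.lt_succ_self), rfl⟩,
              hs n n.lt_succ_self⟩
      rw [key']
      constructor
      · rintro ⟨s, h0, hs, rfl⟩
        have hb : ∀ i, i ≤ n → Nat.beta (Nat.unbeta ((List.range (n + 1)).map s)) i = s i := by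
          intro i hi
          have := Nat.beta_unbeta_coe ((List.range (n + 1)).map s)
            ⟨i, by simp; omega⟩
          simpa using this
        refine ⟨Nat.unbeta ((List.range (n + 1)).map s), ?_, fun i hi => ?_, hb n le_rfl⟩
        · rw [hb 0 (Nat.zero_le _)]; exact h0
        · rw [hb _ hi, hb _ hi.le]; exact hs i hi
      · rintro ⟨s, h⟩
        exact ⟨_, h⟩
    constructor
    · intro hv
      obtain ⟨s, hs⟩ := (key (v 0).unpair.1 (v 0).unpair.2 (v 1)).1 hv
      exact ⟨_, _, s, by simp, hs⟩
    · rintro ⟨a, n, s, han, hs⟩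
      have := (key a n (v 1)).2 ⟨s, hs⟩
      rw [← han]
      simpa using this
  | @rfind f _ ihf =>
    have : FO S fun (_ : 𝒳) (v : Fin 2 → ℕ) => 0 ∈ f (Nat.pair (v 0) (v 1)) ∧
        ∀ i, i < v 1 → ∃ y, y ∈ f (Nat.pair (v 0) i) ∧ ¬ y = 0 := by
      refine FO.and ?_ (FO.all (FO.imp (h.lt (.proj _) (.proj _)) (FO.ex (FO.and ?_
        (FO.not (FO.eq (.proj _) h.zero))))))
      · exact FO.rel₂ (r := fun _ a b => b ∈ f a) ihf (h.pair (.proj _) (.proj _)) h.zero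
      · exact FO.rel₂ (r := fun _ a b => b ∈ f a) ihf (h.pair (.proj _) (.proj _)) (.proj _)
    refine this.of_iff fun _ v => ?_
    refine Nat.mem_rfind.trans ?_
    simp

theorem natPrimrec {c : ℕ → ℕ} (hc : Primrec c) {f : (Fin k → ℕ) → ℕ} (hf : FOFun S f) :
    FOFun S fun v => c (f v) := by
  have h1 : FO S fun (_ : 𝒳) (v : Fin 2 → ℕ) => v 1 ∈ (fun n => Part.some (c n)) (v 0) :=
    h.recursiveIn_graph (O := ∅) (by simp) (Primrec.nat_iff.1 hc).recursiveIn
  have h2 : FO S fun (_ : 𝒳) (w : Fin (k + 1) → ℕ) => ∃ a,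
      f (fun i => w i.castSucc) = a ∧ c a = w (Fin.last k) := by
    refine FO.ex (FO.and ?_ ?_)
    · exact (hf.sub (Fin.snoc (fun i => i.castSucc.castSucc)
        (Fin.last _))).of_iff fun _ _ => by simp
    · have h3 : FO S fun (_ : 𝒳) (v : Fin 2 → ℕ) => c (v 0) = v 1 :=
        h1.of_iff fun _ _ => by simp [eq_comm]
      exact FO.rel₂ (r := fun _ a b => c a = b) h3 (.proj _) (.proj _)
  exact h2.of_iff fun _ _ => by simp

theorem arithClosed : ArithClosed (UDef S) where
  not_mem := FO.not
  and_mem := FO.and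
  ex_mem hp := FO.ex (FO.rel₁ hp (h.pair (.proj _) (.proj _)))
  comap_mem hp hc := FO.rel₁ hp (h.natPrimrec hc (.proj _))
  eq_mem := FO.eq (h.natPrimrec (Primrec.fst.comp Primrec.unpair) (.proj 0))
    (h.natPrimrec (Primrec.snd.comp Primrec.unpair) (.proj 0))

/-- Definability of a `k`-ary relation agrees with definability of the set of codes of its
elements. -/
theorem fo_iff_dfn {p : 𝒳 → (Fin k → ℕ) → Prop} : FO S p ↔ Dfn (UDef S) p := by
  have hd : ∀ i : Fin k, Primrec fun m : ℕ => ((@decode (Fin k → ℕ) Primcodable.toEncodable m).getD 0) i :=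
    fun i => primrec_finApp i (Primrec.option_getD.comp Primrec.decode (Primrec.const 0))
  have hs : PrimrecPred fun m : ℕ => (@decode (Fin k → ℕ) Primcodable.toEncodable m).isSome = Bool.true :=
    primrecPred_eq (Primrec.option_isSome.comp Primrec.decode) (Primrec.const _)
  have hs' : FO S fun _ (v : Fin 1 → ℕ) => (@decode (Fin k → ℕ) Primcodable.toEncodable (v 0)).isSome = Bool.true :=
    dfn_nat.1 (h.arithClosed.primrecPred hs)
  constructor
  · intro hp
    refine (FO.and hs' (FO.comp hp fun i => h.natPrimrec (hd i) (.proj 0))).of_iff fun x v => ?_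
    cases hv : @decode (Fin k → ℕ) Primcodable.toEncodable (v 0) <;> simp [hv]
  · intro hp
    have : FO S fun x v => ∃ m, (∃ w ∈ @decode (Fin k → ℕ) Primcodable.toEncodable m, p x w) ∧
        ∀ i, ((@decode (Fin k → ℕ) Primcodable.toEncodable m).getD 0) i = v i :=
      FO.ex (FO.and (FO.rel₁ (r := fun x m => ∃ w ∈ @decode (Fin k → ℕ) Primcodable.toEncodable m, p x w) hp
        (.proj _)) (FO.finAll fun i => FO.eq (h.natPrimrec (hd i) (.proj _)) (.proj _)))
    refine this.of_iff fun x v => ?_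
    have he := @encodek (Fin k → ℕ) Primcodable.toEncodable v
    refine ⟨fun hv => ⟨_, ⟨v, he, hv⟩, by simp [he]⟩, ?_⟩
    rintro ⟨m, ⟨w, hw, hp⟩, hv⟩
    rw [Option.mem_def] at hw
    have : w = v := by ext i; simpa [hw] using hv i
    rwa [← this]

end HasArith

/-! ### Uniformly definable relations form the least closed family -/

open Language in
theorem dfn_term {𝓑 : Set (𝒳 → ℕ → Prop)} (h : ArithClosed 𝓑)
    (hf : ∀ n (f : L.Functions n), Dfn 𝓑 fun x (q : (Fin n → ℕ) × ℕ) =>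
      (S x).funMap f q.1 = q.2)
    (t : L.Term (Fin k ⊕ Fin n)) :
    Dfn 𝓑 fun x (q : ((Fin k → ℕ) × (Fin n → ℕ)) × ℕ) =>
      @Term.realize L ℕ (S x) _ (Sum.elim q.1.1 q.1.2) t = q.2 := by
  induction t with
  | var i =>
    rcases i with i | i
    · exact h.eq (primrec_finApp i (by fun_prop)) (by fun_prop)
    · exact h.eq (primrec_finApp i (by fun_prop)) (by fun_prop)
  | @func l f ts ih =>
    have : Dfn 𝓑 fun x (q : ((Fin k → ℕ) × (Fin n → ℕ)) × ℕ) => ∃ y : Fin l → ℕ,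
        (∀ i, @Term.realize L ℕ (S x) _ (Sum.elim q.1.1 q.1.2) (ts i) = y i) ∧
          (S x).funMap f y = q.2 := by
      refine h.ex (h.and (h.finAll fun i => ?_) ?_)
      · exact h.comap (c := fun c : (((Fin k → ℕ) × (Fin n → ℕ)) × ℕ) × (Fin l → ℕ) =>
          ((c.1.1.1, c.1.1.2), c.2 i)) (ih i)
          (by have := primrec_finApp (f := fun c : (((Fin k → ℕ) × (Fin n → ℕ)) × ℕ) ×
                (Fin l → ℕ) => c.2) i (by fun_prop)
              fun_prop)
      · exact h.comap (c := fun c : (((Fin k → ℕ) × (Fin n → ℕ)) × ℕ) × (Fin l → ℕ) =>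
          (c.2, c.1.2)) (hf l f) (by fun_prop)
    refine this.of_iff fun x q => ?_
    simp only [← funext_iff, exists_eq_left', Term.realize]

open Language in
theorem dfn_boundedFormula {𝓑 : Set (𝒳 → ℕ → Prop)} (h : ArithClosed 𝓑)
    (hf : ∀ n (f : L.Functions n), Dfn 𝓑 fun x (q : (Fin n → ℕ) × ℕ) =>
      (S x).funMap f q.1 = q.2)
    (hr : ∀ n (r : L.Relations n), Dfn 𝓑 fun x (v : Fin n → ℕ) => (S x).RelMap r v)
    (φ : L.BoundedFormula (Fin k) n) :
    Dfn 𝓑 fun x (q : (Fin k → ℕ) × (Fin n → ℕ)) =>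
      @BoundedFormula.Realize L ℕ (S x) _ _ φ q.1 q.2 := by
  induction φ with
  | falsum => exact h.const False
  | @equal n t₁ t₂ =>
    have : Dfn 𝓑 fun x (q : (Fin k → ℕ) × (Fin n → ℕ)) => ∃ y : ℕ,
        @Term.realize L ℕ (S x) _ (Sum.elim q.1 q.2) t₁ = y ∧
        @Term.realize L ℕ (S x) _ (Sum.elim q.1 q.2) t₂ = y :=
      h.ex (h.and (dfn_term h hf t₁) (dfn_term h hf t₂))
    exact this.of_iff fun x q => by simp [BoundedFormula.Realize, eq_comm]
  | @rel n l r ts =>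
    have : Dfn 𝓑 fun x (q : (Fin k → ℕ) × (Fin n → ℕ)) => ∃ y : Fin l → ℕ,
        (∀ i, @Term.realize L ℕ (S x) _ (Sum.elim q.1 q.2) (ts i) = y i) ∧
          (S x).RelMap r y := by
      refine h.ex (h.and (h.finAll fun i => ?_) (h.comap (hr l r) Primrec.snd))
      exact h.comap (c := fun c : ((Fin k → ℕ) × (Fin n → ℕ)) × (Fin l → ℕ) =>
        ((c.1.1, c.1.2), c.2 i)) (dfn_term h hf (ts i))
        (by have := primrec_finApp (f := fun c : ((Fin k → ℕ) × (Fin n → ℕ)) ×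
              (Fin l → ℕ) => c.2) i (by fun_prop)
            fun_prop)
    refine this.of_iff fun x q => ?_
    simp only [← funext_iff, exists_eq_left', BoundedFormula.Realize]
  | imp _ _ ih₁ ih₂ => exact h.imp ih₁ ih₂
  | @all n φ ih =>
    have : Dfn 𝓑 fun x (q : (Fin k → ℕ) × (Fin n → ℕ)) => ∀ y : ℕ,
        @BoundedFormula.Realize L ℕ (S x) _ _ φ q.1 (Fin.snoc q.2 y) := by
      refine h.all (h.comap (c := fun c : ((Fin k → ℕ) × (Fin n → ℕ)) × ℕ =>
        (c.1.1, (Fin.snoc c.1.2 c.2 : Fin (n + 1) → ℕ))) ih ?_)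
      have : Primrec fun c : ((Fin k → ℕ) × (Fin n → ℕ)) × ℕ =>
          (Fin.snoc c.1.2 c.2 : Fin (n + 1) → ℕ) := by
        refine primrec_finLam fun i => ?_
        refine Fin.lastCases ?_ (fun i => ?_) i
        · simp only [Fin.snoc_last]; fun_prop
        · simp only [Fin.snoc_castSucc]; exact primrec_finApp i (by fun_prop)
      fun_prop
    exact this.of_iff fun x q => Iff.rfl

open Language in
/-- Every uniformly definable relation belongs to each arithmetically closed family that contains
the interpretations of all symbols. -/
theorem FO.dfn {𝓑 : Set (𝒳 → ℕ → Prop)} (h : ArithClosed 𝓑)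
    (hf : ∀ n (f : L.Functions n), Dfn 𝓑 fun x (q : (Fin n → ℕ) × ℕ) =>
      (S x).funMap f q.1 = q.2)
    (hr : ∀ n (r : L.Relations n), Dfn 𝓑 fun x (v : Fin n → ℕ) => (S x).RelMap r v)
    {p : 𝒳 → (Fin k → ℕ) → Prop} (hp : FO S p) : Dfn 𝓑 p := by
  obtain ⟨φ, hφ⟩ := hp
  have h1 := h.comap (c := fun v : Fin k → ℕ => (v, (default : Fin 0 → ℕ)))
    (dfn_boundedFormula h hf hr φ) (by fun_prop)
  refine h1.of_iff fun x v => (hφ x v).trans ?_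
  let := S x
  exact iff_of_eq (congrArg (BoundedFormula.Realize φ v) (Subsingleton.elim _ _))

end Uniform

/-! ### Definability in a structure -/

section Symbols

variable {L : FirstOrder.Language.{0, 0}} {𝒳 : Type*} {S : 𝒳 → L.Structure ℕ} {n : ℕ}

theorem FO.relMap (r : L.Relations n) : FO S fun x v => (S x).RelMap r v := by
  refine ⟨r.formula Language.Term.var, fun x v => ?_⟩
  let := S x
  beta_reduce
  rw [Language.Formula.realize_rel]
  exact Iff.rfl

theorem FO.funMap (f : L.Functions n) :
    FO S fun x (w : Fin (n + 1) → ℕ) => (S x).funMap f (fun i => w i.castSucc) = w (Fin.last n) := by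
  refine ⟨(Language.Term.func f fun i => Language.Term.var i.castSucc).equal
    (Language.Term.var (Fin.last n)), fun x v => ?_⟩
  let := S x
  beta_reduce
  rw [Language.Formula.realize_equal]
  exact Iff.rfl

theorem dfn_snoc {𝓑 : Set (𝒳 → ℕ → Prop)} (h : ArithClosed 𝓑) {f : 𝒳 → (Fin n → ℕ) → ℕ}
    (hf : Dfn 𝓑 fun x (w : Fin (n + 1) → ℕ) => f x (fun i => w i.castSucc) = w (Fin.last n)) :
    Dfn 𝓑 fun x (q : (Fin n → ℕ) × ℕ) => f x q.1 = q.2 := by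
  refine h.comap (c := fun q : (Fin n → ℕ) × ℕ => (Fin.snoc q.1 q.2 : Fin (n + 1) → ℕ))
    hf (primrec_finLam fun i => ?_) |>.of_iff fun _ q => by simp
  refine Fin.lastCases ?_ (fun i => ?_) i
  · simp only [Fin.snoc_last]; fun_prop
  · simp only [Fin.snoc_castSucc]; exact primrec_finApp i (by fun_prop)

end Symbols

section Family

variable {𝒳 𝒴 : Type*} {α : Type*} [Primcodable α]

theorem ArithClosed.pullback {𝓑 : Set (𝒳 → ℕ → Prop)} (h : ArithClosed 𝓑) (F : 𝒳 → 𝒴) :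
    ArithClosed {p : 𝒴 → ℕ → Prop | (fun x => p (F x)) ∈ 𝓑} where
  not_mem hp := h.not_mem hp
  and_mem hp hq := h.and_mem hp hq
  ex_mem hp := h.ex_mem hp
  comap_mem hp hc := h.comap_mem hp hc
  eq_mem := h.eq_mem

/-- The relations obtained from a closed family by fixing the parameter `x₀` form a closed family. -/
theorem ArithClosed.slice {𝓑 : Set (𝒳 → ℕ → Prop)} (h : ArithClosed 𝓑) (x₀ : 𝒳) :
    ArithClosed {p : Unit → ℕ → Prop | ∃ q ∈ 𝓑, ∀ u m, p u m ↔ q x₀ m} where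
  not_mem := by
    rintro p ⟨q, hq, h1⟩
    exact ⟨_, h.not_mem hq, fun u m => by simp only [h1]⟩
  and_mem := by
    rintro p p' ⟨q, hq, h1⟩ ⟨q', hq', h2⟩
    exact ⟨_, h.and_mem hq hq', fun u m => by simp only [h1, h2]⟩
  ex_mem := by
    rintro p ⟨q, hq, h1⟩
    exact ⟨_, h.ex_mem hq, fun u m => by simp only [h1]⟩
  comap_mem := by
    rintro p c ⟨q, hq, h1⟩ hc
    exact ⟨_, h.comap_mem hq hc, fun u m => by simp only [h1]⟩
  eq_mem := ⟨_, h.eq_mem, fun _ _ => Iff.rfl⟩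

/-- The interpretation of the symbol `s` belongs to the family `𝓑`. -/
def SymDfn (𝓑 : Set (𝒳 → ℕ → Prop)) : Symbol → Prop
  | .pred n A => Dfn 𝓑 fun _ (v : Fin n → ℕ) => v ∈ A
  | .func n f => Dfn 𝓑 fun _ (q : (Fin n → ℕ) × ℕ) => f q.1 = q.2

theorem SymDfn.mono {𝓑 𝓒 : Set (𝒳 → ℕ → Prop)} (h : 𝓑 ⊆ 𝓒) {s : Symbol} (hs : SymDfn 𝓑 s) :
    SymDfn 𝓒 s := by
  cases s <;> exact h hs

end Family

namespace Struc

variable (M : Struc)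

/-- The structure `M`, as a family indexed by one point. -/
@[reducible]
def frame : Unit → M.lang.Structure ℕ := fun _ => M.langStructure

/-- The relations definable in `M`, with coded arguments. -/
def family : Set (Unit → ℕ → Prop) := UDef M.frame

variable {M}

theorem def_iff_fo {k : ℕ} {B : Set (Fin k → ℕ)} :
    M.Def B ↔ FO M.frame fun _ v => v ∈ B := by
  unfold Struc.Def
  rw [Set.empty_definable_iff]
  refine exists_congr fun φ => ⟨fun h x v => ?_, fun h => Set.ext fun v => h () v⟩
  rw [h]
  rfl

theorem fo_pred {n : ℕ} {A : Set (Fin n → ℕ)} (h : Symbol.pred n A ∈ M.carrier) :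
    FO M.frame fun _ v => v ∈ A :=
  FO.relMap (S := M.frame) (⟨A, h⟩ : {A // Symbol.pred n A ∈ M.carrier})

theorem fo_func {n : ℕ} {f : (Fin n → ℕ) → ℕ} (h : Symbol.func n f ∈ M.carrier) :
    FOFun M.frame f :=
  FO.funMap (S := M.frame) (⟨f, h⟩ : {f // Symbol.func n f ∈ M.carrier})

theorem hasArith : HasArith M.frame where
  add_graph := by
    have h : Symbol.func 2 (fun v => v 0 + v 1) ∈ M.carrier := M.arith (by simp [arithmetic])
    exact fo_func h
  mul_graph := by
    have h : Symbol.func 2 (fun v => v 0 * v 1) ∈ M.carrier := M.arith (by simp [arithmetic])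
    exact fo_func h

variable (M) in
theorem closed : ArithClosed M.family := M.hasArith.arithClosed

theorem def_iff {k : ℕ} {B : Set (Fin k → ℕ)} :
    M.Def B ↔ Dfn M.family fun _ v => v ∈ B :=
  def_iff_fo.trans hasArith.fo_iff_dfn

theorem symDfn {s : Symbol} (hs : s ∈ M.carrier) : SymDfn M.family s := by
  cases s with
  | pred n A => exact hasArith.fo_iff_dfn.1 (fo_pred hs)
  | func n f => exact dfn_snoc M.closed (hasArith.fo_iff_dfn.1 (fo_func hs))

/-- The definable relations of `M` belong to every arithmetically closed family that contains the
symbols of `M`. -/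
theorem family_subset {𝓑 : Set (Unit → ℕ → Prop)} (h : ArithClosed 𝓑)
    (hs : ∀ s ∈ M.carrier, SymDfn 𝓑 s) : M.family ⊆ 𝓑 := by
  intro p hp
  have := FO.dfn (S := M.frame) h (fun n (f : {f // Symbol.func n f ∈ M.carrier}) => hs _ f.2)
    (fun n (r : {A // Symbol.pred n A ∈ M.carrier}) => hs _ r.2) hp
  refine dfn_nat.1 ((h.comap (c := fun m : ℕ => ((fun _ => m : Fin 1 → ℕ))) this ?_).of_iff
    fun _ _ => Iff.rfl)
  exact primrec_finLam fun i => by fun_prop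

theorem family_mono {M' : Struc} (h : M.carrier ⊆ M'.carrier) : M.family ⊆ M'.family :=
  family_subset M'.closed fun _ hs => symDfn (h hs)

theorem family_subset_add {Y : Set Symbol} : M.family ⊆ (M.add Y).family :=
  family_mono Set.subset_union_left

theorem symDfn_add {Y : Set Symbol} {s : Symbol} (hs : s ∈ Y) : SymDfn (M.add Y).family s :=
  symDfn (Set.mem_union_right _ hs)

theorem family_add_subset {𝓑 : Set (Unit → ℕ → Prop)} (h : ArithClosed 𝓑) {Y : Set Symbol}
    (hM : M.family ⊆ 𝓑) (hY : ∀ s ∈ Y, SymDfn 𝓑 s) : (M.add Y).family ⊆ 𝓑 :=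
  family_subset h fun s hs => hs.elim (fun hs => (symDfn hs).mono hM) (hY s)

theorem mem_defSets {X : Set ℕ} : X ∈ M.defSets ↔ (fun _ m => m ∈ X) ∈ M.family :=
  def_iff_fo

end Struc

theorem dfn_vec₂ {𝒳 : Type*} {𝓑 : Set (𝒳 → ℕ → Prop)} (h : ArithClosed 𝓑)
    {R : 𝒳 → ℕ → ℕ → Prop} :
    (Dfn 𝓑 fun x (v : Fin 2 → ℕ) => R x (v 0) (v 1)) ↔
      Dfn 𝓑 fun x (q : ℕ × ℕ) => R x q.1 q.2 := by
  constructor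
  · intro hR
    refine h.comap (c := fun q : ℕ × ℕ => (![q.1, q.2] : Fin 2 → ℕ)) hR
      (primrec_finLam fun i => ?_)
    fin_cases i
    · exact Primrec.fst
    · exact Primrec.snd
  · intro hR
    exact h.comap (c := fun v : Fin 2 → ℕ => (v 0, v 1)) hR
      ((primrec_finApp 0 Primrec.id).pair (primrec_finApp 1 Primrec.id))

theorem dfn_vec₁ {𝒳 : Type*} {𝓑 : Set (𝒳 → ℕ → Prop)} (h : ArithClosed 𝓑)
    {R : 𝒳 → ℕ → Prop} :
    (Dfn 𝓑 fun x (v : Fin 1 → ℕ) => R x (v 0)) ↔ R ∈ 𝓑 := by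
  rw [← dfn_nat]
  constructor
  · intro hR
    exact h.comap (c := fun q : ℕ => (fun _ => q : Fin 1 → ℕ)) hR
      (primrec_finLam fun i => Primrec.id)
  · intro hR
    exact h.comap (c := fun v : Fin 1 → ℕ => v 0) hR (primrec_finApp 0 Primrec.id)

theorem symDfn_ext₂ {𝒳 : Type*} {𝓑 : Set (𝒳 → ℕ → Prop)} (h : ArithClosed 𝓑)
    {R : ℕ → ℕ → Prop} : SymDfn 𝓑 (.pred 2 (ext₂ R)) ↔ Dfn 𝓑 fun _ (q : ℕ × ℕ) => R q.1 q.2 :=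
  dfn_vec₂ h (R := fun _ => R)

theorem Struc.def_ext₂ {M : Struc} {R : ℕ → ℕ → Prop} :
    M.Def (ext₂ R) ↔ Dfn M.family fun _ (q : ℕ × ℕ) => R q.1 q.2 :=
  Struc.def_iff.trans (dfn_vec₂ M.closed (R := fun _ => R))

theorem isUniversal_iff {M : Struc} {G : ℕ → ℕ → Prop} :
    IsUniversal M G ↔ ∀ p ∈ M.family, ∃ n, ∀ m, p () m ↔ G n m := by
  constructor
  · intro h p hp
    obtain ⟨n, hn⟩ := h {m | p () m} (Struc.mem_defSets.2 hp)
    exact ⟨n, fun m => Set.ext_iff.1 hn m⟩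
  · intro h X hX
    obtain ⟨n, hn⟩ := h _ (Struc.mem_defSets.1 hX)
    exact ⟨n, Set.ext hn⟩

/-- A universal predicate is not definable, by diagonalization. -/
theorem IsUniversal.not_dfn {M : Struc} {G : ℕ → ℕ → Prop} (h : IsUniversal M G) :
    ¬ Dfn M.family fun _ (q : ℕ × ℕ) => G q.1 q.2 := by
  intro hG
  have h1 : Dfn M.family fun _ (m : ℕ) => ¬ G m m :=
    M.closed.not (M.closed.comap (c := fun m : ℕ => (m, m)) hG (by fun_prop))
  obtain ⟨n, hn⟩ := isUniversal_iff.1 h _ (dfn_nat.1 h1)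
  exact iff_not_self (hn n).symm

/-! ### Formula schemes -/

section Schemes

variable (M : Struc) {s : ℕ} (lam : Fin s → ℕ)

/-- The structure `M` together with an interpretation of the second-order variables. -/
@[reducible]
def schemeFrame (A : SetTuple lam) : (M.lang.sum (varLang lam)).Structure ℕ :=
  letI := varStructure A
  Language.sumStructure M.lang (varLang lam) ℕ

/-- The relations between tuples of sets and numbers that are given by formula schemes. -/
def schemeFamily : Set (SetTuple lam → ℕ → Prop) := UDef (schemeFrame M lam)

variable {M lam}

theorem fo_scheme {k : ℕ} {p : SetTuple lam → (Fin k → ℕ) → Prop} :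
    FO (schemeFrame M lam) p ↔ ∃ ψ : Scheme M lam k, ∀ A v, p A v ↔ ψ.Holds A v :=
  Iff.rfl

theorem fo_scheme_func {n : ℕ} {f : (Fin n → ℕ) → ℕ} (h : Symbol.func n f ∈ M.carrier) :
    FOFun (schemeFrame M lam) f :=
  FO.funMap (S := schemeFrame M lam) (Sum.inl (⟨f, h⟩ : {f // Symbol.func n f ∈ M.carrier}))

theorem schemeHasArith : HasArith (schemeFrame M lam) where
  add_graph := by
    have h : Symbol.func 2 (fun v => v 0 + v 1) ∈ M.carrier := M.arith (by simp [arithmetic])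
    exact fo_scheme_func h
  mul_graph := by
    have h : Symbol.func 2 (fun v => v 0 * v 1) ∈ M.carrier := M.arith (by simp [arithmetic])
    exact fo_scheme_func h

theorem schemeClosed : ArithClosed (schemeFamily M lam) := schemeHasArith.arithClosed

theorem dfn_scheme_var (i : Fin s) :
    Dfn (schemeFamily M lam) fun A (v : Fin (lam i) → ℕ) => v ∈ A i :=
  schemeHasArith.fo_iff_dfn.1 (FO.relMap (S := schemeFrame M lam) (Sum.inr (VarRel.var i)))

theorem symDfn_scheme {t : Symbol} (ht : t ∈ M.carrier) : SymDfn (schemeFamily M lam) t := by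
  cases t with
  | pred n A =>
    exact schemeHasArith.fo_iff_dfn.1 (FO.relMap (S := schemeFrame M lam)
      (Sum.inl (⟨A, ht⟩ : {A // Symbol.pred n A ∈ M.carrier})))
  | func n f =>
    exact dfn_snoc schemeClosed (schemeHasArith.fo_iff_dfn.1 (fo_scheme_func (lam := lam) ht))

theorem schemeFamily_subset {𝓑 : Set (SetTuple lam → ℕ → Prop)} (h : ArithClosed 𝓑)
    (hs : ∀ t ∈ M.carrier, SymDfn 𝓑 t)
    (hv : ∀ i, Dfn 𝓑 fun A (v : Fin (lam i) → ℕ) => v ∈ A i) : schemeFamily M lam ⊆ 𝓑 := by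
  intro p hp
  have := FO.dfn (S := schemeFrame M lam) h (fun n f => by
      rcases f with ⟨f, hf⟩ | f
      · exact hs _ hf
      · exact nomatch f)
    (fun n r => by
      rcases r with ⟨r, hr⟩ | r
      · exact hs _ hr
      · obtain ⟨i⟩ : VarRel lam n := r
        exact hv i) hp
  exact (dfn_vec₁ h).1 this

/-- Relations definable in `M` are given by schemes without second-order variables. -/
theorem Dfn.scheme {α : Type*} [Primcodable α] {p : α → Prop}
    (hp : Dfn M.family fun _ => p) : Dfn (schemeFamily M lam) fun _ => p :=
  Struc.family_subset ((schemeClosed (M := M) (lam := lam)).pullback fun _ => ())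
    (fun t ht => by cases t <;> exact symDfn_scheme ht) hp

theorem isSigma11_iff {k : ℕ} {B : Set (Fin k → ℕ)} : IsSigma11 M B ↔
    ∃ (s : ℕ) (lam : Fin s → ℕ) (q : SetTuple lam → (Fin k → ℕ) → Prop),
      Dfn (schemeFamily M lam) q ∧ ∀ v, v ∈ B ↔ ∃ A, q A v := by
  refine exists_congr fun s => exists_congr fun lam => ?_
  constructor
  · rintro ⟨ψ, hψ⟩
    exact ⟨_, schemeHasArith.fo_iff_dfn.1 ⟨ψ, fun _ _ => Iff.rfl⟩, hψ⟩
  · rintro ⟨q, hq, h⟩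
    obtain ⟨ψ, hψ⟩ := schemeHasArith.fo_iff_dfn.2 hq
    exact ⟨ψ, fun v => (h v).trans (exists_congr fun A => hψ A v)⟩

theorem isPi11_iff {k : ℕ} {B : Set (Fin k → ℕ)} : IsPi11 M B ↔
    ∃ (s : ℕ) (lam : Fin s → ℕ) (q : SetTuple lam → (Fin k → ℕ) → Prop),
      Dfn (schemeFamily M lam) q ∧ ∀ v, v ∈ B ↔ ∀ A, q A v := by
  refine exists_congr fun s => exists_congr fun lam => ?_
  constructor
  · rintro ⟨ψ, hψ⟩
    exact ⟨_, schemeHasArith.fo_iff_dfn.1 ⟨ψ, fun _ _ => Iff.rfl⟩, hψ⟩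
  · rintro ⟨q, hq, h⟩
    obtain ⟨ψ, hψ⟩ := schemeHasArith.fo_iff_dfn.2 hq
    exact ⟨ψ, fun v => (h v).trans (forall_congr' fun A => hψ A v)⟩

theorem IsPi11.compl {k : ℕ} {B : Set (Fin k → ℕ)} (h : IsPi11 M B) : IsSigma11 M Bᶜ := by
  obtain ⟨s, lam, q, hq, h⟩ := isPi11_iff.1 h
  exact isSigma11_iff.2 ⟨s, lam, _, schemeClosed.not hq, fun v => by
    rw [Set.mem_compl_iff, h, not_forall]⟩

theorem hasProperImplicitDef_iff {A : SetTuple lam} : HasProperImplicitDef M A ↔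
    ∃ q ∈ schemeFamily M lam, ∀ A', q A' 0 ↔ A' = A := by
  constructor
  · rintro ⟨ψ, hψ⟩
    refine ⟨_, dfn_nat.1 (schemeClosed.comap (c := fun _ : ℕ => (Fin.elim0 : Fin 0 → ℕ))
      (schemeHasArith.fo_iff_dfn.1 ⟨ψ, fun _ _ => Iff.rfl⟩) (Primrec.const _)), hψ⟩
  · rintro ⟨q, hq, h⟩
    obtain ⟨ψ, hψ⟩ := schemeHasArith.fo_iff_dfn.2 (schemeClosed.comap
      (c := fun _ : Fin 0 → ℕ => 0) (dfn_nat.2 hq) (Primrec.const _))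
    exact ⟨ψ, fun A' => (hψ _ _).symm.trans (h A')⟩

/-- A set definable with a tuple `A` of additional predicates is given by a scheme evaluated
at `A`. -/
theorem exists_scheme_of_def_add {A : SetTuple lam} {k : ℕ} {B : Set (Fin k → ℕ)}
    (h : (M.add (Set.range fun i => Symbol.pred (lam i) (A i))).Def B) :
    ∃ q : SetTuple lam → (Fin k → ℕ) → Prop, Dfn (schemeFamily M lam) q ∧
      ∀ v, v ∈ B ↔ q A v := by
  have h1 := Struc.family_subset ((schemeClosed (M := M) (lam := lam)).slice A) (fun t ht => by
    rcases ht with ht | ⟨i, rfl⟩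
    · cases t <;> exact ⟨_, symDfn_scheme ht, fun _ _ => Iff.rfl⟩
    · exact ⟨_, dfn_scheme_var i, fun _ _ => Iff.rfl⟩) (Struc.def_iff.1 h)
  obtain ⟨q, hq, h2⟩ := h1
  refine ⟨fun A v => q A (@encode (Fin k → ℕ) Primcodable.toEncodable v),
    schemeClosed.comap (dfn_nat.2 hq) Primrec.encode, fun v => ?_⟩
  beta_reduce
  rw [← h2 ()]
  have he := @encodek (Fin k → ℕ) Primcodable.toEncodable v
  constructor
  · intro hv
    exact ⟨v, he, hv⟩
  · rintro ⟨w, hw, hv⟩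
    rw [Option.mem_def] at hw
    have := he.symm.trans hw
    simp only [Option.some.injEq] at this
    rwa [this]

/-- Implicitly definable sets are hyperarithmetical: the implicitly defined tuple may be
quantified existentially as well as universally. -/
theorem ImplicitlyDefinable.isHyperarithmetical {k : ℕ} {B : Set (Fin k → ℕ)}
    (h : ImplicitlyDefinable M B) : IsHyperarithmetical M B := by
  obtain ⟨s, lam, A, hA, hB⟩ := h
  obtain ⟨p, hp, hA⟩ := hasProperImplicitDef_iff.1 hA
  obtain ⟨q, hq, hB⟩ := exists_scheme_of_def_add hB
  have hp' : Dfn (schemeFamily M lam) fun A (_ : Fin k → ℕ) => p A 0 :=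
    schemeClosed.comap (dfn_nat.2 hp) (Primrec.const 0)
  refine ⟨isSigma11_iff.2 ⟨s, lam, _, schemeClosed.and hp' hq, fun v => ?_⟩,
    isPi11_iff.2 ⟨s, lam, _, schemeClosed.imp hp' hq, fun v => ?_⟩⟩
  · simp [hA, hB]
  · simp [hA, hB]

end Schemes

/-! ### Oracles: a finite structure as one function -/

section Oracles

theorem recursiveIn_of_primrec {O : Set (ℕ →. ℕ)} {f : ℕ → ℕ} (hf : Primrec f) :
    Nat.RecursiveIn O fun m => Part.some (f m) :=
  (Primrec.nat_iff.1 hf).recursiveIn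

theorem recursiveIn_comp {O : Set (ℕ →. ℕ)} {f g : ℕ → ℕ}
    (hf : Nat.RecursiveIn O fun m => Part.some (f m))
    (hg : Nat.RecursiveIn O fun m => Part.some (g m)) :
    Nat.RecursiveIn O fun m => Part.some (f (g m)) :=
  (Nat.RecursiveIn.comp hf hg).of_eq fun m => by simp

theorem recursiveIn_pair {O : Set (ℕ →. ℕ)} {f g : ℕ → ℕ}
    (hf : Nat.RecursiveIn O fun m => Part.some (f m))
    (hg : Nat.RecursiveIn O fun m => Part.some (g m)) :
    Nat.RecursiveIn O fun m => Part.some (Nat.pair (f m) (g m)) :=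
  (Nat.RecursiveIn.pair hf hg).of_eq fun m => by simp [Seq.seq]

theorem recursiveIn_rec {O : Set (ℕ →. ℕ)} {f g : ℕ → ℕ}
    (hf : Nat.RecursiveIn O fun m => Part.some (f m))
    (hg : Nat.RecursiveIn O fun m => Part.some (g m)) :
    Nat.RecursiveIn O fun p => Part.some (p.unpair.2.rec (motive := fun _ => ℕ)
      (f p.unpair.1) fun y i => g (Nat.pair p.unpair.1 (Nat.pair y i))) := by
  refine (Nat.RecursiveIn.prec hf hg).of_eq fun p => ?_
  show (p.unpair.2.rec (Part.some (f p.unpair.1)) fun y IH =>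
    Part.bind IH fun i => Part.some (g (Nat.pair p.unpair.1 (Nat.pair y i))) : Part ℕ) = _
  induction p.unpair.2 with
  | zero => rfl
  | succ n ih =>
    refine (congrArg (fun q : Part ℕ => Part.bind q _) ih).trans ?_
    rw [Part.bind_some]

/-- Finitely many total functions can be combined into one. -/
theorem exists_combination {O : Set (ℕ →. ℕ)} {F : Set (ℕ → ℕ)} (hF : F.Finite)
    (h : ∀ f ∈ F, Nat.RecursiveIn O fun m => Part.some (f m)) :
    ∃ g : ℕ → ℕ, (Nat.RecursiveIn O fun m => Part.some (g m)) ∧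
      ∀ f ∈ F, ∃ i, ∀ m, g (Nat.pair i m) = f m := by
  induction F, hF using Set.Finite.induction_on with
  | empty => exact ⟨fun _ => 0, recursiveIn_of_primrec (Primrec.const 0), by simp⟩
  | @insert a F _ _ ih =>
    obtain ⟨g, hg, hi⟩ := ih fun f hf => h f (Set.mem_insert_of_mem _ hf)
    have h1 := recursiveIn_rec (h a (Set.mem_insert _ _)) (recursiveIn_comp hg
      (recursiveIn_of_primrec (f := fun m => Nat.pair m.unpair.2.unpair.1 m.unpair.1)
        (by fun_prop)))
    have h2 := recursiveIn_comp h1 (recursiveIn_of_primrec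
      (f := fun m => Nat.pair m.unpair.2 m.unpair.1) (by fun_prop))
    refine ⟨_, h2, ?_⟩
    rintro f (rfl | hf)
    · exact ⟨0, fun m => by simp⟩
    · obtain ⟨i, hi⟩ := hi f hf
      exact ⟨i + 1, fun m => by simp [hi]⟩

open Classical in
/-- The interpretation of a symbol, applied to coded tuples. -/
noncomputable def symFun : Symbol → ℕ → ℕ
  | .func _ f => fun m => f fun i => entry m i
  | .pred n A => fun m => if (fun i : Fin n => entry m i) ∈ A then 1 else 0

theorem mem_oracles {N : Struc} {o : ℕ →. ℕ} :
    o ∈ oracles N ↔ ∃ s ∈ N.carrier, o = fun m => Part.some (symFun s m) := by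
  constructor
  · rintro (⟨n, f, hf, rfl⟩ | ⟨n, A, hA, rfl⟩)
    · exact ⟨_, hf, rfl⟩
    · exact ⟨_, hA, rfl⟩
  · rintro ⟨s | s, hs, rfl⟩
    · exact Or.inr ⟨_, _, hs, rfl⟩
    · exact Or.inl ⟨_, _, hs, rfl⟩

/-- The function `g` is recursive in `N` and codes all symbols of `N`. -/
structure IsCoding (N : Struc) (g : ℕ → ℕ) : Prop where
  recursiveIn : Nat.RecursiveIn (oracles N) fun m => Part.some (g m)
  symbol : ∀ s ∈ N.carrier, ∃ i, ∀ m, g (Nat.pair i m) = symFun s m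

theorem exists_isCoding {N : Struc} (hN : N.LFinite) : ∃ g, IsCoding N g := by
  obtain ⟨g, hg, h⟩ := exists_combination (O := oracles N) (hN.image symFun) (by
    rintro _ ⟨s, hs, rfl⟩
    exact .oracle _ (mem_oracles.2 ⟨s, hs, rfl⟩))
  exact ⟨g, hg, fun s hs => h _ ⟨s, hs, rfl⟩⟩

theorem entry_encode_ofFn {n : ℕ} (v : Fin n → ℕ) (i : Fin n) :
    entry (encode (List.ofFn v)) i = v i := by
  simp [entry]

theorem dfn_symFun {𝒳 : Type*} {𝓑 : Set (𝒳 → ℕ → Prop)} (h : ArithClosed 𝓑) {s : Symbol}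
    (hs : SymDfn 𝓑 s) : Dfn 𝓑 fun _ (q : ℕ × ℕ) => symFun s q.1 = q.2 := by
  cases s with
  | func n f =>
    exact h.comap (c := fun q : ℕ × ℕ => ((fun i => entry q.1 i : Fin n → ℕ), q.2)) hs
      ((primrec_finLam fun i => by fun_prop).pair Primrec.snd)
  | pred n A =>
    have h1 : Dfn 𝓑 fun _ (q : ℕ × ℕ) => (fun i => entry q.1 i : Fin n → ℕ) ∈ A :=
      h.comap (c := fun q : ℕ × ℕ => (fun i => entry q.1 i : Fin n → ℕ)) hs
        (primrec_finLam fun i => by fun_prop)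
    refine (h.or (h.and h1 (h.eq Primrec.snd (Primrec.const 1)))
      (h.and (h.not h1) (h.eq Primrec.snd (Primrec.const 0)))).of_iff fun _ q => ?_
    simp only [symFun]
    split_ifs with hq <;> simp [hq, eq_comm]

theorem symDfn_of_symFun {𝒳 : Type*} {𝓑 : Set (𝒳 → ℕ → Prop)} (h : ArithClosed 𝓑) {s : Symbol}
    (hs : Dfn 𝓑 fun _ (q : ℕ × ℕ) => symFun s q.1 = q.2) : SymDfn 𝓑 s := by
  have hc (n : ℕ) : Primrec fun v : Fin n → ℕ => encode (List.ofFn v) :=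
    Primrec.encode.comp (Primrec.list_ofFn fun i => primrec_finApp i Primrec.id)
  cases s with
  | func n f =>
    refine (h.comap (c := fun q : (Fin n → ℕ) × ℕ => (encode (List.ofFn q.1), q.2)) hs
      (((hc n).comp Primrec.fst).pair Primrec.snd)).of_iff fun _ q => ?_
    simp only [symFun, entry_encode_ofFn]
  | pred n A =>
    refine (h.comap (c := fun v : Fin n → ℕ => (encode (List.ofFn v), 1)) hs
      ((hc n).pair (Primrec.const 1))).of_iff fun _ q => ?_
    have he : (fun i : Fin n => entry (encode (List.ofFn q)) i) = q :=
      funext (entry_encode_ofFn q)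
    simp only [symFun]
    split_ifs with hq
    · simpa [he] using hq
    · simpa [he] using hq

theorem IsCoding.symDfn {N : Struc} {g : ℕ → ℕ} (hg : IsCoding N g) {𝒳 : Type*}
    {𝓑 : Set (𝒳 → ℕ → Prop)} (h : ArithClosed 𝓑)
    (hd : Dfn 𝓑 fun _ (q : ℕ × ℕ) => g q.1 = q.2) {s : Symbol} (hs : s ∈ N.carrier) :
    SymDfn 𝓑 s := by
  obtain ⟨i, hi⟩ := hg.symbol s hs
  refine symDfn_of_symFun h ((h.comap (c := fun q : ℕ × ℕ => (Nat.pair i q.1, q.2)) hd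
    (by fun_prop)).of_iff fun _ q => by simp only [hi])

/-- Functions recursive in the oracles of `N` are definable in `N`. -/
theorem Struc.dfn_recursiveIn {N : Struc} {f : ℕ →. ℕ} (hf : Nat.RecursiveIn (oracles N) f) :
    Dfn N.family fun _ (q : ℕ × ℕ) => q.2 ∈ f q.1 := by
  have h1 : FO N.frame fun _ (v : Fin 2 → ℕ) => v 1 ∈ f (v 0) := by
    refine Struc.hasArith.recursiveIn_graph (fun o ho => ?_) hf
    obtain ⟨s, hs, rfl⟩ := mem_oracles.1 ho
    refine Struc.hasArith.fo_iff_dfn.2 ((dfn_vec₂ N.closed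
      (R := fun _ a b => b ∈ Part.some (symFun s a))).2 ?_)
    exact (dfn_symFun N.closed (Struc.symDfn hs)).of_iff fun _ q => by simp [eq_comm]
  exact (dfn_vec₂ N.closed (R := fun _ a b => b ∈ f a)).1 (Struc.hasArith.fo_iff_dfn.1 h1)

theorem IsCoding.dfn {N : Struc} {g : ℕ → ℕ} (hg : IsCoding N g) :
    Dfn N.family fun _ (q : ℕ × ℕ) => g q.1 = q.2 :=
  (Struc.dfn_recursiveIn hg.recursiveIn).of_iff fun _ q => by simp [eq_comm]

end Oracles

/-! ### Recursion along a well-founded relation -/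

section Recursion

/-- The part of `Y` below `w`. -/
def trunc (r : ℕ → ℕ → Prop) (Y : ℕ → ℕ → Prop) (w : ℕ) : ℕ → ℕ → Prop :=
  fun v y => r v w ∧ Y v y

/-- The relation defined by iterating the operator `Φ` along `r`. -/
noncomputable def hier {r : ℕ → ℕ → Prop} (hr : WellFounded r)
    (Φ : (ℕ → ℕ → Prop) → ℕ → ℕ → Prop) : ℕ → ℕ → Prop :=
  hr.fix fun w ih z => Φ (fun v y => ∃ h : r v w, ih v h y) w z

variable {r : ℕ → ℕ → Prop} {Φ : (ℕ → ℕ → Prop) → ℕ → ℕ → Prop}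

theorem hier_iff (hr : WellFounded r) (w z : ℕ) :
    hier hr Φ w z ↔ Φ (trunc r (hier hr Φ) w) w z := by
  have : trunc r (hier hr Φ) w = fun v y => ∃ _ : r v w, hier hr Φ v y := by
    ext v y
    simp [trunc]
  rw [this, hier, hr.fix_eq]

/-- The relation `Y` satisfies the recursion equation of `Φ` along `r` on the set `D`. -/
def IsHier (r : ℕ → ℕ → Prop) (Φ : (ℕ → ℕ → Prop) → ℕ → ℕ → Prop) (D : ℕ → Prop)
    (Y : ℕ → ℕ → Prop) : Prop :=
  ∀ w, D w → ∀ z, Y w z ↔ Φ (trunc r Y w) w z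

theorem isHier_hier (hr : WellFounded r) (D : ℕ → Prop) : IsHier r Φ D (hier hr Φ) :=
  fun w _ z => hier_iff hr w z

theorem IsHier.eq_hier (hr : WellFounded r) {D : ℕ → Prop} {Y : ℕ → ℕ → Prop}
    (hY : IsHier r Φ D Y) (hD : ∀ v w, r v w → D w → D v) (w : ℕ) (hw : D w) (z : ℕ) :
    Y w z ↔ hier hr Φ w z := by
  induction w using hr.induction generalizing z with
  | _ w ih =>
    have : trunc r Y w = trunc r (hier hr Φ) w := by
      ext v y
      exact and_congr_right fun hv => ih v hv (hD v w hv hw) y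
    rw [hY w hw, hier_iff, this]

/-- The operator `Φ` is definable over `N`, uniformly in its argument. -/
def IsDefinableOp (N : Struc) (Φ : (ℕ → ℕ → Prop) → ℕ → ℕ → Prop) : Prop :=
  ∀ {𝒳 : Type} {𝓑 : Set (𝒳 → ℕ → Prop)}, ArithClosed 𝓑 → (∀ s ∈ N.carrier, SymDfn 𝓑 s) →
    ∀ {α : Type} [Primcodable α] {Y : 𝒳 → α → ℕ → ℕ → Prop},
      (Dfn 𝓑 fun x (c : α × ℕ × ℕ) => Y x c.1 c.2.1 c.2.2) →
      Dfn 𝓑 fun x (c : α × ℕ × ℕ) => Φ (Y x c.1) c.2.1 c.2.2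

theorem Dfn.of_structure {N : Struc} {𝒳 : Type*} {𝓑 : Set (𝒳 → ℕ → Prop)} (h : ArithClosed 𝓑)
    (hN : ∀ s ∈ N.carrier, SymDfn 𝓑 s) {α : Type*} [Primcodable α] {p : α → Prop}
    (hp : Dfn N.family fun _ => p) : Dfn 𝓑 fun _ => p :=
  Struc.family_subset (h.pullback fun _ => ()) (fun t ht => by cases t <;> exact hN _ ht) hp

variable {N : Struc} {𝒳 : Type} {𝓑 : Set (𝒳 → ℕ → Prop)} {α : Type} [Primcodable α]

theorem dfn_trunc (h : ArithClosed 𝓑) {r : α → ℕ → ℕ → Prop}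
    (hr : Dfn 𝓑 fun _ (c : α × ℕ × ℕ) => r c.1 c.2.1 c.2.2)
    {Y : 𝒳 → α → ℕ → ℕ → Prop} (hY : Dfn 𝓑 fun x (c : α × ℕ × ℕ) => Y x c.1 c.2.1 c.2.2) :
    Dfn 𝓑 fun x (c : (α × ℕ) × ℕ × ℕ) => trunc (r c.1.1) (Y x c.1.1) c.1.2 c.2.1 c.2.2 :=
  h.and (h.comap (c := fun c : (α × ℕ) × ℕ × ℕ => (c.1.1, c.2.1, c.1.2)) hr (by fun_prop))
    (h.comap (c := fun c : (α × ℕ) × ℕ × ℕ => (c.1.1, c.2.1, c.2.2)) hY (by fun_prop))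

theorem IsDefinableOp.trunc (hΦ : IsDefinableOp N Φ) (h : ArithClosed 𝓑)
    (hN : ∀ s ∈ N.carrier, SymDfn 𝓑 s) {r : α → ℕ → ℕ → Prop}
    (hr : Dfn 𝓑 fun _ (c : α × ℕ × ℕ) => r c.1 c.2.1 c.2.2)
    {Y : 𝒳 → α → ℕ → ℕ → Prop} (hY : Dfn 𝓑 fun x (c : α × ℕ × ℕ) => Y x c.1 c.2.1 c.2.2) :
    Dfn 𝓑 fun x (c : α × ℕ × ℕ) => Φ (trunc (r c.1) (Y x c.1) c.2.1) c.2.1 c.2.2 :=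
  h.comap (c := fun c : α × ℕ × ℕ => ((c.1, c.2.1), c.2.1, c.2.2))
    (hΦ h hN (Y := fun x (a : α × ℕ) => TarskiHierarchy.trunc (r a.1) (Y x a.1) a.2)
      (dfn_trunc h hr hY)) (by fun_prop)

theorem IsDefinableOp.isHier (hΦ : IsDefinableOp N Φ) (h : ArithClosed 𝓑)
    (hN : ∀ s ∈ N.carrier, SymDfn 𝓑 s) {r : α → ℕ → ℕ → Prop}
    (hr : Dfn 𝓑 fun _ (c : α × ℕ × ℕ) => r c.1 c.2.1 c.2.2)
    {Y : 𝒳 → α → ℕ → ℕ → Prop} (hY : Dfn 𝓑 fun x (c : α × ℕ × ℕ) => Y x c.1 c.2.1 c.2.2)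
    {D : 𝒳 → α → ℕ → Prop} (hD : Dfn 𝓑 fun x (c : α × ℕ) => D x c.1 c.2) :
    Dfn 𝓑 fun x (a : α) => IsHier (r a) Φ (D x a) (Y x a) := by
  have h1 := hΦ.trunc h hN hr hY
  refine h.all (h.imp hD (h.all (h.iff ?_ ?_)))
  · exact h.comap (c := fun c : (α × ℕ) × ℕ => (c.1.1, c.1.2, c.2)) hY (by fun_prop)
  · exact h.comap (c := fun c : (α × ℕ) × ℕ => (c.1.1, c.1.2, c.2)) h1 (by fun_prop)

/-- If all initial parts of a hierarchy occur among the columns of `G`, then the hierarchy is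
definable from `G`: each of these parts is the only solution of the recursion equation. -/
theorem dfn_hier_of_columns (hΦ : IsDefinableOp N Φ) (hwf : WellFounded r)
    (htrans : ∀ u v w, r u v → r v w → r u w) (h : ArithClosed 𝓑)
    (hN : ∀ s ∈ N.carrier, SymDfn 𝓑 s) (hr : Dfn 𝓑 fun _ (q : ℕ × ℕ) => r q.1 q.2)
    {D : ℕ → Prop} (hD : Dfn 𝓑 fun _ => D) {G : ℕ → ℕ → Prop}
    (hG : Dfn 𝓑 fun _ (q : ℕ × ℕ) => G q.1 q.2)
    (hcol : ∀ w, D w → ∃ k, ∀ v, r v w → ∀ y, G k (Nat.pair v y) ↔ hier hwf Φ v y) :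
    Dfn 𝓑 fun _ (q : ℕ × ℕ) => D q.1 ∧ hier hwf Φ q.1 q.2 := by
  have hY : Dfn 𝓑 fun _ (c : ℕ × ℕ × ℕ) => G c.1 (Nat.pair c.2.1 c.2.2) :=
    h.comap (c := fun c : ℕ × ℕ × ℕ => (c.1, Nat.pair c.2.1 c.2.2)) hG (by fun_prop)
  have h1 : Dfn 𝓑 fun _ (q : ℕ × ℕ) => D q.1 ∧ ∃ k,
      IsHier r Φ (fun v => r v q.1) (fun v y => G k (Nat.pair v y)) ∧
      Φ (trunc r (fun v y => G k (Nat.pair v y)) q.1) q.1 q.2 := by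
    refine h.and (h.comap hD Primrec.fst) (h.ex (h.and ?_ ?_))
    · refine h.comap (c := fun c : (ℕ × ℕ) × ℕ => (c.1.1, c.2))
        (hΦ.isHier h hN (α := ℕ × ℕ) (r := fun _ => r) (D := fun _ a v => r v a.1)
        (Y := fun _ a v y => G a.2 (Nat.pair v y)) ?_ ?_ ?_) (by fun_prop)
      · exact h.comap (c := fun c : (ℕ × ℕ) × ℕ × ℕ => (c.2.1, c.2.2)) hr (by fun_prop)
      · exact h.comap (c := fun c : (ℕ × ℕ) × ℕ × ℕ => (c.1.2, c.2.1, c.2.2)) hY (by fun_prop)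
      · exact h.comap (c := fun c : (ℕ × ℕ) × ℕ => (c.2, c.1.1)) hr (by fun_prop)
    · exact h.comap (c := fun c : (ℕ × ℕ) × ℕ => (c.2, c.1.1, c.1.2))
        (hΦ.trunc h hN (r := fun _ => r) (Y := fun _ a v y => G a (Nat.pair v y))
          (h.comap (c := fun c : ℕ × ℕ × ℕ => (c.2.1, c.2.2)) hr (by fun_prop)) hY)
        (by fun_prop)
  refine h1.of_iff fun _ q => and_congr_right fun hq => ?_
  obtain ⟨w, z⟩ := q
  have key : ∀ k, (∀ v, r v w → ∀ y, G k (Nat.pair v y) ↔ hier hwf Φ v y) →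
      trunc r (fun v y => G k (Nat.pair v y)) w = trunc r (hier hwf Φ) w := by
    intro k hk
    ext v y
    exact and_congr_right fun hv => hk v hv y
  constructor
  · intro hz
    obtain ⟨k, hk⟩ := hcol w hq
    refine ⟨k, fun v hv y => ?_, ?_⟩
    · refine (hk v hv y).trans ?_
      rw [hier_iff]
      have : trunc r (fun v y => G k (Nat.pair v y)) v = trunc r (hier hwf Φ) v := by
        ext u y
        exact and_congr_right fun hu => hk u (htrans _ _ _ hu hv) y
      rw [this]
    · rw [key k hk]
      exact (hier_iff hwf _ _).1 hz
  · rintro ⟨k, hk, hz⟩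
    have := key k fun v hv y => hk.eq_hier hwf (fun u v hu hv => htrans _ _ _ hu hv) v hv y
    rw [this] at hz
    exact (hier_iff hwf _ _).2 hz

end Recursion

/-! ### Ordinals and their representations -/

section Representations

/-- The strict part of `R`. -/
def strictRel (R : ℕ → ℕ → Prop) (x y : ℕ) : Prop := R x y ∧ x ≠ y

/-- The function `ρ` is an isomorphism of the field of `R` with the ordinal `β`. -/
structure IsRankFun (R : ℕ → ℕ → Prop) (β : Ordinal.{0}) (ρ : ℕ → Ordinal.{0}) : Prop where
  rel_iff : ∀ x y, R x y ↔ R x x ∧ R y y ∧ ρ x ≤ ρ y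
  inj : ∀ x y, R x x → R y y → ρ x = ρ y → x = y
  lt : ∀ x, R x x → ρ x < β
  surj : ∀ γ < β, ∃ x, R x x ∧ ρ x = γ

theorem isRepresentation_iff {R : ℕ → ℕ → Prop} {β : Ordinal.{0}} :
    IsRepresentation R β ↔ ∃ ρ, IsRankFun R β ρ := by
  classical
  constructor
  · rintro ⟨hR, hwo, rfl⟩
    have hmem : ∀ x, R x x ↔ x ∈ rng R := fun x => ⟨fun h => ⟨x, h⟩, hR.refl x⟩
    refine ⟨fun x => if h : x ∈ rng R then Ordinal.typein (strictPart R) ⟨x, h⟩ else 0,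
      ⟨fun x y => ?_, fun x y hx hy h => ?_, fun x hx => ?_, fun γ hγ => ?_⟩⟩
    · constructor
      · intro h
        have hx := hR.dom_subset _ _ h
        have hy : y ∈ rng R := ⟨x, h⟩
        refine ⟨hR.refl x hx, hR.refl y hy, ?_⟩
        simp only [hx, hy, dif_pos]
        by_cases hxy : x = y
        · subst hxy; rfl
        · exact ((Ordinal.typein_lt_typein (strictPart R)).2
            (⟨h, fun e => hxy (congrArg Subtype.val e)⟩ :
              strictPart R ⟨x, hx⟩ ⟨y, hy⟩)).le
      · rintro ⟨hx, hy, h⟩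
        rw [hmem] at hx hy
        simp only [hx, hy, dif_pos] at h
        rcases h.lt_or_eq with h | h
        · exact ((Ordinal.typein_lt_typein (strictPart R)).1 h).1
        · rw [Ordinal.typein_inj] at h
          cases h
          exact hR.refl x hx
    · rw [hmem] at hx hy
      simp only [hx, hy, dif_pos, Ordinal.typein_inj, Subtype.mk.injEq] at h
      exact h
    · rw [hmem] at hx
      simp only [hx, dif_pos]
      exact Ordinal.typein_lt_type _ _
    · obtain ⟨x, hx⟩ := Ordinal.typein_surj (strictPart R) hγ
      refine ⟨x, hR.refl x x.2, ?_⟩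
      simp only [x.2, dif_pos, hx]
  · rintro ⟨ρ, h⟩
    have hmem : ∀ x, x ∈ rng R ↔ R x x := fun x =>
      ⟨fun ⟨y, hy⟩ => ((h.rel_iff _ _).1 hy).2.1, fun hx => ⟨x, hx⟩⟩
    have hlt : ∀ x y : rng R, strictPart R x y ↔ ρ x < ρ y := by
      intro x y
      have hx := (hmem x).1 x.2
      have hy := (hmem y).1 y.2
      unfold strictPart
      rw [h.rel_iff]
      constructor
      · rintro ⟨⟨_, _, hle⟩, hne⟩
        exact lt_of_le_of_ne hle fun e => hne (Subtype.ext (h.inj _ _ hx hy e))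
      · intro hl
        exact ⟨⟨hx, hy, hl.le⟩, fun e => (e ▸ hl).ne rfl⟩
    let f : rng R → Set.Iio β := fun x => ⟨ρ x, h.lt x ((hmem x).1 x.2)⟩
    have hf : Function.Bijective f := by
      constructor
      · intro x y hxy
        exact Subtype.ext (h.inj _ _ ((hmem x).1 x.2) ((hmem y).1 y.2)
          (congrArg Subtype.val hxy))
      · rintro ⟨γ, hγ⟩
        obtain ⟨x, hx, rfl⟩ := h.surj γ hγ
        exact ⟨⟨x, (hmem x).2 hx⟩, rfl⟩
    let e : strictPart R ≃r ((· < ·) : β.ToType → β.ToType → Prop) :=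
      ⟨(Equiv.ofBijective f hf).trans Ordinal.ToType.mk.toEquiv, by
        intro x y
        rw [hlt]
        exact Ordinal.ToType.mk.lt_iff_lt⟩
    refine ⟨⟨fun x y hxy => (hmem x).2 ((h.rel_iff _ _).1 hxy).1, fun x hx => (hmem x).1 hx,
      fun x y z hxy hyz => ?_, fun x y hxy hyx => ?_, fun x hx y hy => ?_⟩,
      e.toRelEmbedding.isWellOrder, ?_⟩
    · rw [h.rel_iff] at hxy hyz ⊢
      exact ⟨hxy.1, hyz.2.1, hxy.2.2.trans hyz.2.2⟩
    · rw [h.rel_iff] at hxy hyx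
      exact h.inj _ _ hxy.1 hyx.1 (le_antisymm hxy.2.2 hyx.2.2)
    · rw [hmem] at hx hy
      rw [h.rel_iff x y, h.rel_iff y x]
      rcases le_total (ρ x) (ρ y) with hle | hle
      · exact Or.inl ⟨hx, hy, hle⟩
      · exact Or.inr ⟨hy, hx, hle⟩
    · have := e.toRelEmbedding.isWellOrder
      exact (Ordinal.type_eq.2 ⟨e⟩).trans (Ordinal.type_toType β)

theorem definableOrdinal_iff {N : Struc} {β : Ordinal.{0}} : DefinableOrdinal N β ↔
    ∃ R ρ, IsRankFun R β ρ ∧ Dfn N.family fun _ (q : ℕ × ℕ) => R q.1 q.2 := by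
  unfold DefinableOrdinal
  simp only [isRepresentation_iff, Struc.def_ext₂, exists_and_right]

/-- The lexicographic ordering of the pairs of an element of the field of `R` and a number. -/
def lexRel (R : ℕ → ℕ → Prop) (a b : ℕ) : Prop :=
  strictRel R a.unpair.1 b.unpair.1 ∨
    (a.unpair.1 = b.unpair.1 ∧ R a.unpair.1 a.unpair.1 ∧ a.unpair.2 < b.unpair.2)

namespace IsRankFun

variable {R : ℕ → ℕ → Prop} {β : Ordinal.{0}} {ρ : ℕ → Ordinal.{0}} (h : IsRankFun R β ρ)
include h

theorem strict_iff (x y : ℕ) : strictRel R x y ↔ R x x ∧ R y y ∧ ρ x < ρ y := by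
  unfold strictRel
  rw [h.rel_iff x y]
  constructor
  · rintro ⟨⟨hx, hy, hle⟩, hne⟩
    exact ⟨hx, hy, lt_of_le_of_ne hle fun e => hne (h.inj _ _ hx hy e)⟩
  · rintro ⟨hx, hy, hlt⟩
    exact ⟨⟨hx, hy, hlt.le⟩, fun e => (e ▸ hlt).ne rfl⟩

theorem lex_iff (a b : ℕ) : lexRel R a b ↔ R a.unpair.1 a.unpair.1 ∧ R b.unpair.1 b.unpair.1 ∧
    (ρ a.unpair.1 < ρ b.unpair.1 ∨ (ρ a.unpair.1 = ρ b.unpair.1 ∧ a.unpair.2 < b.unpair.2)) := by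
  unfold lexRel
  rw [h.strict_iff]
  constructor
  · rintro (⟨ha, hb, hl⟩ | ⟨e, ha, hl⟩)
    · exact ⟨ha, hb, Or.inl hl⟩
    · exact ⟨ha, e ▸ ha, Or.inr ⟨by rw [e], hl⟩⟩
  · rintro ⟨ha, hb, hl | ⟨e, hl⟩⟩
    · exact Or.inl ⟨ha, hb, hl⟩
    · exact Or.inr ⟨h.inj _ _ ha hb e, ha, hl⟩

theorem wf_strict : WellFounded (strictRel R) :=
  Subrelation.wf (fun hxy => ((h.strict_iff _ _).1 hxy).2.2)
    (InvImage.wf ρ Ordinal.lt_wf)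

theorem wf_lex : WellFounded (lexRel R) :=
  Subrelation.wf (r := InvImage (Prod.Lex (· < ·) (· < ·)) fun a : ℕ =>
      (ρ a.unpair.1, a.unpair.2))
    (fun hab => Prod.lex_def.2 ((h.lex_iff _ _).1 hab).2.2)
    (InvImage.wf _ (WellFounded.prod_lex Ordinal.lt_wf wellFounded_lt))

theorem strict_trans (x y z : ℕ) (hxy : strictRel R x y) (hyz : strictRel R y z) :
    strictRel R x z := by
  rw [h.strict_iff] at *
  exact ⟨hxy.1, hyz.2.1, hxy.2.2.trans hyz.2.2⟩

theorem lex_trans (x y z : ℕ) (hxy : lexRel R x y) (hyz : lexRel R y z) : lexRel R x z := by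
  rw [h.lex_iff] at *
  refine ⟨hxy.1, hyz.2.1, ?_⟩
  rcases hxy.2.2 with h1 | ⟨h1, h1'⟩ <;> rcases hyz.2.2 with h2 | ⟨h2, h2'⟩
  · exact Or.inl (h1.trans h2)
  · exact Or.inl (h2 ▸ h1)
  · exact Or.inl (h1 ▸ h2)
  · exact Or.inr ⟨h1.trans h2, h1'.trans h2'⟩

theorem dfn_initial {N : Struc} (hR : Dfn N.family fun _ (q : ℕ × ℕ) => R q.1 q.2)
    (γ : Ordinal.{0}) : Dfn N.family fun _ (x : ℕ) => R x x ∧ ρ x < γ := by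
  by_cases hγ : γ < β
  · obtain ⟨y, hy, rfl⟩ := h.surj γ hγ
    refine (N.closed.and (N.closed.comap (c := fun x : ℕ => (x, y)) hR (by fun_prop))
      (N.closed.not (N.closed.eq Primrec.id (Primrec.const y)))).of_iff fun _ x => ?_
    have := h.strict_iff x y
    unfold strictRel at this
    simp only [id, ← ne_eq, this, hy, true_and]
  · refine (N.closed.comap (c := fun x : ℕ => (x, x)) hR (by fun_prop)).of_iff fun _ x => ?_
    exact and_iff_left_of_imp fun hx => (h.lt x hx).trans_le (not_lt.1 hγ)

end IsRankFun

theorem dfn_lexRel {𝒳 : Type*} {𝓑 : Set (𝒳 → ℕ → Prop)} (h : ArithClosed 𝓑) {α : Type*}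
    [Primcodable α] {R : α → ℕ → ℕ → Prop}
    (hR : Dfn 𝓑 fun _ (c : α × ℕ × ℕ) => R c.1 c.2.1 c.2.2) :
    Dfn 𝓑 fun _ (c : α × ℕ × ℕ) => lexRel (R c.1) c.2.1 c.2.2 := by
  refine h.or (h.and ?_ (h.not (h.eq (β := ℕ) ?_ ?_)))
    (h.and (h.eq ?_ ?_) (h.and ?_ (h.lt ?_ ?_)))
  · exact h.comap (c := fun c : α × ℕ × ℕ => (c.1, c.2.1.unpair.1, c.2.2.unpair.1)) hR
      (by fun_prop)
  · fun_prop
  · fun_prop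
  · fun_prop
  · fun_prop
  · exact h.comap (c := fun c : α × ℕ × ℕ => (c.1, c.2.1.unpair.1, c.2.1.unpair.1)) hR
      (by fun_prop)
  · fun_prop
  · fun_prop

theorem dfn_strictRel {𝒳 : Type*} {𝓑 : Set (𝒳 → ℕ → Prop)} (h : ArithClosed 𝓑) {α : Type*}
    [Primcodable α] {R : α → ℕ → ℕ → Prop}
    (hR : Dfn 𝓑 fun _ (c : α × ℕ × ℕ) => R c.1 c.2.1 c.2.2) :
    Dfn 𝓑 fun _ (c : α × ℕ × ℕ) => strictRel (R c.1) c.2.1 c.2.2 :=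
  h.and hR (h.not (h.eq (by fun_prop) (by fun_prop)))

end Representations

/-! ### The jump hierarchy -/

section Jump

/-- The `e`-th section of the jump of `X` consists of all `m` such that, for some `x`, the value
`⟨b, y⟩` of the `e`-th partial recursive function at `⟨m, x⟩` satisfies `y ∈ X ↔ b = 0`. -/
def jump (X : ℕ → Prop) (z : ℕ) : Prop :=
  ∃ x, ∃ t, t ∈ Nat.Partrec.Code.eval (Denumerable.ofNat Nat.Partrec.Code z.unpair.1)
    (Nat.pair z.unpair.2 x) ∧ (X t.unpair.2 ↔ t.unpair.1 = 0)

/-- The set coding the graph of `g` and the relation `Y`. -/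
def stage (g : ℕ → ℕ) (Y : ℕ → ℕ → Prop) (t : ℕ) : Prop :=
  (t.unpair.1 = 0 ∧ g t.unpair.2.unpair.1 = t.unpair.2.unpair.2) ∨
    (t.unpair.1 = 1 ∧ Y t.unpair.2.unpair.1 t.unpair.2.unpair.2)

/-- The jump operator relative to `g`. -/
def jumpOp (g : ℕ → ℕ) (Y : ℕ → ℕ → Prop) (_ : ℕ) : ℕ → Prop := jump (stage g Y)

theorem isDefinableOp_jumpOp {N : Struc} {g : ℕ → ℕ} (hg : IsCoding N g) :
    IsDefinableOp N (jumpOp g) := by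
  intro 𝒳 𝓑 h hN α _ Y hY
  have hΓ := Dfn.of_structure h hN hg.dfn
  have hs : Dfn 𝓑 fun x (c : α × ℕ) => stage g (Y x c.1) c.2 := by
    refine h.or (h.and (h.eq (by fun_prop) (Primrec.const 0)) ?_)
      (h.and (h.eq (by fun_prop) (Primrec.const 1)) ?_)
    · exact h.comap (c := fun c : α × ℕ => (c.2.unpair.2.unpair.1, c.2.unpair.2.unpair.2)) hΓ
        (by fun_prop)
    · exact h.comap
        (c := fun c : α × ℕ => (c.1, c.2.unpair.2.unpair.1, c.2.unpair.2.unpair.2)) hY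
        (by fun_prop)
  refine h.ex (h.ex (h.and (h.eval ?_ ?_ ?_) (h.iff ?_ (h.eq ?_ (Primrec.const 0)))))
  · fun_prop
  · fun_prop
  · fun_prop
  · exact h.comap (c := fun c : ((α × ℕ × ℕ) × ℕ) × ℕ => (c.1.1.1, c.2.unpair.2)) hs
      (by fun_prop)
  · fun_prop

theorem one_add_pos (δ : Ordinal.{0}) : 0 < 1 + δ := zero_lt_one.trans_le le_self_add

theorem exists_index {c : ℕ → ℕ} (hc : Primrec c) : ∃ e : ℕ, ∀ m,
    Nat.Partrec.Code.eval (Denumerable.ofNat Nat.Partrec.Code e) m = Part.some (c m) := by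
  obtain ⟨e, he⟩ := Nat.Partrec.Code.exists_code.1 (Nat.Partrec.of_primrec (Primrec.nat_iff.1 hc))
  exact ⟨encode e, fun m => by rw [Denumerable.ofNat_encode, he]; rfl⟩

/-- The relations that are many-one reducible to columns of the jump hierarchy `H` along `R`, for
levels of rank below `1 + δ`. The summand `1` provides the family for `δ = 0` with the levels of
rank `0`, which are the finite jumps of `g`. -/
def levelFamily (R : ℕ → ℕ → Prop) (ρ : ℕ → Ordinal.{0}) (H : ℕ → ℕ → Prop) (δ : Ordinal.{0}) :
    Set (Unit → ℕ → Prop) :=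
  {p | ∃ w, ∃ c : ℕ → ℕ, R w.unpair.1 w.unpair.1 ∧ ρ w.unpair.1 < 1 + δ ∧ Primrec c ∧
    ∀ m, p () m ↔ H w (c m)}

variable {R : ℕ → ℕ → Prop} {β : Ordinal.{0}} {ρ : ℕ → Ordinal.{0}} (h : IsRankFun R β ρ)
  {g : ℕ → ℕ} {δ : Ordinal.{0}}
include h

/-- A set that is `Σ₁` in the part of the hierarchy below `w`, of the simple form allowed by `jump`,
is reducible to the column `w`. -/
theorem mem_levelFamily_of_stage {w : ℕ} (hw : R w.unpair.1 w.unpair.1)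
    (hwδ : ρ w.unpair.1 < 1 + δ) {c : ℕ → ℕ} (hc : Primrec c) {p : Unit → ℕ → Prop}
    (hp : ∀ m, p () m ↔ ∃ x, (stage g (trunc (lexRel R) (hier h.wf_lex (jumpOp g)) w)
      (c (Nat.pair m x)).unpair.2 ↔ (c (Nat.pair m x)).unpair.1 = 0)) :
    p ∈ levelFamily R ρ (hier h.wf_lex (jumpOp g)) δ := by
  obtain ⟨e, he⟩ := exists_index hc
  refine ⟨w, fun m => Nat.pair e m, hw, hwδ, by fun_prop, fun m => ?_⟩
  rw [hp, hier_iff, jumpOp, jump]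
  simp [he]

theorem mem_levelFamily_of_trunc {w : ℕ} (hw : R w.unpair.1 w.unpair.1)
    (hwδ : ρ w.unpair.1 < 1 + δ) :
    Dfn (levelFamily R ρ (hier h.wf_lex (jumpOp g)) δ) fun _ (m : ℕ) =>
      trunc (lexRel R) (hier h.wf_lex (jumpOp g)) w m.unpair.1 m.unpair.2 := by
  refine dfn_nat.2 (mem_levelFamily_of_stage h hw hwδ
    (c := fun m => Nat.pair 0 (Nat.pair 1 m.unpair.1)) (by fun_prop) fun m => ?_)
  simp [stage]

theorem not_mem_levelFamily {p : Unit → ℕ → Prop}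
    (hp : p ∈ levelFamily R ρ (hier h.wf_lex (jumpOp g)) δ) :
    (fun x m => ¬ p x m) ∈ levelFamily R ρ (hier h.wf_lex (jumpOp g)) δ := by
  obtain ⟨w, c, hw, hwδ, hc, hp⟩ := hp
  refine mem_levelFamily_of_stage h (w := Nat.pair w.unpair.1 (w.unpair.2 + 1))
    (by simpa using hw) (by simpa using hwδ)
    (c := fun m => Nat.pair 1 (Nat.pair 1 (Nat.pair w (c m.unpair.1)))) (by fun_prop) fun m => ?_
  have : lexRel R w (Nat.pair w.unpair.1 (w.unpair.2 + 1)) :=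
    (h.lex_iff _ _).2 ⟨hw, by simpa using hw, Or.inr (by simp)⟩
  simp [stage, hp, trunc, this]

theorem exists_lex_above {v w : ℕ} (hv : R v.unpair.1 v.unpair.1) (hvδ : ρ v.unpair.1 < δ)
    (hw : R w.unpair.1 w.unpair.1) (hwδ : ρ w.unpair.1 < δ) :
    ∃ u, R u.unpair.1 u.unpair.1 ∧ ρ u.unpair.1 < δ ∧ lexRel R v u ∧ lexRel R w u := by
  wlog hle : ρ v.unpair.1 ≤ ρ w.unpair.1
  · obtain ⟨u, h1, h2, h3, h4⟩ := this h hw hwδ hv hvδ (not_le.1 hle).le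
    exact ⟨u, h1, h2, h4, h3⟩
  refine ⟨Nat.pair w.unpair.1 (v.unpair.2 + w.unpair.2 + 1), by simpa, by simpa,
    (h.lex_iff _ _).2 ⟨hv, by simpa, ?_⟩, (h.lex_iff _ _).2 ⟨hw, by simpa, Or.inr ?_⟩⟩
  · rcases hle.lt_or_eq with hl | he
    · exact Or.inl (by simpa)
    · refine Or.inr ?_
      simp only [Nat.unpair_pair]
      exact ⟨he, by omega⟩
  · simp only [Nat.unpair_pair]
    exact ⟨trivial, by omega⟩

theorem levelFamily_closed (hδ : 1 + δ ≤ β) :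
    ArithClosed (levelFamily R ρ (hier h.wf_lex (jumpOp g)) δ) where
  not_mem := not_mem_levelFamily h
  and_mem := by
    rintro p q ⟨v, c, hv, hvδ, hc, hp⟩ ⟨w, d, hw, hwδ, hd, hq⟩
    obtain ⟨u, hu, huδ, hvu, hwu⟩ := exists_lex_above h hv hvδ hw hwδ
    have h1 : (fun (x : Unit) m => ¬ (p x m ∧ q x m)) ∈
        levelFamily R ρ (hier h.wf_lex (jumpOp g)) δ := by
      refine mem_levelFamily_of_stage h hu huδ
        (c := fun m => Nat.pair 1 (Nat.pair 1 (if m.unpair.2 = 0 then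
          Nat.pair v (c m.unpair.1) else Nat.pair w (d m.unpair.1)))) ?_ fun m => ?_
      · have := primrec_ite (p := fun m : ℕ => m.unpair.2 = 0)
          (f := fun m => Nat.pair v (c m.unpair.1)) (g := fun m => Nat.pair w (d m.unpair.1))
          (primrecPred_eq (by fun_prop) (Primrec.const 0)) (by fun_prop) (by fun_prop)
        fun_prop
      · rw [hp, hq, not_and_or]
        constructor
        · rintro (hm | hm)
          · exact ⟨0, by simp [stage, trunc, hvu, hm]⟩
          · exact ⟨1, by simp [stage, trunc, hwu, hm]⟩
        · rintro ⟨x, hx⟩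
          by_cases hx0 : x = 0
          · left; simpa [stage, trunc, hvu, hx0] using hx
          · right; simpa [stage, trunc, hwu, hx0] using hx
    refine cast (congrArg (· ∈ _) ?_) (not_mem_levelFamily h h1)
    ext x m
    simp
  ex_mem := by
    rintro p ⟨w, c, hw, hwδ, hc, hp⟩
    refine mem_levelFamily_of_stage h (w := Nat.pair w.unpair.1 (w.unpair.2 + 1))
      (by simpa using hw) (by simpa using hwδ)
      (c := fun m => Nat.pair 0 (Nat.pair 1 (Nat.pair w (c m)))) (by fun_prop) fun m => ?_
    have : lexRel R w (Nat.pair w.unpair.1 (w.unpair.2 + 1)) :=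
      (h.lex_iff _ _).2 ⟨hw, by simpa using hw, Or.inr (by simp)⟩
    simp [stage, hp, trunc, this]
  comap_mem := by
    rintro p d ⟨w, c, hw, hwδ, hc, hp⟩ hd
    exact ⟨w, fun m => c (d m), hw, hwδ, hc.comp hd, fun m => hp _⟩
  eq_mem := by
    obtain ⟨x, hx, hρ⟩ := h.surj 0 ((one_add_pos δ).trans_le hδ)
    -- the number `⟨2, 0⟩` is not in the stage
    refine mem_levelFamily_of_stage h (w := Nat.pair x 0) (by simpa)
      (by rw [Nat.unpair_pair, hρ]; exact one_add_pos δ)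
      (c := fun m => Nat.pair (if m.unpair.1.unpair.1 = m.unpair.1.unpair.2 then 1 else 0)
        (Nat.pair 2 0)) ?_ fun m => ?_
    · have := primrec_ite (p := fun m : ℕ => m.unpair.1.unpair.1 = m.unpair.1.unpair.2)
        (f := fun m => 1) (g := fun m => 0)
        (primrecPred_eq (by fun_prop) (by fun_prop)) (by fun_prop) (by fun_prop)
      fun_prop
    · simp [stage]

theorem dfn_levelFamily_graph (hδ : 1 + δ ≤ β) :
    Dfn (levelFamily R ρ (hier h.wf_lex (jumpOp g)) δ) fun _ (q : ℕ × ℕ) => g q.1 = q.2 := by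
  obtain ⟨x, hx, hρ⟩ := h.surj 0 ((one_add_pos δ).trans_le hδ)
  have h1 : (fun (_ : Unit) m => g m.unpair.1 = m.unpair.2) ∈
      levelFamily R ρ (hier h.wf_lex (jumpOp g)) δ := by
    refine mem_levelFamily_of_stage h (w := Nat.pair x 0) (by simpa)
      (by rw [Nat.unpair_pair, hρ]; exact one_add_pos δ)
      (c := fun m => Nat.pair 0 (Nat.pair 0 m.unpair.1)) (by fun_prop) fun m => ?_
    simp [stage]
  refine ((levelFamily_closed h hδ).comap (c := fun q : ℕ × ℕ => Nat.pair q.1 q.2)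
    (dfn_nat.2 h1) (by fun_prop)).of_iff fun _ q => by simp

omit h in
theorem levelFamily_mono {H : ℕ → ℕ → Prop} {γ : Ordinal.{0}} (hγ : γ ≤ δ) :
    levelFamily R ρ H γ ⊆ levelFamily R ρ H δ := by
  rintro p ⟨w, c, hw, hwδ, hc, hp⟩
  exact ⟨w, c, hw, hwδ.trans_le (add_le_add_right hγ 1), hc, hp⟩

/-- The levels of the jump hierarchy below rank `ε` determine those of rank `ε` arithmetically. -/
theorem dfn_level_of_below {N : Struc} (hg : IsCoding N g)
    (hR : Dfn N.family fun _ (q : ℕ × ℕ) => R q.1 q.2) {𝓑 : Set (Unit → ℕ → Prop)}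
    (hB : ArithClosed 𝓑) (hN : N.family ⊆ 𝓑) {ε : Ordinal.{0}}
    (hε : Dfn 𝓑 fun _ (q : ℕ × ℕ) => (R q.1.unpair.1 q.1.unpair.1 ∧ ρ q.1.unpair.1 < ε) ∧
      hier h.wf_lex (jumpOp g) q.1 q.2) {r : ℕ} (hr : R r r) (hrε : ρ r = ε) (n : ℕ) :
    Dfn 𝓑 fun _ (z : ℕ) => hier h.wf_lex (jumpOp g) (Nat.pair r n) z := by
  have hsym : ∀ s ∈ N.carrier, SymDfn 𝓑 s := fun s hs => (Struc.symDfn hs).mono hN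
  have hlex : Dfn 𝓑 fun _ (q : ℕ × ℕ) => lexRel R q.1 q.2 :=
    hB.comap (c := fun q : ℕ × ℕ => (0, q.1, q.2)) (dfn_lexRel hB (R := fun _ : ℕ => R)
      (hB.comap (c := fun q : ℕ × ℕ × ℕ => (q.2.1, q.2.2)) (hR.mono hN) (by fun_prop)))
      (by fun_prop)
  have step : ∀ n, (Dfn 𝓑 fun _ (q : ℕ × ℕ) =>
      trunc (lexRel R) (hier h.wf_lex (jumpOp g)) (Nat.pair r n) q.1 q.2) →
      Dfn 𝓑 fun _ (z : ℕ) => hier h.wf_lex (jumpOp g) (Nat.pair r n) z := by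
    intro n hn
    have h1 := isDefinableOp_jumpOp hg hB hsym (α := ℕ) (Y := fun _ _ v y =>
      trunc (lexRel R) (hier h.wf_lex (jumpOp g)) (Nat.pair r n) v y)
      (hB.comap (c := fun q : ℕ × ℕ × ℕ => (q.2.1, q.2.2)) hn (by fun_prop))
    exact (hB.comap (c := fun z : ℕ => (0, Nat.pair r n, z)) h1 (by fun_prop)).of_iff
      fun _ z => hier_iff _ _ _
  have htrunc : ∀ n, Dfn 𝓑 fun _ (q : ℕ × ℕ) =>
      trunc (lexRel R) (hier h.wf_lex (jumpOp g)) (Nat.pair r n) q.1 q.2 := by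
    intro n
    induction n with
    | zero =>
      refine hε.of_iff fun _ q => and_congr_left fun _ => ?_
      rw [h.lex_iff]
      simp [hr, hrε]
    | succ n ih =>
      refine (hB.or ih (hB.and (hB.eq (f := Prod.fst) Primrec.fst (Primrec.const (Nat.pair r n)))
        (hB.comap (step n ih) Primrec.snd))).of_iff fun _ q => ?_
      unfold trunc
      rw [h.lex_iff, h.lex_iff]
      simp only [Nat.unpair_pair, hr, hrε, true_and]
      constructor
      · rintro ⟨⟨h1, h2 | ⟨h2, h3⟩⟩, h4⟩
        · exact Or.inl ⟨⟨h1, Or.inl h2⟩, h4⟩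
        · rcases Nat.lt_succ_iff_lt_or_eq.1 h3 with h3 | h3
          · exact Or.inl ⟨⟨h1, Or.inr ⟨h2, h3⟩⟩, h4⟩
          · have : q.1 = Nat.pair r n := by
              rw [← h.inj _ _ h1 hr (h2.trans hrε.symm), ← h3, Nat.pair_unpair]
            exact Or.inr ⟨this, this ▸ h4⟩
      · rintro (⟨⟨h1, h2 | ⟨h2, h3⟩⟩, h4⟩ | ⟨h1, h2⟩)
        · exact ⟨⟨h1, Or.inl h2⟩, h4⟩
        · exact ⟨⟨h1, Or.inr ⟨h2, h3.trans n.lt_succ_self⟩⟩, h4⟩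
        · rw [h1]
          simp [hr, hrε, h2]
  exact step n (htrunc n)

end Jump

/-! ### Tarski sequences and the jump hierarchy -/

section Sequence

@[elab_as_elim]
theorem succ_limit_induction {P : Ordinal.{0} → Prop} (δ : Ordinal.{0}) (zero : P 0)
    (succ : ∀ γ, P γ → P (Order.succ γ))
    (limit : ∀ γ, Order.IsSuccLimit γ → (∀ ε < γ, P ε) → P γ) : P δ := by
  induction δ using Ordinal.limitRecOn with
  | zero => exact zero
  | add_one γ ih =>
    rw [← Order.succ_eq_add_one]
    exact succ γ ih
  | limit γ hγ ih => exact limit γ hγ ih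

theorem one_add_succ (γ : Ordinal.{0}) : 1 + Order.succ γ = Order.succ (1 + γ) := by
  simp only [Order.succ_eq_add_one, add_assoc]

theorem IsTarskiSequence.carrier_mono {N : Struc} {mu : Ordinal.{0}} {M : Ordinal.{0} → Struc}
    (hM : IsTarskiSequence N mu M) {α δ : Ordinal.{0}} (hα : α ≤ δ) (hδ : δ ≤ mu) :
    (M α).carrier ⊆ (M δ).carrier := by
  induction δ using succ_limit_induction with
  | zero => rw [nonpos_iff_eq_zero.1 hα]
  | succ γ ih =>
    rcases hα.lt_or_eq with h | h
    · have hγ := Order.succ_le_iff.1 hδ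
      obtain ⟨P, -, hP⟩ := hM.succ γ hγ
      rw [hP]
      exact (ih (Order.lt_succ_iff.1 h) hγ.le).trans Set.subset_union_left
    · rw [h]
  | limit γ hγ _ =>
    rcases hα.lt_or_eq with h | h
    · rw [hM.limit γ hδ hγ]
      exact Set.subset_biUnion_of_mem (u := fun α => (M α).carrier) h
    · rw [h]

theorem IsTarskiSequence.family_mono {N : Struc} {mu : Ordinal.{0}} {M : Ordinal.{0} → Struc}
    (hM : IsTarskiSequence N mu M) {α δ : Ordinal.{0}} (hα : α ≤ δ) (hδ : δ ≤ mu) :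
    (M α).family ⊆ (M δ).family :=
  Struc.family_mono (hM.carrier_mono hα hδ)

theorem IsTarskiSequence.family_base {N : Struc} {mu : Ordinal.{0}} {M : Ordinal.{0} → Struc}
    (hM : IsTarskiSequence N mu M) {δ : Ordinal.{0}} (hδ : δ ≤ mu) :
    N.family ⊆ (M δ).family := by
  have := hM.family_mono zero_le hδ
  rwa [hM.zero] at this

theorem IsTarskiSequence.mono {N : Struc} {mu nu : Ordinal.{0}} {M : Ordinal.{0} → Struc}
    (hM : IsTarskiSequence N mu M) (h : nu ≤ mu) : IsTarskiSequence N nu M :=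
  ⟨hM.zero, fun α hα => hM.succ α (hα.trans_le h), fun β hβ => hM.limit β (hβ.trans h)⟩

/-- At limits, the definable relations are those definable at some earlier place. -/
theorem IsTarskiSequence.exists_of_limit {N : Struc} {mu : Ordinal.{0}}
    {M : Ordinal.{0} → Struc} (hM : IsTarskiSequence N mu M) {δ : Ordinal.{0}} (hδ : δ ≤ mu)
    (hl : Order.IsSuccLimit δ) {p : Unit → ℕ → Prop} (hp : p ∈ (M δ).family) :
    ∃ γ < δ, p ∈ (M γ).family := by
  have h0 : 0 < δ := pos_iff_ne_zero.2 fun h => hl.not_isMin (h ▸ isMin_bot)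
  have hcl : ArithClosed {p | ∃ γ < δ, p ∈ (M γ).family} :=
    { not_mem := fun ⟨γ, hγ, hp⟩ => ⟨γ, hγ, (M γ).closed.not_mem hp⟩
      and_mem := fun ⟨γ, hγ, hp⟩ ⟨ε, hε, hq⟩ => by
        have hmax := max_lt hγ hε
        exact ⟨max γ ε, hmax, (M _).closed.and_mem
          (hM.family_mono (le_max_left _ _) (hmax.le.trans hδ) hp)
          (hM.family_mono (le_max_right _ _) (hmax.le.trans hδ) hq)⟩
      ex_mem := fun ⟨γ, hγ, hp⟩ => ⟨γ, hγ, (M γ).closed.ex_mem hp⟩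
      comap_mem := fun ⟨γ, hγ, hp⟩ hc => ⟨γ, hγ, (M γ).closed.comap_mem hp hc⟩
      eq_mem := ⟨0, h0, (M 0).closed.eq_mem⟩ }
  refine Struc.family_subset hcl (fun s hs => ?_) hp
  rw [hM.limit δ hδ hl] at hs
  simp only [Set.mem_iUnion] at hs
  obtain ⟨γ, hγ, hs⟩ := hs
  have : (M γ).family ⊆ {p | ∃ γ < δ, p ∈ (M γ).family} := fun p hp => ⟨γ, hγ, hp⟩
  exact (Struc.symDfn hs).mono this

variable {N : Struc} {g : ℕ → ℕ} {R : ℕ → ℕ → Prop} {β : Ordinal.{0}}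
  {ρ : ℕ → Ordinal.{0}}

/-- The predicate `∃ y ∈ {e}(m), K y`, whose sections are the sets reducible to `K` by partial
recursive functions. -/
def reducts (K : ℕ → Prop) (e m : ℕ) : Prop :=
  ∃ y, y ∈ Nat.Partrec.Code.eval (Denumerable.ofNat Nat.Partrec.Code e) m ∧ K y

theorem dfn_reducts {𝒳 : Type*} {𝓑 : Set (𝒳 → ℕ → Prop)} (h : ArithClosed 𝓑) {K : 𝒳 → ℕ → Prop}
    (hK : Dfn 𝓑 K) : Dfn 𝓑 fun x (q : ℕ × ℕ) => reducts (K x) q.1 q.2 :=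
  h.ex (h.and (h.eval (by fun_prop) (by fun_prop) (by fun_prop)) (h.comap hK Primrec.snd))

/-- The part of the jump hierarchy `H` of rank below `ε`, as a set of codes of pairs. -/
def below (R : ℕ → ℕ → Prop) (ρ : ℕ → Ordinal.{0}) (H : ℕ → ℕ → Prop) (ε : Ordinal.{0})
    (m : ℕ) : Prop :=
  (R m.unpair.1.unpair.1 m.unpair.1.unpair.1 ∧ ρ m.unpair.1.unpair.1 < ε) ∧
    H m.unpair.1 m.unpair.2

theorem isUniversal_reducts_below {M : Struc} {H : ℕ → ℕ → Prop} {δ : Ordinal.{0}}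
    (hM : M.family = levelFamily R ρ H δ) : IsUniversal M (reducts (below R ρ H (1 + δ))) := by
  refine isUniversal_iff.2 fun p hp => ?_
  rw [hM] at hp
  obtain ⟨w, c, hw, hwδ, hc, hp⟩ := hp
  obtain ⟨e, he⟩ := exists_index (c := fun m => Nat.pair w (c m)) (by fun_prop)
  refine ⟨e, fun m => ?_⟩
  rw [hp]
  simp [reducts, he, below, hw, hwδ]

variable (h : IsRankFun R β ρ) (hg : IsCoding N g)
  (hR : Dfn N.family fun _ (q : ℕ × ℕ) => R q.1 q.2)
include hg hR

/-- The part of the hierarchy corresponding to a structure is definable from every universal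
predicate of that structure. -/
theorem dfn_below_of_isUniversal {M : Struc} {δ : Ordinal.{0}}
    (hM : M.family = levelFamily R ρ (hier h.wf_lex (jumpOp g)) δ) {𝒳 : Type}
    {𝓑 : Set (𝒳 → ℕ → Prop)} (hB : ArithClosed 𝓑) (hN : ∀ s ∈ N.carrier, SymDfn 𝓑 s)
    {G : ℕ → ℕ → Prop} (hG : IsUniversal M G) (hGB : Dfn 𝓑 fun _ (q : ℕ × ℕ) => G q.1 q.2) :
    Dfn 𝓑 fun _ => below R ρ (hier h.wf_lex (jumpOp g)) (1 + δ) := by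
  have hlex : Dfn N.family fun _ (q : ℕ × ℕ) => lexRel R q.1 q.2 :=
    N.closed.comap (c := fun q : ℕ × ℕ => (0, q.1, q.2)) (dfn_lexRel N.closed
      (R := fun _ : ℕ => R) (N.closed.comap (c := fun q : ℕ × ℕ × ℕ => (q.2.1, q.2.2)) hR
      (by fun_prop))) (by fun_prop)
  have hD := N.closed.comap (c := fun w : ℕ => w.unpair.1) (h.dfn_initial hR (1 + δ))
    (by fun_prop)
  refine hB.comap (c := fun m : ℕ => (m.unpair.1, m.unpair.2))
    (dfn_hier_of_columns (isDefinableOp_jumpOp hg) h.wf_lex h.lex_trans hB hN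
      (Dfn.of_structure hB hN hlex)
      (D := fun w => R w.unpair.1 w.unpair.1 ∧ ρ w.unpair.1 < 1 + δ)
      (Dfn.of_structure hB hN hD) hGB fun w hw => ?_) (by fun_prop)
  have h1 := dfn_nat.1 (mem_levelFamily_of_trunc h (g := g) hw.1 hw.2)
  rw [← hM] at h1
  obtain ⟨k, hk⟩ := isUniversal_iff.1 hG _ h1
  refine ⟨k, fun v hv y => ?_⟩
  rw [← hk]
  simp [trunc, hv]

/-- The reducts of the corresponding part of the hierarchy form a canonic universal predicate. -/
theorem isCanonicUniversal_reducts_below {M : Struc} (hNM : N.family ⊆ M.family)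
    {δ : Ordinal.{0}} (hM : M.family = levelFamily R ρ (hier h.wf_lex (jumpOp g)) δ) :
    IsCanonicUniversal M (reducts (below R ρ (hier h.wf_lex (jumpOp g)) (1 + δ))) := by
  refine ⟨isUniversal_reducts_below hM, fun G hG => Struc.def_ext₂.2 ?_⟩
  have hGd : Dfn (M.add {Symbol.pred 2 (ext₂ G)}).family fun _ (q : ℕ × ℕ) => G q.1 q.2 :=
    (symDfn_ext₂ (Struc.closed _)).1 (Struc.symDfn_add rfl)
  exact dfn_reducts (Struc.closed _) (dfn_below_of_isUniversal h hg hR hM (Struc.closed _)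
    (fun s hs => (Struc.symDfn hs).mono (hNM.trans Struc.family_subset_add)) hG hGd)

/-- The structure `M δ` of a Tarski sequence defines the sets that are reducible to a level of
rank below `1 + δ` of the jump hierarchy along `R`. -/
theorem IsTarskiSequence.family_eq_levelFamily {mu : Ordinal.{0}} {M : Ordinal.{0} → Struc}
    (hM : IsTarskiSequence N mu M) (δ : Ordinal.{0}) (hδ : δ ≤ mu) (hδβ : 1 + δ ≤ β) :
    (M δ).family = levelFamily R ρ (hier h.wf_lex (jumpOp g)) δ := by
  have hcl := levelFamily_closed h (g := g) hδβ
  induction δ using succ_limit_induction with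
  | zero =>
    apply subset_antisymm
    · rw [hM.zero]
      exact Struc.family_subset hcl fun s hs =>
        hg.symDfn hcl (dfn_levelFamily_graph h hδβ) hs
    · rintro p ⟨w, c, hw, hwδ, hc, hp⟩
      have hρ : ρ w.unpair.1 = 0 := by simpa using hwδ
      have h0 : Dfn (M 0).family fun _ (q : ℕ × ℕ) =>
          (R q.1.unpair.1 q.1.unpair.1 ∧ ρ q.1.unpair.1 < 0) ∧
          hier h.wf_lex (jumpOp g) q.1 q.2 :=
        ((M 0).closed.const False).of_iff fun _ _ => by simp
      have h1 := dfn_level_of_below h hg hR (M 0).closed (hM.family_base hδ) h0 hw hρ w.unpair.2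
      rw [Nat.pair_unpair] at h1
      exact dfn_nat.1 (((M 0).closed.comap h1 hc).of_iff fun _ m => hp m)
  | succ γ ih =>
    have hγ := Order.succ_le_iff.1 hδ
    have hγβ : 1 + γ ≤ β := (add_le_add_right (Order.le_succ γ) 1).trans hδβ
    have ih := ih hγ.le hγβ (levelFamily_closed h hγβ)
    obtain ⟨P, hP, hMP⟩ := hM.succ γ hγ
    have hsub : (M γ).family ⊆ levelFamily R ρ (hier h.wf_lex (jumpOp g)) (Order.succ γ) :=
      ih.subset.trans (levelFamily_mono (Order.le_succ γ))
    apply subset_antisymm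
    · rw [hMP]
      refine Struc.family_add_subset hcl hsub fun s hs => ?_
      rw [Set.mem_singleton_iff.1 hs, symDfn_ext₂ hcl]
      refine Dfn.mono (Struc.family_add_subset hcl hsub fun s hs => ?_) (Struc.def_ext₂.1
        (hP.2 _ (isUniversal_reducts_below ih)))
      rw [Set.mem_singleton_iff.1 hs, symDfn_ext₂ hcl]
      refine dfn_reducts hcl ?_
      have hlt : 1 + γ < 1 + Order.succ γ := by
        rw [one_add_succ]
        exact Order.lt_succ _
      obtain ⟨r, hr, hrγ⟩ := h.surj _ (hlt.trans_le hδβ)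
      refine (mem_levelFamily_of_trunc h (w := Nat.pair r 0) (by simpa) (by simp [hrγ])).of_iff
        fun _ m => and_congr_left fun _ => ?_
      rw [h.lex_iff]
      simp [hr, hrγ]
    · rintro p ⟨w, c, hw, hwδ, hc, hp⟩
      have hbase := hM.family_base hδ
      have hPd : Dfn (M (Order.succ γ)).family fun _ (q : ℕ × ℕ) => P q.1 q.2 := by
        rw [hMP]
        exact (symDfn_ext₂ (Struc.closed _)).1 (Struc.symDfn_add rfl)
      have hb := dfn_below_of_isUniversal h hg hR ih (Struc.closed _)
        (fun s hs => (Struc.symDfn hs).mono hbase) hP.1 hPd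
      rw [one_add_succ, Order.lt_succ_iff] at hwδ
      have h1 : Dfn (M (Order.succ γ)).family fun _ (z : ℕ) =>
          hier h.wf_lex (jumpOp g) w z := by
        rcases hwδ.lt_or_eq with hl | he
        · refine ((Struc.closed _).comap (c := fun z : ℕ => Nat.pair w z) hb
            (by fun_prop)).of_iff fun _ z => ?_
          simp [below, hw, hl]
        · have h0 := (Struc.closed _).comap (c := fun q : ℕ × ℕ => Nat.pair q.1 q.2) hb
            (by fun_prop)
          have := dfn_level_of_below h hg hR (Struc.closed _) hbase
            (h0.of_iff fun _ q => by simp [below]) hw he w.unpair.2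
          rwa [Nat.pair_unpair] at this
      exact dfn_nat.1 (((Struc.closed _).comap h1 hc).of_iff fun _ m => hp m)
  | limit δ hl ih =>
    have hsub : ∀ γ < δ, (M γ).family = levelFamily R ρ (hier h.wf_lex (jumpOp g)) γ :=
      fun γ hγ => ih γ hγ (hγ.le.trans hδ) ((add_le_add_right hγ.le 1).trans hδβ)
        (levelFamily_closed h ((add_le_add_right hγ.le 1).trans hδβ))
    apply subset_antisymm
    · intro p hp
      obtain ⟨γ, hγ, hp⟩ := hM.exists_of_limit hδ hl hp
      rw [hsub γ hγ] at hp
      exact levelFamily_mono hγ.le hp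
    · rintro p ⟨w, c, hw, hwδ, hc, hp⟩
      obtain ⟨γ, hγ, hwγ⟩ := ((Ordinal.isNormal_add_right 1).lt_iff_exists_lt hl).1 hwδ
      refine hM.family_mono hγ.le hδ ?_
      rw [hsub γ hγ]
      exact ⟨w, c, hw, hwγ, hc, hp⟩

end Sequence

/-! ### A normal form for existential second-order definitions -/

section NormalForm

/-- The list of the first `k` values of `f`. -/
def pre (f : ℕ → ℕ) (k : ℕ) : List ℕ := (List.range k).map f

@[simp]
theorem length_pre (f : ℕ → ℕ) (k : ℕ) : (pre f k).length = k := by simp [pre]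

theorem take_pre (f : ℕ → ℕ) {j k : ℕ} (h : j ≤ k) : (pre f k).take j = pre f j := by
  simp [pre, ← List.map_take, List.take_range, h]

theorem getD_pre (f : ℕ → ℕ) {i k : ℕ} (h : i < k) (d : ℕ) : (pre f k).getD i d = f i := by
  simp [pre, h]

theorem drop_one_pre (f : ℕ → ℕ) (k : ℕ) : (pre f (k + 1)).drop 1 = pre (fun i => f (i + 1)) k := by
  simp [pre, List.range_succ_eq_map, Function.comp_def]

theorem map_pre (φ f : ℕ → ℕ) (k : ℕ) : (pre f k).map φ = pre (fun i => φ (f i)) k := by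
  simp [pre, Function.comp_def]

variable {𝒳 : Type*} {u : 𝒳 → ℕ → ℕ} {Q Q' : 𝒳 → ℕ → Prop}

/-- The relation `Q x m` has the form `∃ f, ∀ k, K (m, f ↾ k, u x ↾ k)` for a primitive recursive
`K`; in other words, it says that a tree recursive in `u x` has an infinite path. -/
def IsSig (u : 𝒳 → ℕ → ℕ) (Q : 𝒳 → ℕ → Prop) : Prop :=
  ∃ K : ℕ × List ℕ × List ℕ → Prop, PrimrecPred K ∧
    ∀ x m, Q x m ↔ ∃ f : ℕ → ℕ, ∀ k, K (m, pre f k, pre (u x) k)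

theorem IsSig.of_iff (hQ : IsSig u Q) (h : ∀ x m, Q' x m ↔ Q x m) : IsSig u Q' := by
  have : Q' = Q := by ext; apply h
  rwa [this]

theorem isSig_basic {p : ℕ × List ℕ → Prop} (hp : PrimrecPred p) {c : ℕ → ℕ} (hc : Primrec c) :
    IsSig u fun x m => p (m, pre (u x) (c m)) := by
  refine ⟨fun q => ¬ c q.1 ≤ q.2.2.length ∨ p (q.1, q.2.2.take (c q.1)), ?_, fun x m => ?_⟩
  · refine PrimrecPred.or (PrimrecPred.not (primrecPred_le (by fun_prop) (by fun_prop)))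
      (hp.comp (by fun_prop))
  · constructor
    · intro h
      refine ⟨fun _ => 0, fun k => ?_⟩
      by_cases hk : c m ≤ k
      · right
        rwa [take_pre _ hk]
      · left
        simpa using hk
    · rintro ⟨f, h⟩
      simpa [take_pre] using h (c m)

theorem IsSig.comap (hQ : IsSig u Q) {c : ℕ → ℕ} (hc : Primrec c) :
    IsSig u fun x m => Q x (c m) := by
  obtain ⟨K, hK, h⟩ := hQ
  exact ⟨fun q => K (c q.1, q.2.1, q.2.2), hK.comp (by fun_prop), fun x m => h x (c m)⟩

theorem IsSig.ex (hQ : IsSig u Q) : IsSig u fun x m => ∃ y, Q x (Nat.pair m y) := by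
  obtain ⟨K, hK, h⟩ := hQ
  -- the witness is the first value of the path
  refine ⟨fun q => q.2.1.length = 0 ∨ K (Nat.pair q.1 (q.2.1.getD 0 0), q.2.1.drop 1,
    q.2.2.take (q.2.1.length - 1)), ?_, fun x m => ?_⟩
  · exact PrimrecPred.or (primrecPred_eq (by fun_prop) (Primrec.const 0)) (hK.comp (by fun_prop))
  · constructor
    · rintro ⟨y, hy⟩
      obtain ⟨f, hf⟩ := (h _ _).1 hy
      refine ⟨fun i => Nat.casesOn i y f, fun k => ?_⟩
      cases k with
      | zero => left; simp
      | succ k =>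
        right
        rw [getD_pre _ (Nat.succ_pos k), drop_one_pre, length_pre, Nat.add_sub_cancel,
          take_pre _ (Nat.le_succ k)]
        exact hf k
    · rintro ⟨f, hf⟩
      refine ⟨f 0, (h _ _).2 ⟨fun i => f (i + 1), fun k => ?_⟩⟩
      have := hf (k + 1)
      beta_reduce at this
      rw [getD_pre _ (Nat.succ_pos k), drop_one_pre, length_pre, Nat.add_sub_cancel,
        take_pre _ (Nat.le_succ k)] at this
      exact this.resolve_left (Nat.succ_ne_zero k)

theorem IsSig.all (hQ : IsSig u Q) : IsSig u fun x m => ∀ y, Q x (Nat.pair m y) := by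
  obtain ⟨K, hK, h⟩ := hQ
  -- the condition for `y` and length `j` is checked at length `⟨y, j⟩`
  refine ⟨fun q => K (Nat.pair q.1 q.2.1.length.unpair.1,
    (List.range q.2.1.length.unpair.2).map
      (fun i => q.2.1.getD (Nat.pair q.2.1.length.unpair.1 i) 0),
    q.2.2.take q.2.1.length.unpair.2), ?_, fun x m => ?_⟩
  · refine hK.comp (Primrec.pair (by fun_prop) (Primrec.pair (primrec_map (by fun_prop) ?_)
      (by fun_prop)))
    fun_prop
  · have key : ∀ (f : ℕ → ℕ) (y j : ℕ), (List.range j).map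
        (fun i => (pre f (Nat.pair y j)).getD (Nat.pair y i) 0) =
        pre (fun i => f (Nat.pair y i)) j := by
      intro f y j
      refine List.map_congr_left fun i hi => ?_
      exact getD_pre f (Nat.pair_lt_pair_right _ (List.mem_range.1 hi)) 0
    constructor
    · intro hy
      choose F hF using fun y => (h _ _).1 (hy y)
      refine ⟨fun i => F i.unpair.1 i.unpair.2, fun k => ?_⟩
      obtain ⟨y, j, rfl⟩ : ∃ y j, k = Nat.pair y j := ⟨_, _, (Nat.pair_unpair k).symm⟩
      have := hF y j
      rw [length_pre, Nat.unpair_pair]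
      simp only
      rw [key, take_pre _ (Nat.right_le_pair y j)]
      simpa using this
    · rintro ⟨f, hf⟩ y
      refine (h _ _).2 ⟨fun i => f (Nat.pair y i), fun j => ?_⟩
      have := hf (Nat.pair y j)
      beta_reduce at this
      rw [length_pre, Nat.unpair_pair] at this
      simp only at this
      rwa [key, take_pre _ (Nat.right_le_pair y j)] at this

/-- Definition by cases, from which conjunction and disjunction result by quantification. -/
theorem IsSig.cases (hQ : IsSig u Q) (hQ' : IsSig u Q') : IsSig u fun x m =>
    (m.unpair.2 = 0 ∧ Q x m.unpair.1) ∨ (¬ m.unpair.2 = 0 ∧ Q' x m.unpair.1) := by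
  obtain ⟨K, hK, h⟩ := hQ
  obtain ⟨K', hK', h'⟩ := hQ'
  have h0 : PrimrecPred fun q : ℕ × List ℕ × List ℕ => q.1.unpair.2 = 0 :=
    primrecPred_eq (by fun_prop) (Primrec.const 0)
  refine ⟨fun q => (q.1.unpair.2 = 0 ∧ K (q.1.unpair.1, q.2.1, q.2.2)) ∨
    (¬ q.1.unpair.2 = 0 ∧ K' (q.1.unpair.1, q.2.1, q.2.2)), ?_, fun x m => ?_⟩
  · exact (h0.and (hK.comp (by fun_prop))).or (h0.not.and (hK'.comp (by fun_prop)))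
  · by_cases hm : m.unpair.2 = 0 <;> simp [hm, h, h']

theorem IsSig.and (hQ : IsSig u Q) (hQ' : IsSig u Q') : IsSig u fun x m => Q x m ∧ Q' x m :=
  (hQ.cases hQ').all.of_iff fun x m => by
    simp only [Nat.unpair_pair]
    refine ⟨fun h y => ?_, fun h => ⟨by simpa using h 0, by simpa using h 1⟩⟩
    by_cases hy : y = 0 <;> simp [hy, h]

theorem IsSig.or (hQ : IsSig u Q) (hQ' : IsSig u Q') : IsSig u fun x m => Q x m ∨ Q' x m :=
  (hQ.cases hQ').ex.of_iff fun x m => by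
    simp only [Nat.unpair_pair]
    constructor
    · rintro (h | h)
      · exact ⟨0, by simp [h]⟩
      · exact ⟨1, by simp [h]⟩
    · rintro ⟨y, h | h⟩
      · exact Or.inl h.2
      · exact Or.inr h.2

/-- The function with the values `⟨h i, v i⟩`. -/
def pairFun (h v : ℕ → ℕ) (i : ℕ) : ℕ := Nat.pair (h i) (v i)

/-- A function quantifier is absorbed by the path, whose values code pairs. -/
theorem IsSig.exFun {Q : (ℕ → ℕ) × 𝒳 → ℕ → Prop} (hQ : IsSig (fun z => pairFun z.1 (u z.2)) Q) :
    IsSig u fun x m => ∃ h, Q (h, x) m := by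
  obtain ⟨K, hK, h⟩ := hQ
  refine ⟨fun q => K (q.1, q.2.1.map (fun i => i.unpair.2),
    (List.range q.2.1.length).map
      (fun i => Nat.pair (q.2.1.getD i 0).unpair.1 (q.2.2.getD i 0))), ?_, fun x m => ?_⟩
  · refine hK.comp (Primrec.pair (by fun_prop) (Primrec.pair (primrec_map (by fun_prop) ?_)
      (primrec_map (by fun_prop) ?_)))
    · fun_prop
    · fun_prop
  · have key : ∀ (f : ℕ → ℕ) (k : ℕ), (List.range k).map
        (fun i => Nat.pair ((pre f k).getD i 0).unpair.1 ((pre (u x) k).getD i 0)) =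
        pre (pairFun (fun i => (f i).unpair.1) (u x)) k := by
      intro f k
      refine List.map_congr_left fun i hi => ?_
      rw [List.mem_range] at hi
      rw [getD_pre _ hi, getD_pre _ hi, pairFun]
    constructor
    · rintro ⟨h', hh⟩
      obtain ⟨f, hf⟩ := (h _ _).1 hh
      refine ⟨pairFun h' f, fun k => ?_⟩
      beta_reduce
      rw [length_pre, key, map_pre]
      simpa [pairFun] using hf k
    · rintro ⟨f, hf⟩
      refine ⟨fun i => (f i).unpair.1, (h _ _).2 ⟨fun i => (f i).unpair.2, fun k => ?_⟩⟩
      have := hf k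
      beta_reduce at this
      rwa [length_pre, key, map_pre] at this

/-- The relations of the normal form whose complements are of this form too. -/
def sigFamily (u : 𝒳 → ℕ → ℕ) : Set (𝒳 → ℕ → Prop) :=
  {Q | IsSig u Q ∧ IsSig u fun x m => ¬ Q x m}

theorem sigFamily_basic {p : ℕ × List ℕ → Prop} (hp : PrimrecPred p) {c : ℕ → ℕ}
    (hc : Primrec c) : (fun x m => p (m, pre (u x) (c m))) ∈ sigFamily u :=
  ⟨isSig_basic hp hc, isSig_basic hp.not hc⟩

theorem sigFamily_closed : ArithClosed (sigFamily u) where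
  not_mem hp := ⟨hp.2, by simpa using hp.1⟩
  and_mem hp hq := ⟨hp.1.and hq.1, (hp.2.or hq.2).of_iff fun _ _ => not_and_or⟩
  ex_mem hp := ⟨hp.1.ex, hp.2.all.of_iff fun _ _ => not_exists⟩
  comap_mem hp hc := ⟨hp.1.comap hc, hp.2.comap hc⟩
  eq_mem := sigFamily_basic (p := fun q : ℕ × List ℕ => q.1.unpair.1 = q.1.unpair.2)
    (primrecPred_eq (by fun_prop) (by fun_prop)) (Primrec.const 0)

/-- The values of `u`, read through a primitive recursive function. -/
theorem dfn_sigFamily_value {φ : ℕ → ℕ} (hφ : Primrec φ) :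
    Dfn (sigFamily u) fun x (q : ℕ × ℕ) => φ (u x q.1) = q.2 := by
  have h1 : (fun x m => φ (u x m.unpair.1) = m.unpair.2) ∈ sigFamily u := by
    have := sigFamily_basic (u := u)
      (p := fun q : ℕ × List ℕ => φ (q.2.getD q.1.unpair.1 0) = q.1.unpair.2)
      (primrecPred_eq (by fun_prop) (by fun_prop)) (c := fun m => m.unpair.1 + 1) (by fun_prop)
    simpa only [getD_pre _ (Nat.lt_succ_self _)] using this
  refine (sigFamily_closed.comap (c := fun q : ℕ × ℕ => Nat.pair q.1 q.2) (dfn_nat.2 h1)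
    (by fun_prop)).of_iff fun _ q => by simp

variable {N : Struc} {g : ℕ → ℕ}

/-- Relations definable in `N` have the normal form, whenever `u` determines `g`. -/
theorem IsCoding.dfn_sigFamily (hg : IsCoding N g) {φ : ℕ → ℕ} (hφ : Primrec φ)
    (hu : ∀ x i, φ (u x i) = g i) {α : Type*} [Primcodable α] {p : α → Prop}
    (hp : Dfn N.family fun _ => p) : Dfn (sigFamily u) fun _ => p := by
  have hd : Dfn (sigFamily u) fun _ (q : ℕ × ℕ) => g q.1 = q.2 := by
    simpa only [hu] using dfn_sigFamily_value (u := u) hφ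
  exact Dfn.of_structure sigFamily_closed (fun s hs => hg.symDfn sigFamily_closed hd hs) hp

/-- The tuple of sets coded by the function `h`. -/
def tupleOf {s : ℕ} (lam : Fin s → ℕ) (h : ℕ → ℕ) : SetTuple lam :=
  fun i => {v | h (Nat.pair i (encode (List.ofFn v))) = 1}

theorem tupleOf_surjective {s : ℕ} (lam : Fin s → ℕ) : Function.Surjective (tupleOf lam) := by
  classical
  intro A
  refine ⟨fun m => if ∃ (i : Fin s) (v : Fin (lam i) → ℕ), m = Nat.pair i (encode (List.ofFn v)) ∧ v ∈ A i
    then 1 else 0, ?_⟩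
  funext i
  ext v
  simp only [tupleOf, Set.mem_ofPred_eq, ite_eq_left_iff, zero_ne_one, imp_false, not_not]
  constructor
  · rintro ⟨j, w, hjw, hw⟩
    obtain ⟨h1, h2⟩ := Nat.pair_eq_pair.1 hjw
    obtain rfl := Fin.ext h1
    rwa [List.ofFn_injective (encode_injective h2)]
  · intro hv
    exact ⟨i, v, rfl, hv⟩

/-- The normal form theorem for `Σ¹₁` definitions over `N`. -/
theorem IsCoding.isSig_of_scheme (hg : IsCoding N g) {s : ℕ} {lam : Fin s → ℕ}
    {q : SetTuple lam → ℕ → Prop} (hq : q ∈ schemeFamily N lam) :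
    IsSig (fun _ : Unit => g) fun _ m => ∃ A, q A m := by
  have hcl := sigFamily_closed (u := fun z : (ℕ → ℕ) × Unit => pairFun z.1 g)
  have h1 : (fun (z : (ℕ → ℕ) × Unit) m => q (tupleOf lam z.1) m) ∈
      sigFamily (fun z : (ℕ → ℕ) × Unit => pairFun z.1 g) := by
    refine schemeFamily_subset (hcl.pullback fun z => tupleOf lam z.1) (fun t ht => ?_)
      (fun i => ?_) hq
    · have hd : Dfn (sigFamily (fun z : (ℕ → ℕ) × Unit => pairFun z.1 g))
          fun _ (q : ℕ × ℕ) => g q.1 = q.2 := by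
        simpa [pairFun] using dfn_sigFamily_value (u := fun z : (ℕ → ℕ) × Unit => pairFun z.1 g)
          (φ := fun i => i.unpair.2) (by fun_prop)
      have := hg.symDfn hcl hd ht
      cases t <;> exact this
    · have hd : Dfn (sigFamily (fun z : (ℕ → ℕ) × Unit => pairFun z.1 g))
          fun z (q : ℕ × ℕ) => z.1 q.1 = q.2 := by
        simpa [pairFun] using dfn_sigFamily_value (u := fun z : (ℕ → ℕ) × Unit => pairFun z.1 g)
          (φ := fun i => i.unpair.1) (by fun_prop)
      have hc : Primrec fun v : Fin (lam i) → ℕ => encode (List.ofFn v) :=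
        Primrec.encode.comp (Primrec.list_ofFn fun j => primrec_finApp j Primrec.id)
      exact hcl.comap (c := fun v : Fin (lam i) → ℕ =>
        (Nat.pair i (encode (List.ofFn v)), 1)) hd (by fun_prop)
  refine (IsSig.exFun (u := fun _ : Unit => g) h1.1).of_iff fun _ m => ?_
  exact ⟨fun ⟨A, hA⟩ => by
    obtain ⟨h, rfl⟩ := tupleOf_surjective lam A
    exact ⟨h, hA⟩, fun ⟨h, hh⟩ => ⟨_, hh⟩⟩

/-- There is a set that is not of the normal form although its complement is, by diagonalization
of the universal relation `U` of the normal form. -/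
theorem exists_not_isSig (g : ℕ → ℕ) : ∃ D : ℕ → Prop,
    (IsSig (fun _ : Unit => g) fun _ m => ¬ D m) ∧ ¬ IsSig (fun _ : Unit => g) fun _ => D := by
  classical
  let U : ℕ → Prop := fun m => ∃ f : ℕ → ℕ, ∀ k, ∃ t,
    Nat.Partrec.Code.evaln t (Denumerable.ofNat Nat.Partrec.Code m.unpair.1)
      (encode (m.unpair.2, pre f k, pre g k)) = some 1
  have hU : IsSig (fun _ : Unit => g) fun _ => U := by
    have h1 : IsSig (fun z : (ℕ → ℕ) × Unit => pairFun z.1 g) fun z m =>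
        Nat.Partrec.Code.evaln m.unpair.2
          (Denumerable.ofNat Nat.Partrec.Code m.unpair.1.unpair.1.unpair.1)
          (encode (m.unpair.1.unpair.1.unpair.2, pre z.1 m.unpair.1.unpair.2,
            pre g m.unpair.1.unpair.2)) = some 1 := by
      have hp : PrimrecPred fun q : ℕ × List ℕ => Nat.Partrec.Code.evaln q.1.unpair.2
          (Denumerable.ofNat Nat.Partrec.Code q.1.unpair.1.unpair.1.unpair.1)
          (encode (q.1.unpair.1.unpair.1.unpair.2, q.2.map (fun i => i.unpair.1),
            q.2.map (fun i => i.unpair.2))) = some 1 := by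
        refine primrecPred_eq (Nat.Partrec.Code.primrec_evaln.comp
          (((by fun_prop : Primrec fun q : ℕ × List ℕ => q.1.unpair.2).pair
            ((Primrec.ofNat _).comp (by fun_prop))).pair ?_)) (Primrec.const _)
        refine Primrec.encode.comp (Primrec.pair (by fun_prop) (Primrec.pair
          (primrec_map (by fun_prop) ?_) (primrec_map (by fun_prop) ?_)))
        · fun_prop
        · fun_prop
      refine (isSig_basic (u := fun z : (ℕ → ℕ) × Unit => pairFun z.1 g) hp
        (c := fun m => m.unpair.1.unpair.2) (by fun_prop)).of_iff fun z m => ?_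
      simp only [map_pre, pairFun, Nat.unpair_pair]
    refine (IsSig.exFun (u := fun _ : Unit => g) h1.ex.all).of_iff fun _ m => ?_
    simp only [Nat.unpair_pair, U]
  refine ⟨fun m => ¬ U (Nat.pair m m), ?_, ?_⟩
  · exact (hU.comap (c := fun m => Nat.pair m m) (by fun_prop)).of_iff fun _ m => not_not
  · rintro ⟨K, hK, h⟩
    have hc : Primrec fun n : ℕ => (Option.casesOn
        (decode (α := ℕ × List ℕ × List ℕ) n) 0 fun q => if K q then 1 else 0 : ℕ) := by
      refine Primrec.option_casesOn Primrec.decode (Primrec.const 0) ?_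
      exact primrec_ite (hK.comp Primrec.snd) (Primrec.const 1) (Primrec.const 0)
    obtain ⟨e, he⟩ := exists_index hc
    have hKe : ∀ q, K q ↔ ∃ t, Nat.Partrec.Code.evaln t (Denumerable.ofNat Nat.Partrec.Code e)
        (encode q) = some 1 := by
      intro q
      refine Iff.trans ?_ (Nat.Partrec.Code.evaln_complete (x := 1)
        (c := Denumerable.ofNat Nat.Partrec.Code e) (n := encode q))
      have hk : decode (encode q) = some q := encodek q
      rw [he, hk]
      simp
    have := h () e
    simp only [hKe] at this
    have h2 : U (Nat.pair e e) ↔ ∃ f : ℕ → ℕ, ∀ k, ∃ t,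
        Nat.Partrec.Code.evaln t (Denumerable.ofNat Nat.Partrec.Code e)
          (encode (e, pre f k, pre g k)) = some 1 := by
      simp only [U, Nat.unpair_pair]
    rw [← h2] at this
    exact not_iff_self this

end NormalForm

/-! ### Relations decided by finite parts of an oracle -/

section Prefix

theorem primrecPred_ball {α : Type*} [Primcodable α] {f : α → ℕ} {p : α → ℕ → Prop}
    (hf : Primrec f) (hp : PrimrecPred fun q : α × ℕ => p q.1 q.2) :
    PrimrecPred fun a => ∀ i < f a, p a i := by
  have h1 : PrimrecRel fun (i : ℕ) (a : α) => p a i :=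
    hp.comp (f := fun q : ℕ × α => (q.2, q.1)) (by fun_prop)
  exact (PrimrecRel.comp h1.forall_mem_list (Primrec.list_range.comp hf) Primrec.id).of_eq
    fun a => by simp

theorem primrecPred_bex {α : Type*} [Primcodable α] {f : α → ℕ} {p : α → ℕ → Prop}
    (hf : Primrec f) (hp : PrimrecPred fun q : α × ℕ => p q.1 q.2) :
    PrimrecPred fun a => ∃ i < f a, p a i :=
  (primrecPred_ball (p := fun a i => ¬ p a i) hf hp.not).not.of_eq fun a => by simp

variable {N : Struc} {g : ℕ → ℕ}

theorem IsCoding.recursiveIn_pre (hg : IsCoding N g) :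
    Nat.RecursiveIn (oracles N) fun k => Part.some (encode (pre g k)) := by
  have h1 : Nat.RecursiveIn (oracles N) fun m => Part.some (encode
      (Denumerable.ofNat (List ℕ) m.unpair.2.unpair.2 ++ [g m.unpair.2.unpair.1])) := by
    have h2 := recursiveIn_pair (recursiveIn_of_primrec (O := oracles N) Primrec.id)
      (recursiveIn_comp hg.recursiveIn (recursiveIn_of_primrec (O := oracles N)
        (f := fun m => m.unpair.2.unpair.1) (by fun_prop)))
    have h3 : Primrec fun z : ℕ => encode
        (Denumerable.ofNat (List ℕ) z.unpair.1.unpair.2.unpair.2 ++ [z.unpair.2]) := by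
      have := Primrec.ofNat (List ℕ)
      fun_prop
    have := recursiveIn_comp (recursiveIn_of_primrec (O := oracles N) h3) h2
    simpa using this
  have h4 := recursiveIn_comp
    (recursiveIn_rec (recursiveIn_of_primrec (Primrec.const (encode ([] : List ℕ)))) h1)
    (recursiveIn_of_primrec (f := fun k => Nat.pair 0 k) (by fun_prop))
  refine h4.of_eq fun k => congrArg Part.some ?_
  simp only [Nat.unpair_pair]
  induction k with
  | zero => rfl
  | succ k ih =>
    simp only
    rw [ih, Denumerable.ofNat_encode]
    simp [pre, List.range_succ]

/-- Relations that depend primitively recursively on an initial segment of `g` are recursive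
in `N`. -/
theorem IsCoding.recursiveIn_prefix (hg : IsCoding N g) {p : ℕ × List ℕ → Prop}
    [DecidablePred p] (hp : PrimrecPred p) {c : ℕ → ℕ} (hc : Primrec c) :
    Nat.RecursiveIn (oracles N) fun m => Part.some (if p (m, pre g (c m)) then 1 else 0) := by
  have h1 : Primrec fun z : ℕ =>
      if p (z.unpair.1, Denumerable.ofNat (List ℕ) z.unpair.2) then 1 else 0 := by
    have := Primrec.ofNat (List ℕ)
    exact primrec_ite (hp.comp (by fun_prop)) (Primrec.const 1) (Primrec.const 0)
  refine (recursiveIn_comp (recursiveIn_of_primrec h1)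
    (recursiveIn_pair (recursiveIn_of_primrec Primrec.id)
      (recursiveIn_comp hg.recursiveIn_pre (recursiveIn_of_primrec hc)))).of_eq fun m => ?_
  simp only [Nat.unpair_pair, Denumerable.ofNat_encode, id]

theorem IsCoding.dfn_prefix (hg : IsCoding N g) {p : ℕ × List ℕ → Prop}
    (hp : PrimrecPred p) {c : ℕ → ℕ} (hc : Primrec c) :
    Dfn N.family fun _ (m : ℕ) => p (m, pre g (c m)) := by
  classical
  refine (N.closed.comap (c := fun m : ℕ => (m, 1)) (Struc.dfn_recursiveIn
    (hg.recursiveIn_prefix hp hc)) (by fun_prop)).of_iff fun _ m => ?_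
  simp

end Prefix

/-! ### Kleene–Brouwer orderings -/

section KleeneBrouwer

/-- The string `s`, continued by infinite values. -/
def padded (s : List ℕ) (i : ℕ) : ℕ∞ := if i < s.length then (s.getD i 0 : ℕ) else ⊤

theorem padded_of_lt {s : List ℕ} {i : ℕ} (h : i < s.length) : padded s i = (s.getD i 0 : ℕ) :=
  if_pos h

theorem padded_eq_top {s : List ℕ} {i : ℕ} : padded s i = ⊤ ↔ s.length ≤ i := by
  unfold padded
  split_ifs with h
  · simp [h]
  · simpa using h

theorem padded_injective : Function.Injective padded := by
  intro s t h
  have hl : s.length = t.length := by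
    have h1 : ∀ i, s.length ≤ i ↔ t.length ≤ i := fun i => by
      rw [← padded_eq_top, ← padded_eq_top, h]
    exact le_antisymm ((h1 _).2 le_rfl) ((h1 _).1 le_rfl)
  refine List.ext_getElem hl fun i h1 h2 => ?_
  have := congrFun h i
  rw [padded_of_lt h1, padded_of_lt h2] at this
  simpa [h1, h2] using this

theorem padded_lt_iff {s t : List ℕ} {i : ℕ} : padded s i < padded t i ↔
    i < s.length ∧ ¬ (i < t.length ∧ t.getD i 0 ≤ s.getD i 0) := by
  unfold padded
  split_ifs with h1 h2 h2
  · rw [Nat.cast_lt]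
    simp only [h1, h2, true_and, not_le]
  · simp [h1, h2]
  · simp [h1]
  · simp [h1]

theorem padded_eq_iff {s t : List ℕ} {i : ℕ} : padded s i = padded t i ↔ s[i]? = t[i]? := by
  unfold padded
  split_ifs with h1 h2 h2
  · rw [Nat.cast_inj]
    simp [h1, h2]
  · simp [h1, List.getElem?_eq_none (not_lt.1 h2)]
  · simp [h2, List.getElem?_eq_none (not_lt.1 h1)]
  · simp [List.getElem?_eq_none (not_lt.1 h1), List.getElem?_eq_none (not_lt.1 h2)]

/-- The position of the string `s` in the Kleene–Brouwer ordering: proper extensions are smaller,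
and other pairs are compared lexicographically. -/
def kb (s : List ℕ) : Lex (ℕ → ℕ∞) := toLex (padded s)

theorem kb_injective : Function.Injective kb := fun _ _ h => padded_injective (toLex_inj.1 h)

theorem kb_lt_iff {s t : List ℕ} : kb s < kb t ↔
    ∃ i, (∀ j < i, padded s j = padded t j) ∧ padded s i < padded t i := Iff.rfl

theorem kb_not_lt_iff {s t : List ℕ} : ¬ kb s < kb t ↔ kb t ≤ kb s := not_lt

theorem kb_lt_iff_le_ne {s t : List ℕ} : kb s < kb t ↔ kb s ≤ kb t ∧ kb s ≠ kb t :=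
  lt_iff_le_and_ne

theorem kb_lt_iff_bounded {s t : List ℕ} : kb s < kb t ↔
    ∃ i < s.length, (∀ j < i, s[j]? = t[j]?) ∧
      ¬ (i < t.length ∧ t.getD i 0 ≤ s.getD i 0) := by
  rw [kb_lt_iff]
  refine exists_congr fun i => ?_
  rw [padded_lt_iff, and_left_comm]
  simp only [padded_eq_iff]

/-- The tree of all strings whose initial segments satisfy the condition `K`, with parameter
`m` and relative to `g`. -/
def kbTree (K : ℕ × List ℕ × List ℕ → Prop) (g : ℕ → ℕ) (m : ℕ) (s : List ℕ) : Prop :=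
  ∀ j < s.length + 1, K (m, s.take j, pre g j)

/-- The Kleene–Brouwer ordering of the tree given by `K`, as a relation between codes. -/
def kbRel (K : ℕ × List ℕ × List ℕ → Prop) (g : ℕ → ℕ) (m a b : ℕ) : Prop :=
  (kbTree K g m (Denumerable.ofNat (List ℕ) a) ∧ kbTree K g m (Denumerable.ofNat (List ℕ) b)) ∧
    ¬ kb (Denumerable.ofNat (List ℕ) b) < kb (Denumerable.ofNat (List ℕ) a)

variable {K : ℕ × List ℕ × List ℕ → Prop} {g : ℕ → ℕ} {m : ℕ}

theorem kbRel_self {a : ℕ} : kbRel K g m a a ↔ kbTree K g m (Denumerable.ofNat (List ℕ) a) := by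
  simp only [kbRel, and_self, kb_not_lt_iff, le_refl, and_true]

theorem strictRel_kbRel {a b : ℕ} : strictRel (kbRel K g m) a b ↔
    kbTree K g m (Denumerable.ofNat (List ℕ) a) ∧ kbTree K g m (Denumerable.ofNat (List ℕ) b) ∧
      kb (Denumerable.ofNat (List ℕ) a) <
        kb (Denumerable.ofNat (List ℕ) b) := by
  unfold strictRel kbRel
  rw [kb_not_lt_iff, and_assoc, and_assoc, kb_lt_iff_le_ne]
  have : a ≠ b ↔ kb (Denumerable.ofNat (List ℕ) a) ≠
      kb (Denumerable.ofNat (List ℕ) b) :=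
    not_congr ⟨fun h => by rw [h], fun h => by
      have := congrArg encode (kb_injective h)
      simpa using this⟩
  rw [this]

/-- The sequence of the least values that an element of `S` can take after taking the earlier
least values: the greatest lower bound of `S` in the lexicographical ordering. -/
noncomputable def lexInf (S : Set (ℕ → ℕ∞)) (n : ℕ) : ℕ∞ :=
  sInf {w | ∃ s ∈ S, (∀ j (_ : j < n), s j = lexInf S j) ∧ w = s n}

theorem exists_agree_lexInf {S : Set (ℕ → ℕ∞)} (hS : S.Nonempty) (n : ℕ) :
    ∃ s ∈ S, ∀ j < n, s j = lexInf S j := by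
  induction n with
  | zero =>
    obtain ⟨s, hs⟩ := hS
    exact ⟨s, hs, by simp⟩
  | succ n ih =>
    obtain ⟨s, hs, h⟩ := ih
    have hne : {w | ∃ s ∈ S, (∀ j (_ : j < n), s j = lexInf S j) ∧ w = s n}.Nonempty :=
      ⟨s n, s, hs, h, rfl⟩
    obtain ⟨t, ht, h1, h2⟩ := csInf_mem hne
    refine ⟨t, ht, fun j hj => ?_⟩
    rcases Nat.lt_succ_iff_lt_or_eq.1 hj with hj | rfl
    · exact h1 j hj
    · rw [← h2, ← lexInf]

theorem lexInf_le {S : Set (ℕ → ℕ∞)} {s : ℕ → ℕ∞} (hs : s ∈ S) {n : ℕ}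
    (h : ∀ j < n, s j = lexInf S j) : lexInf S n ≤ s n := by
  rw [lexInf]
  exact csInf_le (OrderBot.bddBelow _) ⟨s, hs, h, rfl⟩

theorem kbTree_take {s : List ℕ} (hs : kbTree K g m s) {k : ℕ} (hk : k ≤ s.length) :
    K (m, s.take k, pre g k) := hs k (Nat.lt_succ_of_le hk)

theorem kbTree_pre {f : ℕ → ℕ} (hf : ∀ k, K (m, pre f k, pre g k)) (k : ℕ) :
    kbTree K g m (pre f k) := by
  intro j hj
  rw [length_pre] at hj
  rw [take_pre f (Nat.lt_succ_iff.1 hj)]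
  exact hf j

/-- In a tree without infinite paths the Kleene–Brouwer ordering is well-founded. -/
theorem exists_kb_min (hK : ¬ ∃ f : ℕ → ℕ, ∀ k, K (m, pre f k, pre g k)) {A : Set (List ℕ)}
    (hA : A.Nonempty) (hT : ∀ s ∈ A, kbTree K g m s) :
    ∃ s ∈ A, ∀ t ∈ A, ¬ kb t < kb s := by
  -- if the greatest lower bound of `A` has no infinite value, then it is a path; otherwise it is
  -- attained
  have hS : (padded '' A).Nonempty := hA.image _
  obtain ⟨n, hn⟩ : ∃ n, lexInf (padded '' A) n = ⊤ := by
    by_contra! hne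
    refine hK ⟨fun n => (lexInf (padded '' A) n).toNat, fun k => ?_⟩
    obtain ⟨_, ⟨s, hs, rfl⟩, h⟩ := exists_agree_lexInf hS k
    have hk : k ≤ s.length := by
      by_contra! hlt
      exact hne _ ((h _ hlt).symm.trans (padded_eq_top.2 le_rfl))
    have : pre (fun n => (lexInf (padded '' A) n).toNat) k = s.take k := by
      refine List.ext_getElem (by simp [hk]) fun i h1 h2 => ?_
      have hi : i < k := by simpa using h1
      have := h i hi
      rw [padded_of_lt (hi.trans_le hk)] at this
      simp [pre, ← this, hi.trans_le hk]
    rw [this]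
    exact kbTree_take (hT s hs) hk
  obtain ⟨_, ⟨s, hs, rfl⟩, h⟩ := exists_agree_lexInf hS (n + 1)
  refine ⟨s, hs, fun t ht hlt => ?_⟩
  obtain ⟨i, hi, hlt⟩ := kb_lt_iff.1 hlt
  have hsn : s.length ≤ n := padded_eq_top.1 ((h n n.lt_succ_self).trans hn)
  have hin : i < n + 1 := by
    by_contra! hni
    have h1 : padded t n = ⊤ := (hi n hni).trans (padded_eq_top.2 hsn)
    have h2 : padded t i = ⊤ := padded_eq_top.2 ((padded_eq_top.1 h1).trans (n.le_succ.trans hni))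
    rw [h2] at hlt
    exact not_top_lt hlt
  have h3 : lexInf (padded '' A) i ≤ padded t i :=
    lexInf_le (Set.mem_image_of_mem padded ht) fun j hj => (hi j hj).trans (h j (hj.trans hin))
  exact (h3.trans_lt hlt).ne (h i hin).symm

/-- The order type of a relation is unique. -/
theorem isRankFun_unique {R : ℕ → ℕ → Prop} {β β' : Ordinal.{0}} {ρ ρ' : ℕ → Ordinal.{0}}
    (h : IsRankFun R β ρ) (h' : IsRankFun R β' ρ') : β = β' := by
  obtain ⟨_, hw, h1⟩ := isRepresentation_iff.2 ⟨ρ, h⟩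
  obtain ⟨_, hw', h2⟩ := isRepresentation_iff.2 ⟨ρ', h'⟩
  exact h1.symm.trans h2

theorem exists_isRankFun_kbRel (hK : ¬ ∃ f : ℕ → ℕ, ∀ k, K (m, pre f k, pre g k)) :
    ∃ β ρ, IsRankFun (kbRel K g m) β ρ := by
  have hmem : ∀ b, b ∈ rng (kbRel K g m) ↔ kbTree K g m (Denumerable.ofNat (List ℕ) b) :=
    fun b => ⟨fun ⟨a, h⟩ => h.1.2, fun h => ⟨b, kbRel_self.2 h⟩⟩
  have hstrict : ∀ a b : rng (kbRel K g m), strictPart (kbRel K g m) a b ↔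
      kb (Denumerable.ofNat (List ℕ) a) <
        kb (Denumerable.ofNat (List ℕ) b) := by
    intro a b
    have h1 := strictRel_kbRel (K := K) (g := g) (m := m) (a := a) (b := b)
    simp only [(hmem a).1 a.2, (hmem b).1 b.2, true_and] at h1
    rw [← h1]
    exact and_congr_right fun _ => not_congr Subtype.ext_iff
  have hlin : IsLinearOrdering (kbRel K g m) :=
    { dom_subset := fun a b h => (hmem a).2 h.1.1
      refl := fun a h => kbRel_self.2 ((hmem a).1 h)
      trans := fun a b c h1 h2 => ⟨⟨h1.1.1, h2.1.2⟩, by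
        have h3 := h1.2
        have h4 := h2.2
        rw [kb_not_lt_iff] at *
        exact h3.trans h4⟩
      antisymm := fun a b h1 h2 => by
        have := congrArg encode (kb_injective
          (le_antisymm (kb_not_lt_iff.1 h1.2) (kb_not_lt_iff.1 h2.2)))
        simpa using this
      total := fun a ha b hb => by
        rw [hmem] at ha hb
        unfold kbRel
        simp only [ha, hb, true_and, and_self, kb_not_lt_iff]
        exact le_total _ _ }
  have hwo : IsWellOrder (rng (kbRel K g m)) (strictPart (kbRel K g m)) := by
    refine { wf := ?_, toTrichotomous := ⟨fun a b h1 h2 => ?_⟩ }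
    · refine WellFounded.wellFounded_iff_has_min.2 fun B hB => ?_
      obtain ⟨s, ⟨a, ha, rfl⟩, h⟩ := exists_kb_min hK
        (A := (fun a : rng (kbRel K g m) => Denumerable.ofNat (List ℕ) a) '' B) (hB.image _) (by
          rintro _ ⟨a, -, rfl⟩
          exact (hmem a).1 a.2)
      exact ⟨a, ha, fun b hb hlt => h _ ⟨b, hb, rfl⟩ ((hstrict _ _).1 hlt)⟩
    · rw [hstrict, kb_not_lt_iff] at h1 h2
      have := congrArg encode (kb_injective (le_antisymm h2 h1))
      exact Subtype.ext (by simpa using this)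
  obtain ⟨ρ, hρ⟩ := isRepresentation_iff.1 ⟨hlin, hwo, rfl⟩
  exact ⟨_, ρ, hρ⟩

/-- Infinite paths give descending sequences. -/
theorem strictRel_kbRel_path {f : ℕ → ℕ} (hf : ∀ k, K (m, pre f k, pre g k)) (k : ℕ) :
    strictRel (kbRel K g m) (encode (pre f (k + 1))) (encode (pre f k)) := by
  rw [strictRel_kbRel, Denumerable.ofNat_encode, Denumerable.ofNat_encode]
  refine ⟨kbTree_pre hf _, kbTree_pre hf _, kb_lt_iff.2 ⟨k, fun j hj => ?_, ?_⟩⟩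
  · rw [padded_of_lt (by simp; omega), padded_of_lt (by simp; omega), getD_pre _ (by omega),
      getD_pre _ hj]
  · rw [padded_lt_iff]
    simp

/-- The Kleene–Brouwer orderings depend on finite initial segments of `g`. -/
theorem exists_prefix_kbRel (hK : PrimrecPred K) : ∃ (p : ℕ × List ℕ → Prop) (c : ℕ → ℕ),
    PrimrecPred p ∧ Primrec c ∧ ∀ g m a b,
      kbRel K g m a b ↔ p (Nat.pair m (Nat.pair a b), pre g (c (Nat.pair m (Nat.pair a b)))) := by
  have hof := Primrec.ofNat (List ℕ)
  let T : ℕ → List ℕ → List ℕ → Prop := fun m s l => ∀ j < s.length + 1, K (m, s.take j, l.take j)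
  have hT : ∀ {f : ℕ × List ℕ → ℕ} {s l : ℕ × List ℕ → List ℕ}, Primrec f → Primrec s →
      Primrec l → PrimrecPred fun q => T (f q) (s q) (l q) := by
    intro f s l hf hs hl
    refine primrecPred_ball (f := fun q => (s q).length + 1) (by fun_prop) (hK.comp ?_)
    fun_prop
  refine ⟨fun q => (T q.1.unpair.1 (Denumerable.ofNat (List ℕ) q.1.unpair.2.unpair.1) q.2 ∧
      T q.1.unpair.1 (Denumerable.ofNat (List ℕ) q.1.unpair.2.unpair.2) q.2) ∧
    ¬ kb (Denumerable.ofNat (List ℕ) q.1.unpair.2.unpair.2) <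
      kb (Denumerable.ofNat (List ℕ) q.1.unpair.2.unpair.1),
    fun z => (Denumerable.ofNat (List ℕ) z.unpair.2.unpair.1).length +
      (Denumerable.ofNat (List ℕ) z.unpair.2.unpair.2).length, ?_, by fun_prop, ?_⟩
  · refine ((hT (by fun_prop) (by fun_prop) (by fun_prop)).and
      (hT (by fun_prop) (by fun_prop) (by fun_prop))).and (PrimrecPred.not ?_)
    simp only [kb_lt_iff_bounded]
    refine primrecPred_bex (f := fun q : ℕ × List ℕ =>
      (Denumerable.ofNat (List ℕ) q.1.unpair.2.unpair.2).length) (by fun_prop)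
      (PrimrecPred.and ?_ (PrimrecPred.not (PrimrecPred.and ?_ ?_)))
    · refine primrecPred_ball (f := fun q : (ℕ × List ℕ) × ℕ => q.2) (by fun_prop)
        (primrecPred_eq ?_ ?_)
      · exact Primrec.list_getElem?.comp (by fun_prop) (by fun_prop)
      · exact Primrec.list_getElem?.comp (by fun_prop) (by fun_prop)
    · exact primrecPred_lt (by fun_prop) (by fun_prop)
    · exact primrecPred_le (by fun_prop) (by fun_prop)
  · intro g m a b
    have h1 : ∀ s k, s.length ≤ k → (T m s (pre g k) ↔ kbTree K g m s) := by
      intro s k hk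
      refine forall₂_congr fun j hj => ?_
      rw [take_pre g (by omega)]
    beta_reduce
    simp only [Nat.unpair_pair]
    rw [h1 _ _ (by omega), h1 _ _ (by omega), kbRel]

variable {N : Struc}

theorem IsCoding.dfn_kbRel (hg : IsCoding N g) (hK : PrimrecPred K) :
    Dfn N.family fun _ (c : ℕ × ℕ × ℕ) => kbRel K g c.1 c.2.1 c.2.2 := by
  obtain ⟨p, c, hp, hc, h⟩ := exists_prefix_kbRel hK
  refine (N.closed.comap (c := fun c : ℕ × ℕ × ℕ => Nat.pair c.1 (Nat.pair c.2.1 c.2.2))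
    (hg.dfn_prefix hp hc) (by fun_prop)).of_iff fun _ c => h _ _ _ _

end KleeneBrouwer

/-! ### Boundedness and the ordinal of a structure -/

section Bounding

theorem IsRankFun.initial {R : ℕ → ℕ → Prop} {β α : Ordinal.{0}} {ρ : ℕ → Ordinal.{0}}
    (h : IsRankFun R β ρ) (hα : α ≤ β) : IsRankFun (fun x y => R x y ∧ ρ y < α) α ρ where
  rel_iff x y := by
    rw [h.rel_iff x y]
    constructor
    · rintro ⟨⟨hx, hy, hle⟩, hlt⟩
      exact ⟨⟨hx, hle.trans_lt hlt⟩, ⟨hy, hlt⟩, hle⟩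
    · rintro ⟨⟨hx, -⟩, ⟨hy, hlt⟩, hle⟩
      exact ⟨⟨hx, hy, hle⟩, hlt⟩
  inj x y hx hy := h.inj x y hx.1 hy.1
  lt x hx := hx.2
  surj γ hγ := by
    obtain ⟨x, hx, rfl⟩ := h.surj γ (hγ.trans_le hα)
    exact ⟨x, ⟨hx, hγ⟩, rfl⟩

theorem IsRankFun.exists_embedding {R L : ℕ → ℕ → Prop} {β β' : Ordinal.{0}}
    {ρ ρ' : ℕ → Ordinal.{0}} (h : IsRankFun R β ρ) (h' : IsRankFun L β' ρ') (hβ : β ≤ β') :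
    ∃ f : ℕ → ℕ, ∀ a b, strictRel R a b → strictRel L (f a) (f b) := by
  have : ∀ a, ∃ b, R a a → L b b ∧ ρ' b = ρ a := by
    intro a
    by_cases ha : R a a
    · obtain ⟨b, hb, he⟩ := h'.surj (ρ a) ((h.lt a ha).trans_le hβ)
      exact ⟨b, fun _ => ⟨hb, he⟩⟩
    · exact ⟨0, fun h => absurd h ha⟩
  choose f hf using this
  refine ⟨f, fun a b hab => ?_⟩
  rw [h.strict_iff] at hab
  rw [h'.strict_iff, (hf a hab.1).2, (hf b hab.2.1).2]
  exact ⟨(hf a hab.1).1, (hf b hab.2.1).1, hab.2.2⟩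

variable {N : Struc} {g : ℕ → ℕ} {K : ℕ × List ℕ × List ℕ → Prop} {D : ℕ → Prop}

/-- Boundedness: a set `E` in normal form of indices of well-orderings `L m` cannot have
arbitrarily long `L m`, since otherwise the set `D` of indices of well-founded trees would have the
normal form, `n` being in `D` if the ordering of the `n`-th tree embeds in some `L m`. -/
theorem exists_bound (hg : IsCoding N g) (hK : PrimrecPred K)
    (hKD : ∀ m, ¬ D m ↔ ∃ f : ℕ → ℕ, ∀ k, K (m, pre f k, pre g k))
    (hD : ¬ IsSig (fun _ : Unit => g) fun _ => D) {E : ℕ → Prop}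
    (hE : IsSig (fun _ : Unit => g) fun _ => E) {L : ℕ → ℕ → ℕ → Prop}
    (hL : Dfn N.family fun _ (c : ℕ × ℕ × ℕ) => L c.1 c.2.1 c.2.2)
    (hwo : ∀ m, E m → ∃ β ρ, IsRankFun (L m) β ρ) :
    ∃ n, D n ∧ ∃ β ρ, IsRankFun (kbRel K g n) β ρ ∧
      ∀ m, E m → ∀ β' ρ', IsRankFun (L m) β' ρ' → β' < β := by
  by_contra! hcon
  have key : ∀ n, D n ↔ ∃ m, E m ∧ ∃ f : ℕ → ℕ, ∀ a b,
      strictRel (kbRel K g n) a b → strictRel (L m) (f a) (f b) := by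
    intro n
    constructor
    · intro hn
      obtain ⟨β, ρ, h⟩ := exists_isRankFun_kbRel (K := K) (g := g) (m := n)
        (fun hf => (hKD n).2 hf hn)
      obtain ⟨m, hm, β', ρ', h', hle⟩ := hcon n hn β ρ h
      exact ⟨m, hm, h.exists_embedding h' hle⟩
    · rintro ⟨m, hm, f, hf⟩
      by_contra hn
      obtain ⟨p, hp⟩ := (hKD n).1 hn
      obtain ⟨β, ρ, h⟩ := hwo m hm
      exact (wellFounded_iff_isEmpty_descending_chain.1 h.wf_strict).false
        ⟨fun k => f (encode (pre p k)), fun k => hf _ _ (strictRel_kbRel_path hp k)⟩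
  refine hD (IsSig.of_iff (Q := fun _ n => ∃ m, E m ∧ ∃ f : ℕ → ℕ, ∀ a b,
      strictRel (kbRel K g n) a b → strictRel (L m) (f a) (f b)) ?_ fun _ n => key n)
  have hcl := sigFamily_closed (u := fun z : (ℕ → ℕ) × Unit => pairFun z.1 g)
  have hdg : ∀ {α : Type} [Primcodable α] {p : α → Prop}, (Dfn N.family fun _ => p) →
      Dfn (sigFamily fun z : (ℕ → ℕ) × Unit => pairFun z.1 g) fun _ => p := fun hp =>
    hg.dfn_sigFamily (φ := fun i => i.unpair.2) (by fun_prop) (by simp [pairFun]) hp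
  have hd : Dfn (sigFamily (fun z : (ℕ → ℕ) × Unit => pairFun z.1 g))
      fun z (q : ℕ × ℕ) => z.1 q.1 = q.2 := by
    simpa [pairFun] using dfn_sigFamily_value (u := fun z : (ℕ → ℕ) × Unit => pairFun z.1 g)
      (φ := fun i => i.unpair.1) (by fun_prop)
  have h1 : Dfn (sigFamily (fun z : (ℕ → ℕ) × Unit => pairFun z.1 g)) fun z (c : ℕ) =>
      ∀ a b : ℕ, strictRel (kbRel K g c.unpair.1) a b → ∃ a' b' : ℕ,
        (z.1 a = a' ∧ z.1 b = b') ∧ strictRel (L c.unpair.2) a' b' := by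
    refine hcl.all (hcl.all (hcl.imp ?_ (hcl.ex (hcl.ex (hcl.and (hcl.and ?_ ?_) ?_)))))
    · exact hcl.comap (c := fun c : (ℕ × ℕ) × ℕ => (c.1.1.unpair.1, c.1.2, c.2))
        (hdg (dfn_strictRel N.closed (hg.dfn_kbRel hK))) (by fun_prop)
    · exact hcl.comap (c := fun c : (((ℕ × ℕ) × ℕ) × ℕ) × ℕ => (c.1.1.1.2, c.1.2)) hd
        (by fun_prop)
    · exact hcl.comap (c := fun c : (((ℕ × ℕ) × ℕ) × ℕ) × ℕ => (c.1.1.2, c.2)) hd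
        (by fun_prop)
    · exact hcl.comap (c := fun c : (((ℕ × ℕ) × ℕ) × ℕ) × ℕ =>
        (c.1.1.1.1.unpair.2, c.1.2, c.2)) (hdg (dfn_strictRel N.closed hL)) (by fun_prop)
  have h2 := IsSig.exFun (u := fun _ : Unit => g) (dfn_nat.1 h1).1
  refine ((hE.comap (c := fun z => z.unpair.2) (by fun_prop)).and h2).ex.of_iff fun _ n => ?_
  simp

theorem RecursiveOrdinal.definableOrdinal {α : Ordinal.{0}} (h : RecursiveOrdinal N α) :
    DefinableOrdinal N α := by
  classical
  obtain ⟨R, hR, hc⟩ := h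
  refine ⟨R, hR, Struc.def_ext₂.2 ?_⟩
  refine (N.closed.comap (c := fun q : ℕ × ℕ => (Nat.pair q.1 q.2, 1))
    (Struc.dfn_recursiveIn hc) (by fun_prop)).of_iff fun _ q => ?_
  simp

theorem definableOrdinal_of_isRankFun {R : ℕ → ℕ → Prop} {β α : Ordinal.{0}}
    {ρ : ℕ → Ordinal.{0}} (h : IsRankFun R β ρ)
    (hR : Dfn N.family fun _ (q : ℕ × ℕ) => R q.1 q.2) (hα : α ≤ β) : DefinableOrdinal N α := by
  refine definableOrdinal_iff.2 ⟨_, ρ, h.initial hα, ?_⟩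
  refine (N.closed.and hR (N.closed.comap (c := fun q : ℕ × ℕ => q.2) (h.dfn_initial hR α)
    (by fun_prop))).of_iff fun _ q => and_congr_right fun hq => ?_
  rw [and_iff_right ((h.rel_iff _ _).1 hq).2.1]

theorem DefinableOrdinal.of_le {α β : Ordinal.{0}} (h : DefinableOrdinal N β) (hα : α ≤ β) :
    DefinableOrdinal N α := by
  obtain ⟨R, ρ, h, hR⟩ := definableOrdinal_iff.1 h
  exact definableOrdinal_of_isRankFun h hR hα

theorem IsCoding.dfn_kbRel_section (hg : IsCoding N g) (hK : PrimrecPred K) (n : ℕ) :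
    Dfn N.family fun _ (q : ℕ × ℕ) => kbRel K g n q.1 q.2 :=
  N.closed.comap (c := fun q : ℕ × ℕ => (n, q.1, q.2)) (hg.dfn_kbRel hK) (by fun_prop)

/-- Proper initial segments of the Kleene–Brouwer orderings are recursive. -/
theorem recursiveOrdinal_of_kbRel (hg : IsCoding N g) (hK : PrimrecPred K) {n : ℕ}
    {α β : Ordinal.{0}} {ρ : ℕ → Ordinal.{0}} (h : IsRankFun (kbRel K g n) β ρ) (hα : α < β) :
    RecursiveOrdinal N α := by
  classical
  obtain ⟨b, hb, hbα⟩ := h.surj α hα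
  refine ⟨_, isRepresentation_iff.2 ⟨ρ, h.initial hα.le⟩, ?_⟩
  obtain ⟨p, c, hp, hc, hpc⟩ := exists_prefix_kbRel hK
  have h1 := hg.recursiveIn_prefix hp hc
  have h2 := recursiveIn_pair (recursiveIn_of_primrec Primrec.id) (recursiveIn_pair
    (recursiveIn_comp h1 (recursiveIn_of_primrec (f := fun z => Nat.pair n z) (by fun_prop)))
    (recursiveIn_comp h1 (recursiveIn_of_primrec
      (f := fun z => Nat.pair n (Nat.pair z.unpair.2 b)) (by fun_prop))))
  have h3 : Primrec fun t : ℕ => if (t.unpair.2.unpair.1 = 1 ∧ t.unpair.2.unpair.2 = 1) ∧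
      ¬ t.unpair.1.unpair.2 = b then 1 else 0 :=
    primrec_ite (((primrecPred_eq (by fun_prop) (Primrec.const 1)).and
      (primrecPred_eq (by fun_prop) (Primrec.const 1))).and
      (primrecPred_eq (by fun_prop) (Primrec.const b)).not) (Primrec.const 1) (Primrec.const 0)
  refine (recursiveIn_comp (recursiveIn_of_primrec h3) h2).of_eq fun z => ?_
  obtain ⟨x, y, rfl⟩ : ∃ x y, z = Nat.pair x y := ⟨_, _, (Nat.pair_unpair z).symm⟩
  have hs := h.strict_iff y b
  unfold strictRel at hs
  rw [hbα, and_iff_right hb] at hs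
  have hR : (kbRel K g n x y ∧ ρ y < α) ↔ ((kbRel K g n x y ∧ kbRel K g n y b) ∧ ¬ y = b) := by
    rw [and_assoc]
    refine and_congr_right fun hxy => ?_
    rw [← ne_eq, hs, and_iff_right ((h.rel_iff _ _).1 hxy).2.1]
  simp only [hpc] at hR
  simp [hpc, hR]

/-- The orderings of the well-founded trees exhaust the definable ordinals. -/
theorem exists_kbRel_above (hg : IsCoding N g) (hK : PrimrecPred K)
    (hKD : ∀ m, ¬ D m ↔ ∃ f : ℕ → ℕ, ∀ k, K (m, pre f k, pre g k))
    (hD : ¬ IsSig (fun _ : Unit => g) fun _ => D) {α : Ordinal.{0}}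
    (hα : DefinableOrdinal N α) :
    ∃ n, D n ∧ ∃ β ρ, IsRankFun (kbRel K g n) β ρ ∧ α < β := by
  obtain ⟨R, ρ, h, hR⟩ := definableOrdinal_iff.1 hα
  have hE : IsSig (fun _ : Unit => g) fun _ _ => True :=
    (isSig_basic (p := fun _ => 0 = 0) (primrecPred_eq (Primrec.const 0) (Primrec.const 0))
      (Primrec.const 0)).of_iff fun _ _ => by simp
  obtain ⟨n, hn, β, ρ', h', hb⟩ := exists_bound hg hK hKD hD hE (L := fun _ => R)
    (N.closed.comap (c := fun c : ℕ × ℕ × ℕ => (c.2.1, c.2.2)) hR (by fun_prop))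
    fun _ _ => ⟨α, ρ, h⟩
  exact ⟨n, hn, β, ρ', h', hb 0 trivial α ρ h⟩

/-- A list of trees recursive in `g` for which well-foundedness does not have the normal form. -/
theorem exists_tree_family (g : ℕ → ℕ) : ∃ (K : ℕ × List ℕ × List ℕ → Prop) (D : ℕ → Prop),
    PrimrecPred K ∧ (∀ m, ¬ D m ↔ ∃ f : ℕ → ℕ, ∀ k, K (m, pre f k, pre g k)) ∧
    ¬ IsSig (fun _ : Unit => g) fun _ => D := by
  obtain ⟨D, ⟨K, hK, h⟩, hD⟩ := exists_not_isSig g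
  exact ⟨K, D, hK, fun m => h () m, hD⟩

theorem definableOrdinal_iff_recursiveOrdinal (hN : N.LFinite) {α : Ordinal.{0}} :
    DefinableOrdinal N α ↔ RecursiveOrdinal N α := by
  refine ⟨fun hα => ?_, RecursiveOrdinal.definableOrdinal⟩
  obtain ⟨g, hg⟩ := exists_isCoding hN
  obtain ⟨K, D, hK, hKD, hD⟩ := exists_tree_family g
  obtain ⟨n, -, β, ρ, h, hlt⟩ := exists_kbRel_above hg hK hKD hD hα
  exact recursiveOrdinal_of_kbRel hg hK h hlt

theorem IsRankFun.card_le {R : ℕ → ℕ → Prop} {β : Ordinal.{0}} {ρ : ℕ → Ordinal.{0}}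
    (h : IsRankFun R β ρ) : β.card ≤ Cardinal.aleph0 := by
  obtain ⟨-, hw, rfl⟩ := isRepresentation_iff.2 ⟨ρ, h⟩
  rw [Ordinal.card_type]
  exact Cardinal.mk_le_aleph0

theorem exists_not_definableOrdinal (N : Struc) : ∃ α, ¬ DefinableOrdinal N α := by
  refine ⟨(Cardinal.aleph 1).ord, fun h => ?_⟩
  obtain ⟨R, ρ, h, -⟩ := definableOrdinal_iff.1 h
  have := h.card_le
  rw [Cardinal.card_ord] at this
  exact absurd this (not_le.2 Cardinal.aleph0_lt_aleph_one)

theorem definableOrdinal_iff_lt {α : Ordinal.{0}} : DefinableOrdinal N α ↔ α < Ord N := by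
  constructor
  · intro hα
    by_contra! hle
    exact csInf_mem (s := {α | ¬ DefinableOrdinal N α}) (exists_not_definableOrdinal N)
      (hα.of_le hle)
  · intro hα
    by_contra hn
    exact notMem_of_lt_csInf hα (OrderBot.bddBelow _) hn

theorem isSuccLimit_ord (hN : N.LFinite) : Order.IsSuccLimit (Ord N) := by
  obtain ⟨g, hg⟩ := exists_isCoding hN
  obtain ⟨K, D, hK, hKD, hD⟩ := exists_tree_family g
  have h0 : DefinableOrdinal N 0 :=
    definableOrdinal_iff.2 ⟨fun _ _ => False, fun _ => 0, ⟨by simp, by simp, by simp, by simp⟩,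
      N.closed.const False⟩
  refine Order.isSuccLimit_iff_of_orderBot.2 ⟨?_, ?_⟩
  · exact (pos_iff_ne_zero.1 (definableOrdinal_iff_lt.1 h0))
  · refine Order.isSuccPrelimit_of_succ_lt fun α hα => ?_
    obtain ⟨n, -, β, ρ, h, hlt⟩ :=
      exists_kbRel_above hg hK hKD hD (definableOrdinal_iff_lt.2 hα)
    exact (Order.succ_le_of_lt hlt).trans_lt (definableOrdinal_iff_lt.1
      (definableOrdinal_of_isRankFun h (hg.dfn_kbRel_section hK n) le_rfl))

theorem card_ord_le (hN : N.LFinite) : (Ord N).card ≤ Cardinal.aleph0 := by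
  obtain ⟨g, hg⟩ := exists_isCoding hN
  obtain ⟨K, D, hK, hKD, hD⟩ := exists_tree_family g
  have h1 : ∀ n, ∃ β ρ, D n → IsRankFun (kbRel K g n) β ρ := by
    intro n
    by_cases hn : D n
    · obtain ⟨β, ρ, h⟩ := exists_isRankFun_kbRel (K := K) (g := g) (m := n)
        (fun hf => (hKD n).2 hf hn)
      exact ⟨β, ρ, fun _ => h⟩
    · exact ⟨0, fun _ => 0, fun h => absurd h hn⟩
  choose β ρ hρ using h1
  have h2 : ∀ α : (Ord N).ToType, ∃ q : ℕ × ℕ, ρ q.1 q.2 = Ordinal.ToType.toOrd α := by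
    intro α
    obtain ⟨n, hn, β', ρ', h, hlt⟩ :=
      exists_kbRel_above hg hK hKD hD (definableOrdinal_iff_lt.2 (Set.mem_Iio.1 (Ordinal.ToType.toOrd α).2))
    rw [isRankFun_unique h (hρ n hn)] at hlt
    obtain ⟨x, -, hx⟩ := (hρ n hn).surj _ hlt
    exact ⟨(n, x), hx⟩
  choose q hq using h2
  rw [← Cardinal.mk_toType]
  refine (Cardinal.mk_le_of_injective (f := q) fun a b hab => ?_).trans Cardinal.mk_le_aleph0
  refine Ordinal.ToType.mk.symm.injective (Subtype.ext ?_)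
  have := (hq a).symm
  rw [hab] at this
  exact this.trans (hq b)

end Bounding

/-! ### Hyperarithmetical sets are definable in the hierarchy -/

section Hyperarithmetical

/-- The recursion clause for "the rank of the part of the ordering `L m` below `x` is at most `r`",
with the argument `z = ⟨m, x⟩`. -/
def rankOp (L : ℕ → ℕ → ℕ → Prop) (Y : ℕ → ℕ → Prop) (_ z : ℕ) : Prop :=
  ∀ y, strictRel (L z.unpair.1) y z.unpair.2 → ∃ r', Y r' (Nat.pair z.unpair.1 y)

variable {N : Struc} {L : ℕ → ℕ → ℕ → Prop}

theorem isDefinableOp_rankOp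
    (hL : Dfn N.family fun _ (c : ℕ × ℕ × ℕ) => L c.1 c.2.1 c.2.2) :
    IsDefinableOp N (rankOp L) := by
  intro 𝒳 𝓑 h hN α _ Y hY
  refine h.all (h.imp ?_ (h.ex ?_))
  · exact h.comap (c := fun c : (α × ℕ × ℕ) × ℕ => (c.1.2.2.unpair.1, c.2, c.1.2.2.unpair.2))
      (dfn_strictRel h (Dfn.of_structure h hN hL)) (by fun_prop)
  · exact h.comap (c := fun c : ((α × ℕ × ℕ) × ℕ) × ℕ =>
      (c.1.1.1, c.2, Nat.pair c.1.1.2.2.unpair.1 c.1.2)) hY (by fun_prop)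

variable {R : ℕ → ℕ → Prop} {β : Ordinal.{0}} {ρ : ℕ → Ordinal.{0}} (h : IsRankFun R β ρ)

include h in
/-- Recursions of length `δ` over `N` lead to relations definable in `M (δ + 1)`. -/
theorem IsTarskiSequence.dfn_hier {mu : Ordinal.{0}} {M : Ordinal.{0} → Struc}
    (hM : IsTarskiSequence N mu M) (hR : Dfn N.family fun _ (q : ℕ × ℕ) => R q.1 q.2)
    {Φ : (ℕ → ℕ → Prop) → ℕ → ℕ → Prop} (hΦ : IsDefinableOp N Φ) {δ : Ordinal.{0}}
    (hδ : δ < mu) : Dfn (M (Order.succ δ)).family fun _ (q : ℕ × ℕ) =>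
      (R q.1 q.1 ∧ ρ q.1 < δ) ∧ hier h.wf_strict Φ q.1 q.2 := by
  induction δ using WellFoundedLT.induction with
  | _ δ ih =>
    have hδ' := Order.succ_le_of_lt hδ
    have hbase := hM.family_base hδ'
    obtain ⟨P, hP, hMP⟩ := hM.succ δ hδ
    have hPd : Dfn (M (Order.succ δ)).family fun _ (q : ℕ × ℕ) => P q.1 q.2 := by
      rw [hMP]
      exact (symDfn_ext₂ (Struc.closed _)).1 (Struc.symDfn_add rfl)
    have hs : Dfn N.family fun _ (q : ℕ × ℕ) => strictRel R q.1 q.2 :=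
      N.closed.and hR (N.closed.not (N.closed.eq Primrec.fst Primrec.snd))
    refine dfn_hier_of_columns hΦ h.wf_strict h.strict_trans (Struc.closed _)
      (fun s hs => (Struc.symDfn hs).mono hbase) (hs.mono hbase)
      (D := fun r => R r r ∧ ρ r < δ) ((h.dfn_initial hR δ).mono hbase) hPd fun r hr => ?_
    have h1 := (ih (ρ r) hr.2 (hr.2.trans hδ)).mono
      (hM.family_mono (Order.succ_le_of_lt hr.2) hδ.le)
    obtain ⟨k, hk⟩ := isUniversal_iff.1 hP.1 _ (dfn_nat.1 ((M δ).closed.comap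
      (c := fun m : ℕ => (m.unpair.1, m.unpair.2)) h1 (by fun_prop)))
    refine ⟨k, fun v hv y => ?_⟩
    rw [← hk]
    rw [h.strict_iff] at hv
    simp [hv]

/-- Well-founded orderings of rank less than the length of `R` pass the test of `rankOp`. -/
theorem hier_rankOp_of_le {m : ℕ} {β' : Ordinal.{0}} {ρ' : ℕ → Ordinal.{0}}
    (h' : IsRankFun (L m) β' ρ') (r : ℕ) (hr : R r r) (x : ℕ) (hx : L m x x) (hle : ρ' x ≤ ρ r) :
    hier h.wf_strict (rankOp L) r (Nat.pair m x) := by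
  induction r using h.wf_strict.induction generalizing x with
  | _ r ih =>
    rw [hier_iff]
    intro y hy
    rw [Nat.unpair_pair] at hy ⊢
    simp only at hy ⊢
    rw [h'.strict_iff] at hy
    obtain ⟨r', hr', hρ⟩ := h.surj (ρ' y) ((hy.2.2.trans_le hle).trans (h.lt r hr))
    have hlt : strictRel R r' r :=
      (h.strict_iff _ _).2 ⟨hr', hr, hρ ▸ hy.2.2.trans_le hle⟩
    exact ⟨r', hlt, ih r' hlt hr' y hy.1 hρ.ge⟩

/-- Orderings with a descending sequence fail the test of `rankOp`, as it would lead to a descending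
sequence in `R`. -/
theorem not_hier_rankOp_of_descending {m : ℕ} {x : ℕ → ℕ}
    (hx : ∀ k, strictRel (L m) (x (k + 1)) (x k)) (r k : ℕ) :
    ¬ hier h.wf_strict (rankOp L) r (Nat.pair m (x k)) := by
  induction r using h.wf_strict.induction generalizing k with
  | _ r ih =>
    intro hr
    rw [hier_iff] at hr
    have := hr (x (k + 1)) (by simpa using hx k)
    rw [Nat.unpair_pair] at this
    obtain ⟨r', hlt, hr'⟩ := this
    exact ih r' hlt (k + 1) hr'

/-- If a set and its complement have the normal form, then the lengths of the Kleene–Brouwer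
orderings belonging to the elements of the set are bounded, and the set can be recognized by
comparing these orderings with a single definable well-ordering. -/
theorem IsTarskiSequence.mem_family_of_isSig {g : ℕ → ℕ} (hg : IsCoding N g)
    {M : Ordinal.{0} → Struc} (hM : IsTarskiSequence N (Ord N) M) {E : ℕ → Prop}
    (hE : IsSig (fun _ : Unit => g) fun _ => E)
    (hE' : IsSig (fun _ : Unit => g) fun _ m => ¬ E m) :
    (fun _ => E) ∈ (M (Ord N)).family := by
  obtain ⟨K, hK, hKE⟩ := hE'
  obtain ⟨K₀, D, hK₀, hKD, hD⟩ := exists_tree_family g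
  have hL := hg.dfn_kbRel hK
  have hwo : ∀ m, E m → ∃ β ρ, IsRankFun (kbRel K g m) β ρ := fun m hm =>
    exists_isRankFun_kbRel fun hf => (hKE () m).2 hf hm
  obtain ⟨n, -, β, ρ, h, hb⟩ := exists_bound hg hK₀ hKD hD hE hL hwo
  have hR := hg.dfn_kbRel_section hK₀ n
  have hβ : β < Ord N := definableOrdinal_iff_lt.1 (definableOrdinal_of_isRankFun h hR le_rfl)
  have hH := (hM.dfn_hier h hR (isDefinableOp_rankOp hL) hβ).mono
    (hM.family_mono (Order.succ_le_of_lt hβ) le_rfl)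
  have hbase := hM.family_base (le_refl (Ord N))
  have hcl := (M (Ord N)).closed
  have key : Dfn (M (Ord N)).family fun _ (m : ℕ) => ∀ x : ℕ, kbRel K g m x x → ∃ r : ℕ,
      (kbRel K₀ g n r r ∧ ρ r < β) ∧
      hier h.wf_strict (rankOp (kbRel K g)) r (Nat.pair m x) := by
    refine hcl.all (hcl.imp ?_ (hcl.ex ?_))
    · exact hcl.comap (c := fun c : ℕ × ℕ => (c.1, c.2, c.2)) (hL.mono hbase) (by fun_prop)
    · exact hcl.comap (c := fun c : (ℕ × ℕ) × ℕ => (c.2, Nat.pair c.1.1 c.1.2)) hH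
        (by fun_prop)
  refine dfn_nat.1 (key.of_iff fun _ m => ?_)
  constructor
  · intro hm x hx
    obtain ⟨β', ρ', h'⟩ := hwo m hm
    obtain ⟨r, hr, hρ⟩ := h.surj (ρ' x) ((h'.lt x hx).trans (hb m hm β' ρ' h'))
    exact ⟨r, ⟨hr, h.lt r hr⟩, hier_rankOp_of_le h h' r hr x hx hρ.ge⟩
  · intro hall
    by_contra hm
    obtain ⟨f, hf⟩ := (hKE () m).1 hm
    obtain ⟨r, -, hr⟩ := hall (encode (pre f 0))
      (by rw [kbRel_self, Denumerable.ofNat_encode]; exact kbTree_pre hf 0)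
    exact not_hier_rankOp_of_descending h (x := fun k => encode (pre f k))
      (strictRel_kbRel_path hf) r 0 hr

/-- `Σ¹₁` sets have the normal form, after coding of their elements. -/
theorem IsSigma11.isSig {g : ℕ → ℕ} (hg : IsCoding N g) {k : ℕ} {B : Set (Fin k → ℕ)}
    (hB : IsSigma11 N B) : IsSig (fun _ : Unit => g) fun _ m =>
      ∃ v ∈ @decode (Fin k → ℕ) Primcodable.toEncodable m, v ∈ B := by
  obtain ⟨s, lam, q, hq, h⟩ := isSigma11_iff.1 hB
  refine (hg.isSig_of_scheme hq).of_iff fun _ m => ?_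
  simp only [h]
  exact ⟨fun ⟨v, hv, A, hA⟩ => ⟨A, v, hv, hA⟩, fun ⟨A, v, hv, hA⟩ => ⟨v, hv, A, hA⟩⟩

theorem IsHyperarithmetical.def_of_isTarskiSequence (hN : N.LFinite) {M : Ordinal.{0} → Struc}
    (hM : IsTarskiSequence N (Ord N) M) {k : ℕ} {B : Set (Fin k → ℕ)}
    (hB : IsHyperarithmetical N B) : (M (Ord N)).Def B := by
  obtain ⟨g, hg⟩ := exists_isCoding hN
  refine Struc.def_iff.2 (hM.mem_family_of_isSig hg (hB.1.isSig hg) ?_)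
  have h1 : IsSig (fun _ : Unit => g) fun _ m =>
      ¬ (@decode (Fin k → ℕ) Primcodable.toEncodable m).isSome = true :=
    isSig_basic (p := fun q : ℕ × List ℕ =>
      ¬ (@decode (Fin k → ℕ) Primcodable.toEncodable q.1).isSome = true)
      (primrecPred_eq (Primrec.option_isSome.comp (Primrec.decode.comp Primrec.fst))
        (Primrec.const true)).not (Primrec.const 0)
  refine ((hB.2.compl.isSig hg).or h1).of_iff fun _ m => ?_
  cases hm : @decode (Fin k → ℕ) Primcodable.toEncodable m <;> simp

end Hyperarithmetical

/-! ### Generic points of arithmetically closed families -/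

section Generic

theorem countable_schemeFamily {N : Struc} (hN : N.LFinite) {s : ℕ} (lam : Fin s → ℕ) :
    (schemeFamily N lam).Countable := by
  have hc : Countable N.carrier := hN.countable
  have h1 : Countable (Σ n, N.lang.Functions n) :=
    Function.Injective.countable (f := fun p : Σ n, N.lang.Functions n =>
      (⟨Symbol.func p.1 p.2.1, p.2.2⟩ : N.carrier)) (by
        rintro ⟨n, f, hf⟩ ⟨m, f', hf'⟩ he
        simp only [Subtype.mk.injEq, Symbol.func.injEq] at he
        obtain ⟨rfl, he⟩ := he
        cases he
        rfl)
  have h2 : Countable (Σ n, N.lang.Relations n) :=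
    Function.Injective.countable (f := fun p : Σ n, N.lang.Relations n =>
      (⟨Symbol.pred p.1 p.2.1, p.2.2⟩ : N.carrier)) (by
        rintro ⟨n, f, hf⟩ ⟨m, f', hf'⟩ he
        simp only [Subtype.mk.injEq, Symbol.pred.injEq] at he
        obtain ⟨rfl, he⟩ := he
        cases he
        rfl)
  have h3 : Countable (Σ n, (N.lang.sum (varLang lam)).Functions n) :=
    Function.Surjective.countable (f := fun p : Σ n, N.lang.Functions n =>
      (⟨p.1, Sum.inl p.2⟩ : Σ n, (N.lang.sum (varLang lam)).Functions n)) (by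
        rintro ⟨n, f | f⟩
        · exact ⟨⟨n, f⟩, rfl⟩
        · exact nomatch f)
  have h4 : Countable (Σ n, (N.lang.sum (varLang lam)).Relations n) :=
    Function.Surjective.countable (f := fun p : (Σ n, N.lang.Relations n) ⊕ Fin s =>
      (Sum.elim (fun p => ⟨p.1, Sum.inl p.2⟩) (fun i => ⟨lam i, Sum.inr (VarRel.var i)⟩) p :
        Σ n, (N.lang.sum (varLang lam)).Relations n)) (by
        rintro ⟨n, f | f⟩
        · exact ⟨Sum.inl ⟨n, f⟩, rfl⟩
        · obtain ⟨i⟩ : VarRel lam n := f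
          exact ⟨Sum.inr i, rfl⟩)
  have h5 : Countable (N.lang.sum (varLang lam)).Symbols :=
    inferInstanceAs (Countable ((Σ n, (N.lang.sum (varLang lam)).Functions n) ⊕
      (Σ n, (N.lang.sum (varLang lam)).Relations n)))
  have h6 : ∀ p : schemeFamily N lam, ∃ φ : (N.lang.sum (varLang lam)).Formula (Fin 1),
      ∀ A v, p.1 A (v 0) ↔ Scheme.Holds φ A v := fun p => fo_scheme.1 p.2
  choose φ hφ using h6
  refine Set.countable_coe_iff.1 (Function.Injective.countable (f := φ) fun p q hpq => ?_)
  refine Subtype.ext (funext fun A => funext fun m => propext ?_)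
  refine (hφ p A fun _ => m).trans ?_
  rw [hpq]
  exact (hφ q A fun _ => m).symm

variable {𝒳 : Type*}

/-- The family `τ` of statements is the theory of a generic point for `𝓒`: it treats the
first-order operations as a point of `𝒳` does. -/
structure IsGeneric (𝓒 : Set (𝒳 → ℕ → Prop)) (τ : (𝒳 → Prop) → Prop) : Prop where
  not_iff : ∀ p ∈ 𝓒, ∀ m, τ (fun x => ¬ p x m) ↔ ¬ τ fun x => p x m
  and_iff : ∀ p ∈ 𝓒, ∀ q ∈ 𝓒, ∀ m,
    τ (fun x => p x m ∧ q x m) ↔ (τ fun x => p x m) ∧ τ fun x => q x m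
  ex_iff : ∀ p ∈ 𝓒, ∀ m, τ (fun x => ∃ y, p x (Nat.pair m y)) ↔
    ∃ y, τ fun x => p x (Nat.pair m y)
  const_iff : ∀ c : Prop, τ (fun _ => c) ↔ c

/-- Consistent conditions from a countable arithmetically closed family can be extended
generically, and the generic point can be made to satisfy countably many further requirements. -/
theorem exists_isGeneric {𝓒 : Set (𝒳 → ℕ → Prop)} (h : ArithClosed 𝓒) (hc : 𝓒.Countable)
    {c : 𝒳 → ℕ → Prop} (hc𝓒 : c ∈ 𝓒) {x₀ : 𝒳} (hx₀ : c x₀ 0) (P : ℕ → Prop)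
    (hP : ∀ c' ∈ 𝓒, ∀ m₀, (∃ x, c' x m₀) → (∀ x, c' x m₀ → c x 0) →
      ∀ q ∈ 𝓒, ∃ x, c' x m₀ ∧ ∃ m, ¬ (q x m ↔ P m)) :
    ∃ τ, IsGeneric 𝓒 τ ∧ τ (fun x => c x 0) ∧
      ∀ q ∈ 𝓒, ∃ m, ¬ (τ (fun x => q x m) ↔ P m) := by
  -- conditions are nonempty sets given by relations of the family
  let Cond : Type _ := {X : Set 𝒳 // X.Nonempty ∧ (∀ x ∈ X, c x 0) ∧
    ∃ q ∈ 𝓒, ∃ m, X = {x | q x m}}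
  have hinter : ∀ (X : Cond) (q : 𝒳 → ℕ → Prop) (m : ℕ), q ∈ 𝓒 → (∃ x ∈ X.1, q x m) →
      ∃ X' : Cond, X'.1 ⊆ X.1 ∧ ∀ x ∈ X'.1, q x m := by
    rintro ⟨X, hX, hXc, p, hp, k, rfl⟩ q m hq hx
    have h1 := h.and_mem (h.comap_mem (c := fun z => z.unpair.1) hp (by fun_prop))
      (h.comap_mem (c := fun z => z.unpair.2) hq (by fun_prop))
    refine ⟨⟨{x | p x k ∧ q x m}, hx, fun x hx => hXc x hx.1, _, h1, Nat.pair k m, ?_⟩,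
      fun x hx => hx.1, fun x hx => hx.2⟩
    simp
  let Req : Type _ := (𝓒 × ℕ) ⊕ 𝓒
  let Meets : Req → Set 𝒳 → Prop := Sum.elim
    (fun p X => (∃ y, ∀ x ∈ X, p.1.1 x (Nat.pair p.2 y)) ∨
      ∀ x ∈ X, ∀ y, ¬ p.1.1 x (Nat.pair p.2 y))
    (fun q X => ∃ m, ∀ x ∈ X, ¬ (q.1 x m ↔ P m))
  have hdense : ∀ (r : Req) (X : Cond), ∃ X' : Cond, X'.1 ⊆ X.1 ∧ Meets r X'.1 := by
    rintro (⟨⟨p, hp⟩, m⟩ | ⟨q, hq⟩) X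
    · by_cases hx : ∃ y, ∃ x ∈ X.1, p x (Nat.pair m y)
      · obtain ⟨y, hx⟩ := hx
        obtain ⟨X', h1, h2⟩ := hinter X p _ hp hx
        exact ⟨X', h1, Or.inl ⟨y, h2⟩⟩
      · push Not at hx
        exact ⟨X, subset_rfl, Or.inr fun x hxX y => hx y x hxX⟩
    · obtain ⟨c', hc', m₀, hX⟩ := X.2.2.2
      obtain ⟨x, hx, m, hm⟩ := hP c' hc' m₀ (by
          obtain ⟨x, hx⟩ := X.2.1
          rw [hX] at hx
          exact ⟨x, hx⟩)
        (fun x hx => X.2.2.1 x (by rw [hX]; exact hx)) q hq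
      have hxX : x ∈ X.1 := by rw [hX]; exact hx
      by_cases hPm : P m
      · obtain ⟨X', h1, h2⟩ := hinter X _ m (h.not_mem hq) ⟨x, hxX, by tauto⟩
        exact ⟨X', h1, m, fun x hx => by have := h2 x hx; tauto⟩
      · obtain ⟨X', h1, h2⟩ := hinter X q m hq ⟨x, hxX, by tauto⟩
        exact ⟨X', h1, m, fun x hx => by have := h2 x hx; tauto⟩
  have hcount : Countable 𝓒 := hc
  have hne : Nonempty Req := ⟨Sum.inr ⟨c, hc𝓒⟩⟩
  obtain ⟨r, hr⟩ := exists_surjective_nat Req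
  choose next hnext using fun i => hdense (r i)
  let X : ℕ → Cond := fun i => Nat.rec
    ⟨{x | c x 0}, ⟨x₀, hx₀⟩, fun x hx => hx, c, hc𝓒, 0, rfl⟩ (fun i Y => next i Y) i
  have hstep : ∀ i, (X (i + 1)).1 ⊆ (X i).1 := fun i => (hnext i (X i)).1
  have hanti : Antitone fun i => (X i).1 := antitone_nat_of_succ_le hstep
  have hmeets : ∀ i, Meets (r i) (X (i + 1)).1 := fun i => (hnext i (X i)).2
  let τ : (𝒳 → Prop) → Prop := fun Z => ∃ i, ∀ x ∈ (X i).1, Z x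
  have hmono : ∀ {Z Z' : 𝒳 → Prop}, (∀ x, Z x → Z' x) → τ Z → τ Z' :=
    fun hZ ⟨i, hi⟩ => ⟨i, fun x hx => hZ x (hi x hx)⟩
  have hand : ∀ {Z Z' : 𝒳 → Prop}, τ Z → τ Z' → τ fun x => Z x ∧ Z' x := by
    rintro Z Z' ⟨i, hi⟩ ⟨j, hj⟩
    exact ⟨max i j, fun x hx => ⟨hi x (hanti (le_max_left i j) hx),
      hj x (hanti (le_max_right i j) hx)⟩⟩
  have hcons : ∀ {Z : 𝒳 → Prop}, τ Z → ∃ x, Z x := by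
    rintro Z ⟨i, hi⟩
    obtain ⟨x, hx⟩ := (X i).2.1
    exact ⟨x, hi x hx⟩
  have hex : ∀ p ∈ 𝓒, ∀ m, (∃ y, τ fun x => p x (Nat.pair m y)) ∨
      τ fun x => ∀ y, ¬ p x (Nat.pair m y) := by
    intro p hp m
    obtain ⟨i, hi⟩ := hr (Sum.inl (⟨p, hp⟩, m))
    have := hmeets i
    rw [hi] at this
    rcases this with ⟨y, hy⟩ | hy
    · exact Or.inl ⟨y, i + 1, hy⟩
    · exact Or.inr ⟨i + 1, hy⟩
  refine ⟨τ, ⟨fun p hp m => ⟨fun h1 h2 => ?_, fun h1 => ?_⟩, fun p hp q hq m =>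
    ⟨fun h1 => ⟨hmono (fun _ hx => hx.1) h1, hmono (fun _ hx => hx.2) h1⟩,
      fun h1 => hand h1.1 h1.2⟩, fun p hp m => ⟨fun h1 => ?_, ?_⟩,
    fun P => ⟨fun h1 => (hcons h1).choose_spec, fun h1 => ⟨0, fun _ _ => h1⟩⟩⟩,
    ⟨0, fun x hx => hx⟩, fun q hq => ?_⟩
  · obtain ⟨x, hx⟩ := hcons (hand h1 h2)
    exact hx.1 hx.2
  · rcases hex _ (h.comap_mem (c := fun z => z.unpair.1) hp (by fun_prop)) m with ⟨y, hy⟩ | hy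
    · simp only [Nat.unpair_pair] at hy
      exact absurd hy h1
    · simp only [Nat.unpair_pair] at hy
      exact hmono (fun x hx => hx 0) hy
  · rcases hex p hp m with h2 | h2
    · exact h2
    · obtain ⟨x, ⟨y, hy⟩, hx⟩ := hcons (hand h1 h2)
      exact absurd hy (hx y)
  · rintro ⟨y, hy⟩
    exact hmono (fun x hx => ⟨y, hx⟩) hy
  · obtain ⟨i, hi⟩ := hr (Sum.inr ⟨q, hq⟩)
    have := hmeets i
    rw [hi] at this
    obtain ⟨m, hm⟩ := this
    refine ⟨m, fun hiff => ?_⟩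
    by_cases hPm : P m
    · obtain ⟨x, hx1, hx2⟩ := hcons (hand (hiff.2 hPm) ⟨i + 1, hm⟩)
      exact hx2 (iff_of_true hx1 hPm)
    · have h1 : τ fun x => q x m := ⟨i + 1, fun x hx => by
        have := hm x hx
        tauto⟩
      exact hPm (hiff.1 h1)

/-- A theory of a generic point is the theory of a tuple of sets. -/
theorem IsGeneric.exists_tuple {N : Struc} {s : ℕ} {lam : Fin s → ℕ}
    {τ : (SetTuple lam → Prop) → Prop} (hτ : IsGeneric (schemeFamily N lam) τ) :
    ∃ A : SetTuple lam, ∀ q ∈ schemeFamily N lam, ∀ m, q A m ↔ τ fun A' => q A' m := by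
  let A : SetTuple lam := fun i => {v | τ fun A' => v ∈ A' i}
  refine ⟨A, ?_⟩
  have hcl : ArithClosed {q : SetTuple lam → ℕ → Prop | q ∈ schemeFamily N lam ∧
      ∀ m, q A m ↔ τ fun A' => q A' m} :=
    { not_mem := fun {p} hp => ⟨schemeClosed.not_mem hp.1, fun m =>
        (not_congr (hp.2 m)).trans (hτ.not_iff p hp.1 m).symm⟩
      and_mem := fun {p q} hp hq => ⟨schemeClosed.and_mem hp.1 hq.1, fun m =>
        (and_congr (hp.2 m) (hq.2 m)).trans (hτ.and_iff p hp.1 q hq.1 m).symm⟩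
      ex_mem := fun {p} hp => ⟨schemeClosed.ex_mem hp.1, fun m =>
        (exists_congr fun y => hp.2 _).trans (hτ.ex_iff p hp.1 m).symm⟩
      comap_mem := fun {p c} hp hc => ⟨schemeClosed.comap_mem hp.1 hc, fun m => hp.2 _⟩
      eq_mem := ⟨schemeClosed.eq_mem, fun m => (hτ.const_iff _).symm⟩ }
  have hsub := schemeFamily_subset (M := N) hcl (fun t ht => ?_) (fun i => ?_)
  · exact fun q hq => (hsub hq).2
  · cases t <;> exact ⟨symDfn_scheme ht, fun m => (hτ.const_iff _).symm⟩
  · refine ⟨dfn_scheme_var i, fun m => ?_⟩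
    show (∃ v ∈ @decode (Fin (lam i) → ℕ) Primcodable.toEncodable m, v ∈ A i) ↔
      τ fun A' => ∃ v ∈ @decode (Fin (lam i) → ℕ) Primcodable.toEncodable m, v ∈ A' i
    generalize @decode (Fin (lam i) → ℕ) Primcodable.toEncodable m = o
    cases o with
    | none => simpa using (hτ.const_iff False).not.2 not_false
    | some v =>
      simp only [Option.mem_def, Option.some.injEq, exists_eq_left']
      exact Iff.rfl

end Generic

/-! ### The length of Tarski sequences -/

section Length

variable {N : Struc} {g : ℕ → ℕ} {K : ℕ × List ℕ × List ℕ → Prop} {D : ℕ → Prop}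

theorem one_add_lt_ord (hN : N.LFinite) {α : Ordinal.{0}} (hα : α < Ord N) : 1 + α < Ord N := by
  have h := Ordinal.one_add_of_omega0_le (Ordinal.omega0_le_of_isSuccLimit (isSuccLimit_ord hN))
  calc 1 + α < 1 + Ord N := add_lt_add_right hα 1
    _ = Ord N := h

/-- The structures of a Tarski sequence below the ordinal of `N` are levels of jump hierarchies
along well-orderings from a fixed recursive family. -/
theorem IsTarskiSequence.exists_family_eq_levelFamily (hN : N.LFinite) (hg : IsCoding N g)
    (hK : PrimrecPred K) (hKD : ∀ m, ¬ D m ↔ ∃ f : ℕ → ℕ, ∀ k, K (m, pre f k, pre g k))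
    (hD : ¬ IsSig (fun _ : Unit => g) fun _ => D) {α mu : Ordinal.{0}} (hα : α < Ord N)
    {M : Ordinal.{0} → Struc} (hM : IsTarskiSequence N mu M) (hmu : α ≤ mu) :
    ∃ n β ρ, ∃ h : IsRankFun (kbRel K g n) β ρ, D n ∧
      (M α).family = levelFamily (kbRel K g n) ρ (hier h.wf_lex (jumpOp g)) α := by
  obtain ⟨n, hn, β, ρ, h, hlt⟩ := exists_kbRel_above hg hK hKD hD
    (definableOrdinal_iff_lt.2 (one_add_lt_ord hN hα))
  exact ⟨n, β, ρ, h, hn,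
    hM.family_eq_levelFamily h hg (hg.dfn_kbRel_section hK n) α hmu hlt.le⟩

/-- Tarski sequences of length below `Ord N` can be continued. -/
theorem IsTarskiSequence.exists_isCanonicUniversal (hN : N.LFinite) {α : Ordinal.{0}}
    (hα : α < Ord N) {M : Ordinal.{0} → Struc} (hM : IsTarskiSequence N α M) :
    ∃ P, IsCanonicUniversal (M α) P := by
  obtain ⟨g, hg⟩ := exists_isCoding hN
  obtain ⟨K, D, hK, hKD, hD⟩ := exists_tree_family g
  obtain ⟨n, β, ρ, h, -, hfam⟩ :=
    hM.exists_family_eq_levelFamily hN hg hK hKD hD hα le_rfl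
  exact ⟨_, isCanonicUniversal_reducts_below h hg (hg.dfn_kbRel_section hK n)
    (hM.family_base le_rfl) hfam⟩

/-- For every `n`, the predicate `G` has a column witnessing that the `n`-th tree has an infinite
path, or a column that satisfies the recursion equation of the jump hierarchy along the ordering
of this tree. -/
def IsDecisive (K : ℕ × List ℕ × List ℕ → Prop) (g : ℕ → ℕ) (G : ℕ → ℕ → Prop) : Prop :=
  ∀ n : ℕ, (∃ k : ℕ, (∃ x, G k x) ∧
      ∀ x, G k x → ∃ y, G k y ∧ strictRel (kbRel K g n) y x) ∨
    ∃ k : ℕ, IsHier (lexRel (kbRel K g n)) (jumpOp g)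
      (fun w => kbRel K g n w.unpair.1 w.unpair.1) fun w z => G k (Nat.pair w z)

theorem exists_isDecisive (hKD : ∀ m, ¬ D m ↔ ∃ f : ℕ → ℕ, ∀ k, K (m, pre f k, pre g k)) :
    ∃ G, IsDecisive K g G := by
  have h1 : ∀ n, ∃ A : ℕ → Prop,
      ((∃ x, A x) ∧ ∀ x, A x → ∃ y, A y ∧ strictRel (kbRel K g n) y x) ∨
      IsHier (lexRel (kbRel K g n)) (jumpOp g)
        (fun w => kbRel K g n w.unpair.1 w.unpair.1) fun w z => A (Nat.pair w z) := by
    intro n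
    by_cases hn : D n
    · obtain ⟨β, ρ, h⟩ := exists_isRankFun_kbRel (K := K) (g := g) (m := n)
        (fun hf => (hKD n).2 hf hn)
      refine ⟨fun m => hier h.wf_lex (jumpOp g) m.unpair.1 m.unpair.2, Or.inr ?_⟩
      simpa using isHier_hier h.wf_lex _
    · obtain ⟨f, hf⟩ := (hKD n).1 hn
      refine ⟨fun x => ∃ k, x = encode (pre f k), Or.inl ⟨⟨_, 0, rfl⟩, ?_⟩⟩
      rintro _ ⟨k, rfl⟩
      exact ⟨_, ⟨k + 1, rfl⟩, strictRel_kbRel_path hf k⟩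
  choose A hA using h1
  exact ⟨A, fun n => (hA n).imp (fun h => ⟨n, h⟩) fun h => ⟨n, h⟩⟩

theorem dfn_isDecisive (hg : IsCoding N g) (hK : PrimrecPred K) {𝒳 : Type}
    {𝓑 : Set (𝒳 → ℕ → Prop)} (h : ArithClosed 𝓑) (hN : ∀ s ∈ N.carrier, SymDfn 𝓑 s)
    {G : 𝒳 → ℕ → ℕ → Prop} (hG : Dfn 𝓑 fun x (q : ℕ × ℕ) => G x q.1 q.2) :
    Dfn 𝓑 fun x (_ : ℕ) => IsDecisive K g (G x) := by
  have hR := Dfn.of_structure h hN (hg.dfn_kbRel hK)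
  refine h.all (h.or (h.ex (h.and (h.ex ?_) (h.all (h.imp ?_ (h.ex (h.and ?_ ?_)))))) (h.ex ?_))
  · exact h.comap (c := fun c : ((ℕ × ℕ) × ℕ) × ℕ => (c.1.2, c.2)) hG (by fun_prop)
  · exact h.comap (c := fun c : ((ℕ × ℕ) × ℕ) × ℕ => (c.1.2, c.2)) hG (by fun_prop)
  · exact h.comap (c := fun c : (((ℕ × ℕ) × ℕ) × ℕ) × ℕ => (c.1.1.2, c.2)) hG (by fun_prop)
  · exact h.comap (c := fun c : (((ℕ × ℕ) × ℕ) × ℕ) × ℕ => (c.1.1.1.2, c.2, c.1.2))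
      (dfn_strictRel h hR) (by fun_prop)
  · refine IsDefinableOp.isHier (isDefinableOp_jumpOp hg) h hN (α := (ℕ × ℕ) × ℕ)
      (r := fun a => lexRel (kbRel K g a.1.2))
      (D := fun _ a w => kbRel K g a.1.2 w.unpair.1 w.unpair.1)
      (Y := fun x a w z => G x a.2 (Nat.pair w z)) ?_ ?_ ?_
    · exact h.comap (c := fun c : ((ℕ × ℕ) × ℕ) × ℕ × ℕ => (c.1.1.2, c.2.1, c.2.2))
        (dfn_lexRel h hR) (by fun_prop)
    · exact h.comap (c := fun c : ((ℕ × ℕ) × ℕ) × ℕ × ℕ => (c.1.2, Nat.pair c.2.1 c.2.2)) hG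
        (by fun_prop)
    · exact h.comap (c := fun c : ((ℕ × ℕ) × ℕ) × ℕ => (c.1.1.2, c.2.unpair.1, c.2.unpair.1)) hR
        (by fun_prop)

theorem IsDecisive.exists_column {G : ℕ → ℕ → Prop} (hG : IsDecisive K g G) {n : ℕ}
    {β : Ordinal.{0}} {ρ : ℕ → Ordinal.{0}} (h : IsRankFun (kbRel K g n) β ρ) :
    ∃ k, ∀ w z, kbRel K g n w.unpair.1 w.unpair.1 →
      (G k (Nat.pair w z) ↔ hier h.wf_lex (jumpOp g) w z) := by
  rcases hG n with ⟨k, hne, hmin⟩ | ⟨k, hk⟩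
  · obtain ⟨x, hx, hxmin⟩ := h.wf_strict.has_min {x | G k x} hne
    obtain ⟨y, hy, hlt⟩ := hmin x hx
    exact absurd hlt (hxmin y hy)
  · exact ⟨k, fun w z hw => hk.eq_hier h.wf_lex
      (fun v w hvw _ => ((h.lex_iff _ _).1 hvw).1) w hw z⟩

/-- Decisive predicates compute all sets definable in a Tarski sequence of length `Ord N`. -/
theorem IsDecisive.exists_reduction {G : ℕ → ℕ → Prop} (hG : IsDecisive K g G)
    (hN : N.LFinite) (hg : IsCoding N g) (hK : PrimrecPred K)
    (hKD : ∀ m, ¬ D m ↔ ∃ f : ℕ → ℕ, ∀ k, K (m, pre f k, pre g k))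
    (hD : ¬ IsSig (fun _ : Unit => g) fun _ => D) {M : Ordinal.{0} → Struc}
    (hM : IsTarskiSequence N (Ord N) M) {p : Unit → ℕ → Prop} (hp : p ∈ (M (Ord N)).family) :
    ∃ c : ℕ → ℕ, Primrec c ∧ ∀ m, p () m ↔ G (c m).unpair.1 (c m).unpair.2 := by
  obtain ⟨α, hα, hp⟩ := hM.exists_of_limit le_rfl (isSuccLimit_ord hN) hp
  obtain ⟨n, β, ρ, h, -, hfam⟩ :=
    hM.exists_family_eq_levelFamily hN hg hK hKD hD hα hα.le
  rw [hfam] at hp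
  obtain ⟨w, c, hw, -, hc, hp⟩ := hp
  obtain ⟨k, hk⟩ := hG.exists_column h
  refine ⟨fun m => Nat.pair k (Nat.pair w (c m)), by fun_prop, fun m => ?_⟩
  rw [hp, Nat.unpair_pair]
  exact (hk w _ hw).symm

/-- The final structure has no canonic universal predicate `P`. Every decisive predicate `G`
computes all sets definable in the structure, so `P` would be definable from each `G`. Being
decisive is an arithmetical property, hence `P` would be hyperarithmetical, and therefore
definable, unless there is a sufficiently generic decisive predicate from which `P` is not
definable. -/
theorem IsTarskiSequence.not_isCanonicUniversal (hN : N.LFinite) {M : Ordinal.{0} → Struc}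
    (hM : IsTarskiSequence N (Ord N) M) (P : ℕ → ℕ → Prop) :
    ¬ IsCanonicUniversal (M (Ord N)) P := by
  intro hP
  obtain ⟨g, hg⟩ := exists_isCoding hN
  obtain ⟨K, D, hK, hKD, hD⟩ := exists_tree_family g
  let lam : Fin 1 → ℕ := fun _ => 1
  let G : SetTuple lam → ℕ → ℕ → Prop := fun A k m =>
    (fun _ => Nat.pair k m : Fin 1 → ℕ) ∈ A 0
  have hGd : Dfn (schemeFamily N lam) fun A (q : ℕ × ℕ) => G A q.1 q.2 :=
    schemeClosed.comap (c := fun q : ℕ × ℕ => (fun _ => Nat.pair q.1 q.2 : Fin 1 → ℕ))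
      (dfn_scheme_var (lam := lam) 0) (primrec_finLam fun _ => by fun_prop)
  have hC := dfn_nat.1 (dfn_isDecisive hg hK schemeClosed (fun s hs => symDfn_scheme hs) hGd)
  obtain ⟨G₀, hG₀⟩ := exists_isDecisive (K := K) (g := g) hKD
  let A₀ : SetTuple lam := fun _ => {v | G₀ (v 0).unpair.1 (v 0).unpair.2}
  have hA₀ : IsDecisive K g (G A₀) := by
    have : G A₀ = G₀ := by
      funext k m
      show G₀ (Nat.pair k m).unpair.1 (Nat.pair k m).unpair.2 = G₀ k m
      rw [Nat.unpair_pair]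
    rwa [this]
  by_cases hcase : ∀ c' ∈ schemeFamily N lam, ∀ m₀, (∃ A, c' A m₀) →
      (∀ A, c' A m₀ → IsDecisive K g (G A)) → ∀ q ∈ schemeFamily N lam,
      ∃ A, c' A m₀ ∧ ∃ m : ℕ, ¬ (q A m ↔ P m.unpair.1 m.unpair.2)
  · -- a generic decisive predicate from which `P` is not definable
    obtain ⟨τ, hτ, hτC, hτP⟩ := exists_isGeneric schemeClosed (countable_schemeFamily hN lam) hC
      (x₀ := A₀) hA₀ (fun m => P m.unpair.1 m.unpair.2) hcase
    obtain ⟨A, hA⟩ := hτ.exists_tuple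
    have hdec : IsDecisive K g (G A) := (hA _ hC 0).2 hτC
    let NA := N.add (Set.range fun i => Symbol.pred (lam i) (A i))
    have hGA : Dfn NA.family fun _ (q : ℕ × ℕ) => G A q.1 q.2 := by
      have h1 : Dfn NA.family fun _ (v : Fin 1 → ℕ) => v ∈ A 0 :=
        Struc.symDfn_add (s := Symbol.pred (lam 0) (A 0)) ⟨0, rfl⟩
      exact NA.closed.comap (c := fun q : ℕ × ℕ => (fun _ => Nat.pair q.1 q.2 : Fin 1 → ℕ)) h1
        (primrec_finLam fun _ => by fun_prop)
    have hsub : (M (Ord N)).family ⊆ NA.family := by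
      intro p hp
      obtain ⟨c, hc, hp⟩ := hdec.exists_reduction hN hg hK hKD hD hM hp
      exact dfn_nat.1 ((NA.closed.comap (c := fun m : ℕ => ((c m).unpair.1, (c m).unpair.2)) hGA
        (by fun_prop)).of_iff fun _ m => hp m)
    have huniv : IsUniversal (M (Ord N))
        (reducts fun t => G A t.unpair.1 t.unpair.2) := by
      refine isUniversal_iff.2 fun p hp => ?_
      obtain ⟨c, hc, hp⟩ := hdec.exists_reduction hN hg hK hKD hD hM hp
      obtain ⟨e, he⟩ := exists_index hc
      exact ⟨e, fun m => by simp [reducts, he, hp]⟩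
    have hPd : Dfn NA.family fun _ (q : ℕ × ℕ) => P q.1 q.2 := by
      refine Dfn.mono (Struc.family_add_subset NA.closed hsub fun s hs => ?_)
        (Struc.def_ext₂.1 (hP.2 _ huniv))
      rw [Set.mem_singleton_iff.1 hs, symDfn_ext₂ NA.closed]
      exact dfn_reducts NA.closed (NA.closed.comap
        (c := fun t : ℕ => (t.unpair.1, t.unpair.2)) hGA (by fun_prop))
    have hPd' : NA.Def {v : Fin 1 → ℕ | P (v 0).unpair.1 (v 0).unpair.2} :=
      Struc.def_iff.2 (NA.closed.comap
        (c := fun v : Fin 1 → ℕ => ((v 0).unpair.1, (v 0).unpair.2)) hPd (by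
          have := Primrec.unpair.comp (primrec_finApp (f := fun v : Fin 1 → ℕ => v) 0 Primrec.id)
          exact this))
    obtain ⟨q, hq, hqP⟩ := exists_scheme_of_def_add hPd'
    have hq' : (fun A' m => q A' fun _ => m) ∈ schemeFamily N lam :=
      dfn_nat.1 (schemeClosed.comap (c := fun m : ℕ => (fun _ => m : Fin 1 → ℕ)) hq
        (primrec_finLam fun _ => Primrec.id))
    obtain ⟨m, hm⟩ := hτP _ hq'
    refine hm ?_
    rw [← hA _ hq' m]
    exact (hqP fun _ => m).symm
  · -- an arithmetical class on which `P` is defined by a single scheme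
    push Not at hcase
    obtain ⟨c', hc', m₀, ⟨A₁, hA₁⟩, -, q, hq, hqP⟩ := hcase
    have hc'' : Dfn (schemeFamily N lam) fun A (_ : ℕ) => c' A m₀ :=
      schemeClosed.comap (dfn_nat.2 hc') (Primrec.const m₀)
    have h1 := hg.isSig_of_scheme (dfn_nat.1 (schemeClosed.and hc'' (dfn_nat.2 hq)))
    have h2 := hg.isSig_of_scheme
      (dfn_nat.1 (schemeClosed.and hc'' (schemeClosed.not (dfn_nat.2 hq))))
    have h3 := hM.mem_family_of_isSig hg (E := fun m => P m.unpair.1 m.unpair.2)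
      (h1.of_iff fun _ m => ⟨fun h => ⟨A₁, hA₁, (hqP A₁ hA₁ m).2 h⟩,
        fun ⟨A, hA, h⟩ => (hqP A hA m).1 h⟩)
      (h2.of_iff fun _ m => ⟨fun h => ⟨A₁, hA₁, fun h' => h ((hqP A₁ hA₁ m).1 h')⟩,
        fun ⟨A, hA, h⟩ h' => h ((hqP A hA m).2 h')⟩)
    refine hP.1.not_dfn (((Struc.closed _).comap (c := fun q : ℕ × ℕ => Nat.pair q.1 q.2)
      (dfn_nat.2 h3) (by fun_prop)).of_iff fun _ q => ?_)
    simp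

/-- No Tarski sequence is longer than `Ord N`. -/
theorem IsTarskiSequence.le_ord (hN : N.LFinite) {mu : Ordinal.{0}} {M : Ordinal.{0} → Struc}
    (hM : IsTarskiSequence N mu M) : mu ≤ Ord N := by
  by_contra! hlt
  obtain ⟨P, hP, -⟩ := hM.succ _ hlt
  exact (hM.mono hlt.le).not_isCanonicUniversal hN P hP

end Length

/-! ### Tarski hierarchies and implicit definability -/

section Final

variable {N : Struc}

open Classical in
/-- The structure that follows `M` in a Tarski sequence, if there is one. -/
noncomputable def nextStruc (M : Struc) : Struc :=
  if h : ∃ P, IsCanonicUniversal M P then M.add {Symbol.pred 2 (ext₂ h.choose)} else M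

/-- The Tarski sequence over `N` with a choice of canonic universal predicates. -/
noncomputable def tarskiSeq (N : Struc) (α : Ordinal.{0}) : Struc :=
  Ordinal.limitRecOn (motive := fun _ => Struc) α N (fun _ M => nextStruc M)
    fun β _ M => ⟨arithmetic ∪ ⋃ γ, ⋃ h : γ < β, (M γ h).carrier, Set.subset_union_left⟩

/-- The choices succeed below `Ord N`. -/
theorem isTarskiSequence_tarskiSeq (hN : N.LFinite) {α : Ordinal.{0}} (hα : α ≤ Ord N) :
    IsTarskiSequence N α (tarskiSeq N) := by
  induction α using WellFoundedLT.induction with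
  | _ α ih =>
    refine ⟨Ordinal.limitRecOn_zero .., fun γ hγ => ?_, fun β hβ hl => ?_⟩
    · have hex := (ih γ hγ (hγ.le.trans hα)).exists_isCanonicUniversal hN (hγ.trans_le hα)
      refine ⟨hex.choose, hex.choose_spec, ?_⟩
      have h1 : tarskiSeq N (Order.succ γ) = nextStruc (tarskiSeq N γ) := by
        rw [Order.succ_eq_add_one]
        exact Ordinal.limitRecOn_add_one ..
      rw [h1, nextStruc, dif_pos hex]
    · have h1 : (tarskiSeq N β).carrier =
          arithmetic ∪ ⋃ γ, ⋃ _ : γ < β, (tarskiSeq N γ).carrier :=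
        congrArg Struc.carrier (Ordinal.limitRecOn_limit (motive := fun _ => Struc) β N
          (fun _ M => nextStruc M) (fun β _ M =>
            ⟨arithmetic ∪ ⋃ γ, ⋃ h : γ < β, (M γ h).carrier, Set.subset_union_left⟩) hl)
      rw [h1]
      refine Set.union_eq_right.2 ((tarskiSeq N 0).arith.trans ?_)
      have h0 : 0 < β := pos_iff_ne_zero.2 fun h => hl.not_isMin (h ▸ isMin_bot)
      exact Set.subset_biUnion_of_mem (u := fun γ => (tarskiSeq N γ).carrier) h0

theorem exists_isTarskiHierarchy (hN : N.LFinite) : ∃ lam M, IsTarskiHierarchy N lam M :=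
  ⟨Ord N, tarskiSeq N,
    { toIsTarskiSequence := isTarskiSequence_tarskiSeq hN le_rfl
      maximal := fun _ _ hM _ => hM.le_ord hN }⟩

/-- A shorter hierarchy could be continued by one more step, against its maximality. -/
theorem IsTarskiHierarchy.eq_ord (hN : N.LFinite) {lam : Ordinal.{0}} {M : Ordinal.{0} → Struc}
    (hM : IsTarskiHierarchy N lam M) : lam = Ord N := by
  classical
  refine le_antisymm (hM.toIsTarskiSequence.le_ord hN) ?_
  by_contra! hlt
  obtain ⟨P, hP⟩ := hM.toIsTarskiSequence.exists_isCanonicUniversal hN hlt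
  have hle : ∀ α ≤ lam, (if α ≤ lam then M α else
      (M lam).add {Symbol.pred 2 (ext₂ P)}) = M α := fun α hα => if_pos hα
  refine absurd (hM.maximal (Order.succ lam) (fun α => if α ≤ lam then M α else
    (M lam).add {Symbol.pred 2 (ext₂ P)}) ⟨?_, fun α hα => ?_, fun β hβ hl => ?_⟩ hle)
    (not_le.2 (Order.lt_succ lam))
  · rw [hle 0 zero_le, hM.zero]
  · have hα := Order.lt_succ_iff.1 hα
    rw [hle α hα]
    rcases hα.lt_or_eq with hα' | rfl
    · rw [hle _ (Order.succ_le_of_lt hα')]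
      exact hM.succ α hα'
    · exact ⟨P, hP, if_neg (not_le.2 (Order.lt_succ _))⟩
  · have hβ' : β ≤ lam := by
      rcases hβ.lt_or_eq with h | rfl
      · exact Order.lt_succ_iff.1 h
      · exact absurd hl (Order.not_isSuccLimit_succ lam)
    rw [hle β hβ', hM.limit β hβ' hl]
    refine Set.iUnion₂_congr fun α hα => ?_
    rw [hle α (hα.le.trans hβ')]

/-- Sets definable in the hierarchy are implicitly definable: the jump hierarchy along a definable
well-ordering is the only solution of its recursion equation. -/
theorem IsTarskiSequence.implicitlyDefinable (hN : N.LFinite) {M : Ordinal.{0} → Struc}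
    (hM : IsTarskiSequence N (Ord N) M) {k : ℕ} {B : Set (Fin k → ℕ)} (hB : (M (Ord N)).Def B) :
    ImplicitlyDefinable N B := by
  obtain ⟨g, hg⟩ := exists_isCoding hN
  obtain ⟨K, D, hK, hKD, hD⟩ := exists_tree_family g
  obtain ⟨α, hα, hp⟩ := hM.exists_of_limit le_rfl (isSuccLimit_ord hN) (Struc.def_iff.1 hB)
  obtain ⟨n, β, ρ, h, -, hfam⟩ :=
    hM.exists_family_eq_levelFamily hN hg hK hKD hD hα hα.le
  rw [hfam] at hp
  obtain ⟨w, c, hw, -, hc, hp⟩ := hp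
  have hR := hg.dfn_kbRel_section hK n
  generalize kbRel K g n = R at h hfam hw hp hR
  let lam : Fin 1 → ℕ := fun _ => 2
  let H : ℕ → ℕ → Prop := fun v z => R v.unpair.1 v.unpair.1 ∧ hier h.wf_lex (jumpOp g) v z
  let A : SetTuple lam := fun _ => ext₂ H
  refine ⟨1, lam, A, hasProperImplicitDef_iff.2 ⟨fun A' _ =>
    (∀ v z : ℕ, ![v, z] ∈ A' 0 → R v.unpair.1 v.unpair.1) ∧
      IsHier (lexRel R) (jumpOp g) (fun v => R v.unpair.1 v.unpair.1)
        (fun v z => ![v, z] ∈ A' 0), ?_, fun A' => ?_⟩, ?_⟩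
  · have hcl := schemeClosed (M := N) (lam := lam)
    have hA : Dfn (schemeFamily N lam) fun A' (q : ℕ × ℕ) => ![q.1, q.2] ∈ A' 0 :=
      (dfn_vec₂ hcl (R := fun (A' : SetTuple lam) v z => ![v, z] ∈ A' 0)).1
        ((dfn_scheme_var (M := N) (lam := lam) 0).of_iff fun A' v => by
          have : ![v 0, v 1] = v := by
            ext i
            fin_cases i <;> rfl
          rw [this])
    have hR' := hR.scheme (lam := lam)
    refine dfn_nat.1 (hcl.and (hcl.all (hcl.all (hcl.imp ?_ ?_))) ?_)
    · exact hcl.comap (c := fun c : (ℕ × ℕ) × ℕ => (c.1.2, c.2)) hA (by fun_prop)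
    · exact hcl.comap (c := fun c : (ℕ × ℕ) × ℕ => (c.1.2.unpair.1, c.1.2.unpair.1)) hR'
        (by fun_prop)
    · refine IsDefinableOp.isHier (isDefinableOp_jumpOp hg) hcl (fun s hs => symDfn_scheme hs)
        (α := ℕ) (r := fun _ => lexRel R) (D := fun _ _ v => R v.unpair.1 v.unpair.1)
        (Y := fun A' _ v z => ![v, z] ∈ A' 0) ?_ ?_ ?_
      · exact dfn_lexRel hcl (R := fun _ : ℕ => R)
          (hcl.comap (c := fun c : ℕ × ℕ × ℕ => (c.2.1, c.2.2)) hR' (by fun_prop))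
      · exact hcl.comap (c := fun c : ℕ × ℕ × ℕ => (c.2.1, c.2.2)) hA (by fun_prop)
      · exact hcl.comap (c := fun c : ℕ × ℕ => (c.2.unpair.1, c.2.unpair.1)) hR' (by fun_prop)
  · have hdown : ∀ v u, lexRel R v u → R u.unpair.1 u.unpair.1 → R v.unpair.1 v.unpair.1 :=
      fun v u hvu _ => ((h.lex_iff _ _).1 hvu).1
    constructor
    · rintro ⟨h1, h2⟩
      funext i
      obtain rfl : i = 0 := Subsingleton.elim _ _
      ext v
      have hv : v = ![v 0, v 1] := by
        ext i
        fin_cases i <;> rfl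
      show v ∈ A' 0 ↔ H (v 0) (v 1)
      rw [hv]
      constructor
      · intro hv
        have := h1 _ _ hv
        exact ⟨this, (h2.eq_hier h.wf_lex hdown _ this _).1 hv⟩
      · rintro ⟨h3, h4⟩
        exact (h2.eq_hier h.wf_lex hdown _ h3 _).2 h4
    · rintro rfl
      refine ⟨fun v z hv => hv.1, fun v hv z => ?_⟩
      have htr : trunc (lexRel R) (fun v z => ![v, z] ∈ A 0) v =
          trunc (lexRel R) (hier h.wf_lex (jumpOp g)) v := by
        ext u y
        exact and_congr_right fun huv => and_iff_right (hdown u v huv hv)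
      rw [htr, ← hier_iff (Φ := jumpOp g) h.wf_lex]
      exact and_iff_right hv
  · let NA := N.add (Set.range fun i => Symbol.pred (lam i) (A i))
    have hH : Dfn NA.family fun _ (q : ℕ × ℕ) => H q.1 q.2 :=
      (symDfn_ext₂ NA.closed).1 (Struc.symDfn_add (s := Symbol.pred (lam 0) (A 0)) ⟨0, rfl⟩)
    refine Struc.def_iff.2 (dfn_nat.1 ((NA.closed.comap (c := fun m : ℕ => (w, c m)) hH
      (by fun_prop)).of_iff fun x m => (hp m).trans (and_iff_right hw).symm))

/-- The set of the codes of the elements of `B`. -/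
def codes {k : ℕ} (B : Set (Fin k → ℕ)) : Set (Fin 1 → ℕ) :=
  {v | ∃ b ∈ @decode (Fin k → ℕ) Primcodable.toEncodable (v 0), b ∈ B}

theorem Struc.def_codes {M : Struc} {k : ℕ} {B : Set (Fin k → ℕ)} :
    M.Def (codes B) ↔ M.Def B := by
  rw [Struc.def_iff, Struc.def_iff]
  exact dfn_vec₁ M.closed (R := fun _ m =>
    ∃ b ∈ @decode (Fin k → ℕ) Primcodable.toEncodable m, b ∈ B)

end Final

end TarskiHierarchy

theorem theorem1 (N : TarskiHierarchy.Struc) (hN : N.LFinite) :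
    -- a Tarski hierarchy over `N` exists
    (∃ lam M, TarskiHierarchy.IsTarskiHierarchy N lam M) ∧
    ∀ (lam : Ordinal.{0}) (M : Ordinal.{0} → TarskiHierarchy.Struc),
      TarskiHierarchy.IsTarskiHierarchy N lam M →
      -- its length is the maximal length of a sequence of this kind, and is countable
      IsGreatest {mu | ∃ M', TarskiHierarchy.IsTarskiSequence N mu M'} lam ∧
      lam.card ≤ Cardinal.aleph0 ∧
      -- it is the first ordinal not definable in `N`, i.e. the first one not recursive in `N`
      lam = TarskiHierarchy.Ord N ∧
      lam = sInf {α | ¬ TarskiHierarchy.RecursiveOrdinal N α} ∧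
      -- the final structure contains all sets implicitly definable in `N` ...
      (∀ (k : ℕ) (B : Set (Fin k → ℕ)),
        TarskiHierarchy.ImplicitlyDefinable N B → (M lam).Def B) ∧
      -- ... and is minimal with this property, so that it is equivalent to `𝓘(N)`
      (∀ M' : TarskiHierarchy.Struc,
        (∀ X : Set (Fin 1 → ℕ), TarskiHierarchy.ImplicitlyDefinable N X → M'.Def X) →
        ∀ (k : ℕ) (B : Set (Fin k → ℕ)), (M lam).Def B → M'.Def B) ∧
      (M lam).Equivalent (TarskiHierarchy.implicitClosure N) ∧
      -- its definable sets are those implicitly definable in `N`, i.e. hyperarithmetical in `N`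
      (∀ (k : ℕ) (B : Set (Fin k → ℕ)),
        (M lam).Def B ↔ TarskiHierarchy.ImplicitlyDefinable N B) ∧
      (∀ (k : ℕ) (B : Set (Fin k → ℕ)),
        (M lam).Def B ↔ TarskiHierarchy.IsHyperarithmetical N B) := by
  refine ⟨TarskiHierarchy.exists_isTarskiHierarchy hN, fun lam M hM => ?_⟩
  obtain rfl := hM.eq_ord hN
  have hseq := hM.toIsTarskiSequence
  have hdi : ∀ {k : ℕ} {B : Set (Fin k → ℕ)}, (M (TarskiHierarchy.Ord N)).Def B →
      TarskiHierarchy.ImplicitlyDefinable N B := fun hB => hseq.implicitlyDefinable hN hB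
  have hhd : ∀ {k : ℕ} {B : Set (Fin k → ℕ)}, TarskiHierarchy.IsHyperarithmetical N B →
      (M (TarskiHierarchy.Ord N)).Def B := fun hB => hB.def_of_isTarskiSequence hN hseq
  have hmin : ∀ M' : TarskiHierarchy.Struc,
      (∀ X : Set (Fin 1 → ℕ), TarskiHierarchy.ImplicitlyDefinable N X → M'.Def X) →
      ∀ (k : ℕ) (B : Set (Fin k → ℕ)), (M (TarskiHierarchy.Ord N)).Def B → M'.Def B :=
    fun M' hM' k B hB => TarskiHierarchy.Struc.def_codes.1
      (hM' _ (hdi (TarskiHierarchy.Struc.def_codes.2 hB)))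
  refine ⟨⟨⟨M, hseq⟩, ?_⟩, TarskiHierarchy.card_ord_le hN, rfl, ?_,
    fun k B hB => hhd hB.isHyperarithmetical, hmin, ?_,
    fun k B => ⟨hdi, fun hB => hhd hB.isHyperarithmetical⟩,
    fun k B => ⟨fun hB => (hdi hB).isHyperarithmetical, hhd⟩⟩
  · rintro mu ⟨M', hM'⟩
    exact hM'.le_ord hN
  · simp only [← TarskiHierarchy.definableOrdinal_iff_recursiveOrdinal hN]
    rfl
  · apply Set.Subset.antisymm
    · intro X hX
      exact hmin _ (fun Y hY => TarskiHierarchy.Struc.def_iff.2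
        (TarskiHierarchy.Struc.symDfn (M := TarskiHierarchy.implicitClosure N)
          (s := .pred 1 Y) (Or.inr ⟨Y, hY, rfl⟩))) 1 _ hX
    · intro X hX
      rw [TarskiHierarchy.Struc.mem_defSets] at hX ⊢
      refine TarskiHierarchy.Struc.family_add_subset (TarskiHierarchy.Struc.closed _)
        (hseq.family_base le_rfl) ?_ hX
      rintro _ ⟨Y, hY, rfl⟩
      exact TarskiHierarchy.Struc.def_iff.1 (hhd hY.isHyperarithmetical)
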